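/- **The $\mathcal W_3$ algebra at $c=-2$ and its vacuum module.** Let $c=-2$. The $\mathcal W_3$ algebra has generators $L_n,W_n$ $(n\in\mathbb Z)$ and relations $$[L_m,L_n]=(m-n)L_{m+n}+\tfrac{c}{12}(m^3-m)\delta_{m,-n},\qquad [L_m,W_n]=(2m-n)W_{m+n},$$ $$[W_m,W_n]=(m-n)\Bigl(\tfrac1{15}(m+n+3)(m+n+2)-\tfrac16(m+2)(n+2)\Bigr)L_{m+n}+\tfrac{16}{22+5c}(m-n)\Lambda_{m+n}+\tfrac{c}{360}m(m^2-1)(m^2-4)\delta_{m,-n},$$ where $$\Lambda_m=\sum_{n\le-2}L_nL_{m-n}+\sum_{n>-2}L_{m-n}L_n-\tfrac3{10}(m+2)(m+3)L_m .$$ On the highest weight modules considered here this sum is finite on every vector. Let $\mathcal M(0,0)$ be the Verma module with highest weight vector $|0\rangle$, where $L_n|0\rangle=W_n|0\rangle=0$ for $n\ge0$. Let the vacuum module $\mathcal{VM}_{-2}$ be the quotient of $\mathcal M(0,0)$ by the submodule generated by $L_{-1}|0\rangle$, $W_{-1}|0\rangle$, $W_{-2}|0\rangle$. **Zhu algebra.**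 For an $\mathbb N$-graded vertex algebra $V$ with fields $Y(a,z)=\sum_n a_{(n)}z^{-n-1}$, define bilinear operations, for $a$ homogeneous of weight $\mathrm{wt}\,a$, by $$a*b=\mathrm{Res}_z\Bigl(Y(a,z)\tfrac{(z+1)^{\mathrm{wt}\,a}}{z}\,b\Bigr),\qquad a\circ b=\mathrm{Res}_z\Bigl(Y(a,z)\tfrac{(z+1)^{\mathrm{wt}\,a}}{z^2}\,b\Bigr).$$ Let $O(V)$ be the span of all $a\circ b$, let $A(V)=V/O(V)$ with the product induced by $*$ and unit the class of the vacuum, and let $[a]\in A(V)$ be the class of $a$. **Statement.** $\mathcal{VM}_{-2}$ carries a vertex algebra structure with vacuum vector $|0\rangle$, graded by $L_0$, such that $$Y(L_{-2}|0\rangle,z)=\sum_nL_nz^{-n-2},\qquad Y(W_{-3}|0\rangle,z)=\sum_nW_nz^{-n-3}.$$ For this structure, put $\widetilde W_n=\frac{\sqrt6}{2}W_n$. There is an isomorphism of unital algebras $\sigma:A(\mathcal{VM}_{-2})\to\mathbb C[t,w]$ with $\sigma([L_{-2}|0\rangle])=t$ and $\sigma([\widetilde W_{-3}|0\rangle])=w$.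 Under this isomorphism, the vectors $$v_s=\Bigl(\tfrac32W_{-3}^2-\tfrac{19}{36}L_{-3}^2-\tfrac89L_{-2}^3-\tfrac{14}9L_{-2}L_{-4}+\tfrac{44}9L_{-6}\Bigr)|0\rangle,$$ $$v_s'=\Bigl(\tfrac92W_{-6}+9L_{-3}W_{-3}-6L_{-2}W_{-4}\Bigr)|0\rangle$$ of $\mathcal{VM}_{-2}$ satisfy $$\sigma([v_s])=w^2-\tfrac19t^2(8t+1),\qquad \sigma([v_s'])=0 .$$ -/

import Mathlib

/-- A (`ℕ`-graded) vertex algebra structure on a complex vector space `V`.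
The field of `a` is `Y(a, z) = ∑ₙ a_(n) z^(-n-1)`, with `a_(n) = Y a n`; the axioms are
written coefficientwise. -/
structure VertexAlgebra (V : Type*) [AddCommGroup V] [Module ℂ V] where
  /-- the homogeneous components `V_n` -/
  grading : ℕ → Submodule ℂ V
  isInternal : DirectSum.IsInternal grading
  /-- the vacuum vector -/
  vac : V
  /-- the degree operator -/
  L0 : Module.End ℂ V
  /-- the translation operator -/
  T : Module.End ℂ V
  /-- the state-field correspondence -/
  Y : V →ₗ[ℂ] (ℤ → Module.End ℂ V)
  /-- `Y(a, z)` is a field: `Y(a, z) b` has only finitely many negative powers of `z`. -/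
  field : ∀ a b : V, ∃ N : ℤ, ∀ n : ℤ, N ≤ n → Y a n b = 0
  /-- `Y(|0⟩, z) = id` -/
  Y_vac : ∀ n : ℤ, Y vac n = if n = -1 then 1 else 0
  /-- `Y(a, z)|0⟩` is regular at `z = 0` -/
  Y_apply_vac_of_nonneg : ∀ (a : V) (n : ℤ), 0 ≤ n → Y a n vac = 0
  /-- with value `a` there -/
  Y_apply_vac : ∀ a : V, Y a (-1) vac = a
  /-- `L₀ = n` on `V_n` -/
  L0_apply : ∀ (n : ℕ) (a : V), a ∈ grading n → L0 a = (n : ℂ) • a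
  /-- `[L₀, Y(a, z)] = z ∂_z Y(a, z) + Y(L₀ a, z)` -/
  L0_comm : ∀ (a : V) (n : ℤ),
    L0 * Y a n - Y a n * L0 = (-(n : ℂ) - 1) • Y a n + Y (L0 a) n
  /-- `[T, Y(a, z)] = ∂_z Y(a, z)` -/
  T_comm : ∀ (a : V) (n : ℤ), T * Y a n - Y a n * T = (-(n : ℂ)) • Y a (n - 1)
  T_vac : T vac = 0
  /-- `(z - w)^N [Y(a, z), Y(b, w)] = 0` for some `N` (hence for all larger ones) -/
  locality : ∀ a b : V, ∃ N : ℕ, ∀ m n : ℤ,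
    ∑ j ∈ Finset.range (N + 1), ((-1 : ℂ) ^ j * (N.choose j : ℂ)) •
      (Y a (m + N - j) * Y b (n + j) - Y b (n + j) * Y a (m + N - j)) = 0

namespace VertexAlgebra

variable {V : Type*} [AddCommGroup V] [Module ℂ V] (𝒱 : VertexAlgebra V)

/-- The linear map `a ↦ (b ↦ Res_z (Y(a, z) (z + 1)^p / z^k b))`, where
`Res_z` picks the coefficient of `z⁻¹`, so that
`Res_z (Y(a, z) (z + 1)^p / z^k) = ∑ j ≤ p, (p choose j) a_(j - k)`. -/
noncomputable def residue (p : ℕ) (k : ℤ) : V →ₗ[ℂ] Module.End ℂ V :=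
  ∑ j ∈ Finset.range (p + 1), (p.choose j : ℂ) •
    (LinearMap.proj ((j : ℤ) - k) ∘ₗ 𝒱.Y)

theorem bijective_coeLinearMap : Function.Bijective (DirectSum.coeLinearMap 𝒱.grading) :=
  𝒱.isInternal

/-- The decomposition `V ≃ ⨁ₙ V_n`. -/
noncomputable def decomp : V ≃ₗ[ℂ] DirectSum ℕ (fun n => 𝒱.grading n) :=
  (LinearEquiv.ofBijective (DirectSum.coeLinearMap 𝒱.grading) 𝒱.bijective_coeLinearMap).symm

/-- The bilinear operation with `(a, b) ↦ Res_z (Y(a, z) (z + 1)^(wt a) / z^k b)`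
for `a` homogeneous. -/
noncomputable def zhuOp (k : ℤ) : V →ₗ[ℂ] Module.End ℂ V :=
  DirectSum.toModule ℂ ℕ (Module.End ℂ V)
    (fun p => 𝒱.residue p k ∘ₗ (𝒱.grading p).subtype) ∘ₗ 𝒱.decomp.toLinearMap

theorem zhuOp_of_mem (k : ℤ) {p : ℕ} {a : V} (ha : a ∈ 𝒱.grading p) (b : V) :
    𝒱.zhuOp k a b = ∑ j ∈ Finset.range (p + 1), (p.choose j : ℂ) • 𝒱.Y a ((j : ℤ) - k) b := by
  have h : 𝒱.decomp a = DirectSum.lof ℂ ℕ (fun n => 𝒱.grading n) p ⟨a, ha⟩ := by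
    rw [decomp, LinearEquiv.symm_apply_eq]
    simp [DirectSum.coeLinearMap_lof]
  simp [zhuOp, h, residue, LinearMap.sum_apply]

/-- `a * b = Res_z (Y(a, z) (z + 1)^(wt a) / z b)` -/
noncomputable def star (a b : V) : V := 𝒱.zhuOp 1 a b

/-- `a ∘ b = Res_z (Y(a, z) (z + 1)^(wt a) / z² b)` -/
noncomputable def circ (a b : V) : V := 𝒱.zhuOp 2 a b

/-- `O(V)`, the span of all `a ∘ b`. -/
noncomputable def O : Submodule ℂ V :=
  Submodule.span ℂ {x | ∃ a b : V, x = 𝒱.circ a b}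

/-- The space `A(V) = V / O(V)`. -/
abbrev ZhuAlgebra : Type _ := V ⧸ 𝒱.O

/-- The class `[a]` in `A(V)`. -/
noncomputable def zhuClass (a : V) : 𝒱.ZhuAlgebra := Submodule.Quotient.mk a

/-- The linear isomorphism `σ : A(V) ≃ B` is an isomorphism of unital algebras, where the
product of `A(V)` is the one induced by `*`, `[a] [b] = [a * b]`, and its unit is `[|0⟩]`. -/
structure IsZhuAlgebraIso {B : Type*} [Ring B] [Algebra ℂ B]
    (σ : 𝒱.ZhuAlgebra ≃ₗ[ℂ] B) : Prop where
  map_star : ∀ a b : V,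
    σ (𝒱.zhuClass (𝒱.star a b)) = σ (𝒱.zhuClass a) * σ (𝒱.zhuClass b)
  map_vac : σ (𝒱.zhuClass 𝒱.vac) = 1

end VertexAlgebra

namespace WThree

/-- The generators `L_n`, `W_n` (`n ∈ ℤ`) of the `W₃` algebra. -/
inductive Gen : Type
  | L (n : ℤ) : Gen
  | W (n : ℤ) : Gen

/-- The index of a generator. -/
def Gen.index : Gen → ℤ
  | .L n => n
  | .W n => n

/-- The free associative algebra on the `L_n`, `W_n`. -/
abbrev FreeAlg : Type := FreeAlgebra ℂ Gen

noncomputable def genL (n : ℤ) : FreeAlg := FreeAlgebra.ι ℂ (Gen.L n)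

noncomputable def genW (n : ℤ) : FreeAlg := FreeAlgebra.ι ℂ (Gen.W n)

/-- The monomial `x₁ x₂ ⋯ x_k` in the generators. -/
noncomputable def monomial (l : List Gen) : FreeAlg := (l.map (FreeAlgebra.ι ℂ)).prod

/-- The sum of the indices of a monomial. -/
def degree (l : List Gen) : ℤ := (l.map Gen.index).sum

/-- `[L_m, L_n] - (m - n) L_{m+n} - c/12 (m³ - m) δ_{m,-n}` -/
noncomputable def relLL (c : ℂ) (m n : ℤ) : FreeAlg :=
  genL m * genL n - genL n * genL m
    - (((m : ℂ) - n) • genL (m + n)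
      + (if m = -n then c / 12 * ((m : ℂ) ^ 3 - m) else 0) • (1 : FreeAlg))

/-- `[L_m, W_n] - (2m - n) W_{m+n}` -/
noncomputable def relLW (m n : ℤ) : FreeAlg :=
  genL m * genW n - genW n * genL m - (2 * (m : ℂ) - n) • genW (m + n)

/-- The truncation of
`Λ_m = ∑_{n ≤ -2} L_n L_{m-n} + ∑_{n > -2} L_{m-n} L_n - 3/10 (m + 2)(m + 3) L_m`
to the summation indices `-K ≤ n ≤ K`. -/
noncomputable def truncLambda (K m : ℤ) : FreeAlg :=
  ∑ n ∈ Finset.Icc (-K) (-2), genL n * genL (m - n)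
    + ∑ n ∈ Finset.Icc (-1) K, genL (m - n) * genL n
    - (3 / 10 * ((m : ℂ) + 2) * ((m : ℂ) + 3)) • genL m

/-- The difference of the two sides of the commutation relation for `[W_m, W_n]`, with
`Λ_{m+n}` truncated to summation indices between `-K` and `K`. -/
noncomputable def relWW (c : ℂ) (K m n : ℤ) : FreeAlg :=
  genW m * genW n - genW n * genW m
    - ((((m : ℂ) - n) * (1 / 15 * ((m : ℂ) + n + 3) * ((m : ℂ) + n + 2)
          - 1 / 6 * ((m : ℂ) + 2) * ((n : ℂ) + 2))) • genL (m + n)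
      + (16 / (22 + 5 * c) * ((m : ℂ) - n)) • truncLambda K (m + n)
      + (if m = -n then c / 360 * (m : ℂ) * ((m : ℂ) ^ 2 - 1) * ((m : ℂ) ^ 2 - 4) else 0)
          • (1 : FreeAlg))

/-- The elements `x` of the free algebra for which `x |t, w⟩ = 0` is imposed in the Verma module:
the highest weight conditions, the defining relations of the `W₃` algebra applied to the
vectors `monomial l |t, w⟩`, and the vanishing of the vectors of `L₀`-weight `t - d`, `d > 0`
(which holds in every highest weight module). The latter makes the infinite sum `Λ_{m+n}` finite
on `monomial l |t, w⟩`: all its terms outside `-K ≤ n ≤ K` vanish there as soon as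
`|m + n| + |degree l| ≤ K`. -/
inductive VermaRel (c t w : ℂ) : FreeAlg → Prop
  | L_pos (n : ℤ) (hn : 0 < n) : VermaRel c t w (genL n)
  | W_pos (n : ℤ) (hn : 0 < n) : VermaRel c t w (genW n)
  | L_zero : VermaRel c t w (genL 0 - t • (1 : FreeAlg))
  | W_zero : VermaRel c t w (genW 0 - w • (1 : FreeAlg))
  | degree_pos (l : List Gen) (hl : 0 < degree l) : VermaRel c t w (monomial l)
  | LL (m n : ℤ) (l : List Gen) : VermaRel c t w (relLL c m n * monomial l)
  | LW (m n : ℤ) (l : List Gen) : VermaRel c t w (relLW m n * monomial l)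
  | WW (m n K : ℤ) (l : List Gen) (hK : |m + n| + |degree l| ≤ K) :
      VermaRel c t w (relWW c K m n * monomial l)

/-- The annihilator of `|t, w⟩`: the left ideal generated by the relations above. -/
def vermaIdeal (c t w : ℂ) : Submodule FreeAlg FreeAlg :=
  Submodule.span FreeAlg {x | VermaRel c t w x}

/-- The Verma module `M_c(t, w)`. -/
abbrev Verma (c t w : ℂ) : Type := FreeAlg ⧸ vermaIdeal c t w

/-- The highest weight vector `|t, w⟩`. -/
noncomputable def hwVec (c t w : ℂ) : Verma c t w := Submodule.Quotient.mk 1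

/-- The submodule of `M_c(0, 0)` generated by `L_{-1}|0⟩`, `W_{-1}|0⟩`, `W_{-2}|0⟩`. -/
noncomputable def vacuumSub (c : ℂ) : Submodule FreeAlg (Verma c 0 0) :=
  Submodule.span FreeAlg
    {genL (-1) • hwVec c 0 0, genW (-1) • hwVec c 0 0, genW (-2) • hwVec c 0 0}

/-- The vacuum module `M_c`. -/
abbrev VacuumModule (c : ℂ) : Type := Verma c 0 0 ⧸ vacuumSub c

/-- The vacuum vector `|0⟩` of `M_c`. -/
noncomputable def vac (c : ℂ) : VacuumModule c := Submodule.Quotient.mk (hwVec c 0 0)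

/-- The operator `L_n` on `M_c`. -/
noncomputable def opL (c : ℂ) (n : ℤ) : Module.End ℂ (VacuumModule c) :=
  Algebra.lsmul ℂ ℂ (VacuumModule c) (genL n)

/-- The operator `W_n` on `M_c`. -/
noncomputable def opW (c : ℂ) (n : ℤ) : Module.End ℂ (VacuumModule c) :=
  Algebra.lsmul ℂ ℂ (VacuumModule c) (genW n)

/-- `𝒱` is the vertex algebra structure of the vacuum module `M_c`: the vacuum vector is `|0⟩`,
the gradation is by `L₀`, and the fields of `L_{-2}|0⟩` and `W_{-3}|0⟩` are
`T(z) = ∑ₙ L_n z^(-n-2)` and `W(z) = ∑ₙ W_n z^(-n-3)`. (As the modes of `T(z)` and `W(z)`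
generate `M_c` from `|0⟩`, this determines `𝒱`.) -/
structure IsVacuumVertexAlgebra (c : ℂ) (𝒱 : VertexAlgebra (VacuumModule c)) : Prop where
  vac_eq : 𝒱.vac = vac c
  L0_eq : 𝒱.L0 = opL c 0
  field_T : ∀ n : ℤ, 𝒱.Y (genL (-2) • vac c) n = opL c (n - 1)
  field_W : ∀ n : ℤ, 𝒱.Y (genW (-3) • vac c) n = opW c (n - 2)

/-- `√6 / 2`, the factor in the rescaling `W̃_n = (√6 / 2) W_n`. -/
noncomputable def rescale : ℂ := ((Real.sqrt 6 : ℝ) : ℂ) / 2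

/-- `σ : A(M_c) ≃ ℂ[t, w]` is the algebra isomorphism with `[L_{-2}|0⟩] ↦ t = X 0` and
`[W̃_{-3}|0⟩] ↦ w = X 1`. -/
structure IsZhuPolynomialIso (c : ℂ) (𝒱 : VertexAlgebra (VacuumModule c))
    (σ : 𝒱.ZhuAlgebra ≃ₗ[ℂ] MvPolynomial (Fin 2) ℂ) : Prop where
  isAlgebraIso : 𝒱.IsZhuAlgebraIso σ
  map_L : σ (𝒱.zhuClass (genL (-2) • vac c)) = MvPolynomial.X 0
  map_W : σ (𝒱.zhuClass ((rescale • genW (-3)) • vac c)) = MvPolynomial.X 1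

/-- The singular vector `v_s` of `M_{-2}`. -/
noncomputable def vs : VacuumModule (-2) :=
  ((3 / 2 : ℂ) • genW (-3) ^ 2 - (19 / 36 : ℂ) • genL (-3) ^ 2 - (8 / 9 : ℂ) • genL (-2) ^ 3
    - (14 / 9 : ℂ) • (genL (-2) * genL (-4)) + (44 / 9 : ℂ) • genL (-6)) • vac (-2)

/-- The singular vector `v_s'` of `M_{-2}`. -/
noncomputable def vs' : VacuumModule (-2) :=
  ((9 / 2 : ℂ) • genW (-6) + (9 : ℂ) • (genL (-3) * genW (-3))
    - (6 : ℂ) • (genL (-2) * genW (-4))) • vac (-2)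

end WThree

/-!
The vertex algebra structure comes from the reconstruction theorem
`VertexAlgebra.exists_of_generating`: a family of mutually local, translation covariant fields whose
modes generate the space from a vacuum vector determines a vertex algebra. Mutually local covariant
fields are closed under normally ordered products (Dong's lemma, `IsLocal.nop`), and such a field is
determined by its value on the vacuum vector (Goddard's uniqueness theorem,
`apply_eq_zero_of_isLocal`). The commutation relations say that `L(z)` and `W(z)` are mutually
local, so `VacuumRep.exists_vertexAlgebra` applies to the vacuum module.

The Zhu algebra is bounded from above by its filtration by weight. Modulo `O(V)`, the modes `L_n`,
`n ≤ -3`, and `W_n`, `n ≤ -4`, lower the weight, so vectors of weight at most `N` are combinations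
of the `L_{-2}^i W_{-3}^j |0⟩` with `2 i + 3 j ≤ N` (`VacuumRep.IsStructure.grading_le`). Hence the
Zhu algebra is the polynomial ring in `[L_{-2} |0⟩]` and `[W̃_{-3} |0⟩]` as soon as these two
classes satisfy no polynomial relation (`VacuumRep.IsStructure.exists_iso`); its commutativity need
not be known beforehand.

That there is no relation is seen in a free field realization, which needs no basis of the vacuum
module. Let `a` and `b` be commuting free bosons of levels `1` and `1/3`. The field
`S = (3/2) b² + (1/2) ∂b` is a Virasoro field of central charge `0`, and for any such `S` commuting
with `a` the fields
`ω = S + (1/2) a² + (1/2) ∂a`,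
`W̃ = (1/3) a³ + (1/2) a ∂a + (1/12) ∂²a - 2 a S - (1/2) ∂S`
satisfy the relations of the `W₃` algebra at `c = -2` (`FreeField.IsBosonVir.vacuumRep`). By the
universal property of the vacuum module (`VacuumRep.exists_hom`) this gives a homomorphism to the
vertex algebra of the two bosons. On the latter, `α_{-n-1} ↦ (-1)^n α` induces a homomorphism from
its Zhu algebra to the polynomials in the zero modes `x` and `y` of `a` and `b`
(`Heisenberg.zeroMode_zhuOp`). The images of `ω` and `W̃` are
`τ = s + (x² - x)/2` and `υ = x³/3 - x²/2 + x/6 - (2 x - 1) s`, where `s = (3 y² - y)/2`; the map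
`(x, y) ↦ (τ, υ)` of the plane to itself is onto, so `τ` and `υ` are algebraically independent
(`Heisenberg.injective_aeval_zeroModes`).

The classes of the two vectors are then computed with the relations
`Res_z z^(-2-i) (z + 1)^(wt a) Y(a, z) b ∈ O(V)` for `a = L_{-2} |0⟩` and `a = W_{-3} |0⟩`
(`VacuumRep.IsStructure.map_vs`, `VacuumRep.IsStructure.map_vs'`). The coefficients hold for every
isomorphism as in the theorem, since they only use the images of the two generators.
-/

open Finset

namespace VertexAlgebra

/-! ### Shift operators on functions on an abelian group -/

section Shift

variable {G V : Type*} [AddCommGroup G] [AddCommGroup V] [Module ℂ V]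

/-- The group algebra `ℂ[G]` acts on functions `G → V`; the basis element of `s` acts by the
shift `f ↦ f (· + s)`. If `f` is the coefficient function of a formal distribution, with the
coefficient of `z^(-n-1)` at `n`, this is multiplication by the Laurent monomial `z^s`. -/
noncomputable def shiftAct : AddMonoidAlgebra ℂ G →ₐ[ℂ] Module.End ℂ (G → V) :=
  AddMonoidAlgebra.lift ℂ (Module.End ℂ (G → V)) G
    { toFun := fun s => LinearMap.funLeft ℂ V (fun x => x + s.toAdd)
      map_one' := by ext f x; simp [LinearMap.funLeft]
      map_mul' := by
        intro s t; ext f x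
        simp [LinearMap.funLeft, add_assoc] }

theorem shiftAct_single (s : G) (c : ℂ) (f : G → V) (x : G) :
    shiftAct (AddMonoidAlgebra.single s c) f x = c • f (x + s) := by
  simp [shiftAct, LinearMap.funLeft]

/-- The monomial `z^s` of the group algebra. -/
noncomputable def mon (s : G) : AddMonoidAlgebra ℂ G := AddMonoidAlgebra.single s 1

theorem shiftAct_mon (s : G) (f : G → V) (x : G) : shiftAct (mon s) f x = f (x + s) := by
  simp [mon, shiftAct_single]

theorem shiftAct_mon_sub_mon_pow (s t : G) (N : ℕ) (f : G → V) (x : G) :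
    shiftAct ((mon s - mon t) ^ N) f x =
      ∑ j ∈ range (N + 1), ((-1 : ℂ) ^ j * (N.choose j : ℂ)) •
        f (x + ((N - j : ℕ) • s + j • t)) := by
  have h : (mon s - mon t : AddMonoidAlgebra ℂ G) ^ N
      = ∑ j ∈ range (N + 1), AddMonoidAlgebra.single ((N - j : ℕ) • s + j • t)
          ((-1 : ℂ) ^ j * (N.choose j : ℂ)) := by
    rw [sub_eq_neg_add, add_pow]
    refine sum_congr rfl fun j _ => ?_
    have h1 : ((-1 : AddMonoidAlgebra ℂ G) ^ j) = AddMonoidAlgebra.single 0 ((-1 : ℂ) ^ j) := by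
      rw [AddMonoidAlgebra.one_def, ← AddMonoidAlgebra.single_neg, AddMonoidAlgebra.single_pow,
        nsmul_zero]
    have h2 : ((N.choose j : ℕ) : AddMonoidAlgebra ℂ G)
        = AddMonoidAlgebra.single 0 (N.choose j : ℂ) := by
      rw [AddMonoidAlgebra.natCast_def]
    rw [neg_pow, mon, mon, h1, h2, AddMonoidAlgebra.single_pow, AddMonoidAlgebra.single_pow]
    simp only [AddMonoidAlgebra.single_mul_single, one_pow, mul_one, zero_add, add_zero,
      add_comm (j • t)]
  rw [h, map_sum, LinearMap.sum_apply, Finset.sum_apply]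
  exact sum_congr rfl fun j _ => shiftAct_single _ _ _ _

theorem shiftAct_mul (r r' : AddMonoidAlgebra ℂ G) (f : G → V) :
    shiftAct (r * r') f = shiftAct r (shiftAct r' f) := by
  rw [map_mul]; rfl

/-- A submodule stable under all shifts is stable under the group algebra. -/
theorem shiftAct_mem (S : Submodule ℂ (G → V)) (hS : ∀ s : G, ∀ f ∈ S, shiftAct (mon s) f ∈ S)
    (r : AddMonoidAlgebra ℂ G) {f : G → V} (hf : f ∈ S) : shiftAct r f ∈ S := by
  induction r using AddMonoidAlgebra.induction_on with
  | of s => exact hS _ f hf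
  | add a b ha hb => rw [map_add]; exact S.add_mem ha hb
  | smul c a ha => rw [map_smul]; exact S.smul_mem c ha

end Shift

/-! ### Mutually local fields -/

section Fields

variable {V : Type*} [AddCommGroup V] [Module ℂ V]

/-- `A(z) = ∑ₙ A n z^(-n-1)` is a field. -/
def IsField (A : ℤ → Module.End ℂ V) : Prop := ∀ v : V, ∃ N : ℤ, ∀ n : ℤ, N ≤ n → A n v = 0

/-- `(z - w)^N [A(z), B(w)] = 0` -/
def IsLocalAt (N : ℕ) (A B : ℤ → Module.End ℂ V) : Prop := ∀ m n : ℤ,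
  ∑ j ∈ range (N + 1), ((-1 : ℂ) ^ j * (N.choose j : ℂ)) •
    (A (m + N - j) * B (n + j) - B (n + j) * A (m + N - j)) = 0

/-- `(z - w)^N [A(z), B(w)] = 0` for some `N` -/
def IsLocal (A B : ℤ → Module.End ℂ V) : Prop := ∃ N : ℕ, IsLocalAt N A B

theorem shiftAct_eq_zero_of_isLocalAt {G : Type*} [AddCommGroup G] {N : ℕ}
    {A B : ℤ → Module.End ℂ V} (h : IsLocalAt N A B) (s t : G) (f : G → V)
    (hf : ∀ x, ∃ (φ : Module.End ℂ V) (v : V) (m n : ℤ), ∀ j : ℕ, j ≤ N →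
      f (x + ((N - j : ℕ) • s + j • t)) =
        φ (A (m + N - j) (B (n + j) v) - B (n + j) (A (m + N - j) v))) :
    shiftAct ((mon s - mon t) ^ N) f = 0 := by
  ext x
  obtain ⟨φ, v, m, n, hx⟩ := hf x
  rw [shiftAct_mon_sub_mon_pow, Pi.zero_apply, ← map_zero φ,
    ← LinearMap.zero_apply (σ₁₂ := RingHom.id ℂ) (M₂ := V) v,
    ← h m n,    LinearMap.sum_apply, map_sum]
  refine sum_congr rfl fun j hj => ?_
  rw [hx j (Nat.lt_succ_iff.mp (mem_range.mp hj)), LinearMap.smul_apply, map_smul]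
  rfl

theorem isLocalAt_iff {N : ℕ} {A B : ℤ → Module.End ℂ V} :
    IsLocalAt N A B ↔ ∀ v, shiftAct ((mon ((1 : ℤ), (0 : ℤ)) - mon (0, 1)) ^ N)
      (fun x : ℤ × ℤ => A x.1 (B x.2 v) - B x.2 (A x.1 v)) = 0 := by
  constructor
  · intro h v
    refine shiftAct_eq_zero_of_isLocalAt h _ _ _ fun x => ⟨1, v, x.1, x.2, fun j hj => ?_⟩
    simp [hj, add_sub_assoc]
  · intro h m n
    ext v
    have := congrFun (h v) (m, n)
    rw [shiftAct_mon_sub_mon_pow] at this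
    rw [LinearMap.zero_apply, LinearMap.sum_apply]
    refine Eq.trans (sum_congr rfl fun j hj => ?_) this
    have hj' := Nat.lt_succ_iff.mp (mem_range.mp hj)
    simp [hj', add_sub_assoc]

theorem IsLocalAt.mono {N M : ℕ} {A B : ℤ → Module.End ℂ V} (h : IsLocalAt N A B)
    (hNM : N ≤ M) : IsLocalAt M A B := by
  rw [isLocalAt_iff] at h ⊢
  intro v
  rw [← Nat.sub_add_cancel hNM, pow_add, shiftAct_mul, h v, map_zero]

theorem IsLocal.symm {A B : ℤ → Module.End ℂ V} (h : IsLocal A B) : IsLocal B A := by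
  obtain ⟨N, h⟩ := h
  refine ⟨N, fun m n => ?_⟩
  have h1 := h n m
  rw [← sum_range_reflect] at h1
  have h2 := congrArg (fun x => (-(-1 : ℂ) ^ N) • x) h1
  simp only [smul_zero, smul_sum] at h2
  rw [← h2]
  refine sum_congr rfl fun j hj => ?_
  have hj' := Nat.lt_succ_iff.mp (mem_range.mp hj)
  have e : N + 1 - 1 - j = N - j := by omega
  rw [e, Nat.choose_symm hj', Nat.cast_sub hj', smul_smul]
  have e1 : n + (N : ℤ) - (N - j) = n + j := by ring
  have e2 : m + ((N : ℤ) - j) = m + N - j := by ring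
  have e3 : (-1 : ℂ) ^ N * (-1) ^ (N - j) = (-1) ^ j := by
    rw [← pow_add, show N + (N - j) = 2 * (N - j) + j by omega, pow_add, pow_mul]
    simp
  rw [e1, e2, ← neg_sub (A _ * B _), smul_neg, ← neg_smul, neg_mul, ← mul_assoc, e3]

theorem IsLocal.add {A A' B : ℤ → Module.End ℂ V} (h : IsLocal A B) (h' : IsLocal A' B) :
    IsLocal (A + A') B := by
  obtain ⟨N, h⟩ := h
  obtain ⟨M, h'⟩ := h'
  refine ⟨max N M, fun m n => ?_⟩
  have := congrArg₂ (· + ·) (h.mono (le_max_left N M) m n) (h'.mono (le_max_right N M) m n)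
  simp only [← sum_add_distrib, ← smul_add, add_zero] at this
  rw [← this]
  refine sum_congr rfl fun j _ => ?_
  simp only [Pi.add_apply, add_mul, mul_add]
  congr 1; abel

theorem IsLocal.smul {A B : ℤ → Module.End ℂ V} (c : ℂ) (h : IsLocal A B) :
    IsLocal (c • A) B := by
  obtain ⟨N, h⟩ := h
  refine ⟨N, fun m n => ?_⟩
  rw [← smul_zero c, ← h m n, smul_sum]
  refine sum_congr rfl fun j _ => ?_
  simp only [Pi.smul_apply, smul_mul_assoc, mul_smul_comm]
  rw [← smul_sub, smul_comm]

theorem isLocal_zero (B : ℤ → Module.End ℂ V) : IsLocal 0 B :=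
  ⟨0, fun m n => by simp⟩

/-- The field `∂_z A(z)`. -/
def derivField (A : ℤ → Module.End ℂ V) : ℤ → Module.End ℂ V := fun n => (-(n : ℂ)) • A (n - 1)

theorem IsField.deriv {A : ℤ → Module.End ℂ V} (h : IsField A) : IsField (derivField A) := by
  intro v
  obtain ⟨N, hN⟩ := h v
  refine ⟨N + 1, fun n hn => ?_⟩
  simp [derivField, hN (n - 1) (by omega)]

theorem IsLocal.deriv {A B : ℤ → Module.End ℂ V} (h : IsLocal A B) :
    IsLocal (derivField A) B := by
  obtain ⟨N, h⟩ := h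
  refine ⟨N + 1, ?_⟩
  rw [isLocalAt_iff] at h ⊢
  intro v
  -- `d` is `∂_z` on formal distributions in `z, w`
  let d : (ℤ × ℤ → V) →ₗ[ℂ] (ℤ × ℤ → V) :=
    { toFun := fun f x => (-(x.1 : ℂ)) • f (x.1 - 1, x.2)
      map_add' := by intro f g; ext x; simp [-neg_smul]
      map_smul' := by
        intro c f; ext x
        simp only [Pi.smul_apply, RingHom.id_apply]; rw [smul_comm] }
  set D : AddMonoidAlgebra ℂ (ℤ × ℤ) := mon ((1 : ℤ), (0 : ℤ)) - mon (0, 1) with hD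
  have h1 : ∀ f, shiftAct D (d f) = d (shiftAct D f) - f := by
    intro f; ext x
    simp only [hD, map_sub, LinearMap.sub_apply, Pi.sub_apply, shiftAct_mon, LinearMap.coe_mk,
      AddHom.coe_mk, d]
    simp
    module
  have h2 : ∀ (n : ℕ) f, shiftAct (D ^ (n + 1)) (d f)
      = d (shiftAct (D ^ (n + 1)) f) - ((n : ℂ) + 1) • shiftAct (D ^ n) f := by
    intro n
    induction n with
    | zero => intro f; simp [h1]
    | succ n ih =>
      intro f
      rw [pow_succ, shiftAct_mul, h1, map_sub, ih, ← shiftAct_mul, ← shiftAct_mul, ← pow_succ,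
        ← pow_succ]
      push_cast; module
  have := h2 N (fun x : ℤ × ℤ => A x.1 (B x.2 v) - B x.2 (A x.1 v))
  rw [h v, pow_succ' D, shiftAct_mul D _ (fun x : ℤ × ℤ => A x.1 (B x.2 v) - B x.2 (A x.1 v)),
    h v, map_zero, map_zero, smul_zero, sub_zero] at this
  rw [pow_succ', ← this]
  congr 1
  ext x
  simp [d, derivField, smul_sub]
  abel

theorem isField_add {A B : ℤ → Module.End ℂ V} (hA : IsField A) (hB : IsField B) :
    IsField (A + B) := by
  intro v
  obtain ⟨N, hN⟩ := hA v
  obtain ⟨M, hM⟩ := hB v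
  exact ⟨max N M, fun n hn => by
    simp [hN n (le_trans (le_max_left _ _) hn), hM n (le_trans (le_max_right _ _) hn)]⟩

theorem IsField.exists_nat {A : ℤ → Module.End ℂ V} (h : IsField A) (m : ℤ) (v : V) :
    ∃ K : ℕ, ∀ i : ℕ, K ≤ i → A (m + i) v = 0 := by
  obtain ⟨N, hN⟩ := h v
  exact ⟨(N - m).toNat, fun i hi => hN _ (by omega)⟩

open Classical in
/-- The normally ordered product `:A(z)B(z):`, with modes
`∑_{i ≥ 0} (A_(-1-i) B_(m+i) + B_(m-1-i) A_i)`; it is `0` unless `A` and `B` are fields. -/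
noncomputable def nop (A B : ℤ → Module.End ℂ V) : ℤ → Module.End ℂ V := fun m =>
  if h : IsField A ∧ IsField B then
    have fin : ∀ v, (Function.support fun i : ℕ => A (-1 - i) (B (m + i) v)).Finite ∧
        (Function.support fun i : ℕ => B (m - 1 - i) (A i v)).Finite := by
      intro v
      obtain ⟨K, hK⟩ := h.2.exists_nat m v
      obtain ⟨K', hK'⟩ := h.1.exists_nat 0 v
      constructor
      · refine (Finset.finite_toSet (range K)).subset fun i hi => ?_
        by_contra hc
        exact hi (by simp [hK i (by simpa using hc)])
      · refine (Finset.finite_toSet (range K')).subset fun i hi => ?_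
        by_contra hc
        have := hK' i (by simpa using hc)
        rw [zero_add] at this
        exact hi (by simp [this])
    { toFun := fun v => ∑ᶠ i : ℕ, A (-1 - i) (B (m + i) v) + ∑ᶠ i : ℕ, B (m - 1 - i) (A i v)
      map_add' := by
        intro u v
        simp only [map_add]
        rw [finsum_add_distrib (fin u).1 (fin v).1, finsum_add_distrib (fin u).2 (fin v).2]
        abel
      map_smul' := by
        intro c v
        simp only [map_smul, RingHom.id_apply, ← smul_finsum, smul_add] }
  else 0

theorem nop_apply {A B : ℤ → Module.End ℂ V} (hA : IsField A) (hB : IsField B) (m : ℤ) (v : V)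
    {K K' : ℕ} (hK : ∀ i : ℕ, K ≤ i → B (m + i) v = 0) (hK' : ∀ i : ℕ, K' ≤ i → A i v = 0) :
    nop A B m v = ∑ i ∈ range K, A (-1 - i) (B (m + i) v)
      + ∑ i ∈ range K', B (m - 1 - i) (A i v) := by
  rw [nop, dif_pos ⟨hA, hB⟩]
  simp only [LinearMap.coe_mk, AddHom.coe_mk]
  congr 1
  · refine finsum_eq_sum_of_support_subset _ fun i hi => ?_
    by_contra hc
    exact hi (by simp [hK i (by simpa using hc)])
  · refine finsum_eq_sum_of_support_subset _ fun i hi => ?_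
    by_contra hc
    exact hi (by simp [hK' i (by simpa using hc)])

theorem nop_apply_eventually {A B : ℤ → Module.End ℂ V} (hA : IsField A) (hB : IsField B)
    (m : ℤ) (v : V) : ∀ᶠ K : ℕ in Filter.atTop,
      nop A B m v = ∑ i ∈ range K, (A (-1 - i) (B (m + i) v) + B (m - 1 - i) (A i v)) := by
  obtain ⟨K, hK⟩ := hB.exists_nat m v
  obtain ⟨K', hK'⟩ := hA.exists_nat 0 v
  filter_upwards [Filter.eventually_ge_atTop (max K K')] with L hL
  rw [sum_add_distrib]
  refine nop_apply hA hB m v (fun i hi => hK i (le_trans (le_trans (le_max_left _ _) hL) hi))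
    fun i hi => ?_
  simpa using hK' i (le_trans (le_trans (le_max_right _ _) hL) hi)

theorem isField_nop {A B : ℤ → Module.End ℂ V} (hA : IsField A) (hB : IsField B) :
    IsField (nop A B) := by
  intro v
  obtain ⟨K', hK'⟩ := hA.exists_nat 0 v
  obtain ⟨N, hN⟩ := hB v
  choose M hM using fun u => hB u
  obtain ⟨P, hP⟩ : ∃ P : ℤ, ∀ i ∈ range K', M (A i v) + 1 + i ≤ P := by
    refine ⟨∑ i ∈ range K', |M (A i v) + 1 + i|, fun i hi => ?_⟩
    exact (le_abs_self _).trans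
      (single_le_sum (f := fun i : ℕ => |M (A i v) + 1 + i|) (fun _ _ => abs_nonneg _) hi)
  refine ⟨max N P, fun n hn => ?_⟩
  rw [nop_apply hA hB n v (K := 0) (K' := K')
    (fun i _ => hN _ (by have := le_max_left N P; omega))
    (fun i hi => by simpa using hK' i hi)]
  rw [range_zero, sum_empty, zero_add]
  refine sum_eq_zero fun i hi => hM _ _ ?_
  have := hP i hi
  have := le_max_right N P
  omega

/-- The difference `A(z) B(w) C(u) v - C(u) A(z) B(w) v`, as a function of the three indices. -/
def tripleComm (A B C : ℤ → Module.End ℂ V) (v : V) : ℤ × ℤ × ℤ → V :=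
  fun x => A x.1 (B x.2.1 (C x.2.2 v)) - C x.2.2 (A x.1 (B x.2.1 v))

/-- The difference `B(w) A(z) C(u) v - C(u) B(w) A(z) v`, as a function of the three indices. -/
def tripleComm' (A B C : ℤ → Module.End ℂ V) (v : V) : ℤ × ℤ × ℤ → V :=
  fun x => B x.2.1 (A x.1 (C x.2.2 v)) - C x.2.2 (B x.2.1 (A x.1 v))

/-- The algebraic core of Dong's lemma: `(w - u)^(3N)` lies in the ideal generated by
`(w - u)^N (z - u)^N`, which kills both triple commutators, and `(z - w)^(N+1)`, which kills
their difference. -/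
theorem dong_core {A B C : ℤ → Module.End ℂ V} {N : ℕ} (hAB : IsLocalAt N A B)
    (hAC : IsLocalAt N A C) (hBC : IsLocalAt N B C) (v : V) :
    (∃ Q : AddMonoidAlgebra ℂ (ℤ × ℤ × ℤ),
      shiftAct ((mon (0, 1, 0) - mon (0, 0, 1)) ^ (3 * N)) (tripleComm A B C v)
        = shiftAct (Q * (mon (1, 0, 0) - mon (0, 1, 0)) ^ (N + 1)) (tripleComm A B C v) ∧
      shiftAct ((mon (0, 1, 0) - mon (0, 0, 1)) ^ (3 * N)) (tripleComm' A B C v)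
        = shiftAct (Q * (mon (1, 0, 0) - mon (0, 1, 0)) ^ (N + 1)) (tripleComm' A B C v)) ∧
    shiftAct ((mon (1, 0, 0) - mon (0, 1, 0)) ^ N) (tripleComm A B C v - tripleComm' A B C v)
      = 0 := by
  have e1 : ∀ (x : ℤ × ℤ × ℤ) (N j : ℕ), j ≤ N →
      x + ((N - j) • ((1 : ℤ), (0 : ℤ), (0 : ℤ)) + j • ((0 : ℤ), (1 : ℤ), (0 : ℤ)))
        = (x.1 + N - j, x.2.1 + j, x.2.2) := by
    intro x N j hj
    ext <;> simp [hj]; ring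
  have e2 : ∀ (x : ℤ × ℤ × ℤ) (N j : ℕ), j ≤ N →
      x + ((N - j) • ((1 : ℤ), (0 : ℤ), (0 : ℤ)) + j • ((0 : ℤ), (0 : ℤ), (1 : ℤ)))
        = (x.1 + N - j, x.2.1, x.2.2 + j) := by
    intro x N j hj
    ext <;> simp [hj]; ring
  have e3 : ∀ (x : ℤ × ℤ × ℤ) (N j : ℕ), j ≤ N →
      x + ((N - j) • ((0 : ℤ), (1 : ℤ), (0 : ℤ)) + j • ((0 : ℤ), (0 : ℤ), (1 : ℤ)))
        = (x.1, x.2.1 + N - j, x.2.2 + j) := by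
    intro x N j hj
    ext <;> simp [hj]; ring
  set z : AddMonoidAlgebra ℂ (ℤ × ℤ × ℤ) := mon ((1 : ℤ), (0 : ℤ), (0 : ℤ)) with hz
  set w : AddMonoidAlgebra ℂ (ℤ × ℤ × ℤ) := mon ((0 : ℤ), (1 : ℤ), (0 : ℤ)) with hw
  set u : AddMonoidAlgebra ℂ (ℤ × ℤ × ℤ) := mon ((0 : ℤ), (0 : ℤ), (1 : ℤ)) with hu
  have k1 : shiftAct ((w - u) ^ N * (z - u) ^ N) (tripleComm A B C v) = 0 := by
    have a1 : shiftAct ((w - u) ^ N) (fun x : ℤ × ℤ × ℤ =>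
        A x.1 (B x.2.1 (C x.2.2 v)) - A x.1 (C x.2.2 (B x.2.1 v))) = 0 := by
      refine shiftAct_eq_zero_of_isLocalAt hBC _ _ _ fun x => ⟨A x.1, v, x.2.1, x.2.2, ?_⟩
      intro j hj
      rw [e3 x N j hj, map_sub]
    have a2 : shiftAct ((z - u) ^ N) (fun x : ℤ × ℤ × ℤ =>
        A x.1 (C x.2.2 (B x.2.1 v)) - C x.2.2 (A x.1 (B x.2.1 v))) = 0 := by
      refine shiftAct_eq_zero_of_isLocalAt hAC _ _ _ fun x => ⟨1, B x.2.1 v, x.1, x.2.2, ?_⟩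
      intro j hj
      rw [e2 x N j hj]; rfl
    have a3 : tripleComm A B C v = (fun x : ℤ × ℤ × ℤ =>
        A x.1 (B x.2.1 (C x.2.2 v)) - A x.1 (C x.2.2 (B x.2.1 v))) + (fun x : ℤ × ℤ × ℤ =>
        A x.1 (C x.2.2 (B x.2.1 v)) - C x.2.2 (A x.1 (B x.2.1 v))) := by
      ext x; simp [tripleComm]
    rw [a3, map_add, shiftAct_mul _ _ (fun x : ℤ × ℤ × ℤ =>
        A x.1 (C x.2.2 (B x.2.1 v)) - C x.2.2 (A x.1 (B x.2.1 v))), a2,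
      mul_comm, shiftAct_mul, a1, map_zero, map_zero, add_zero]
  have k2 : shiftAct ((w - u) ^ N * (z - u) ^ N) (tripleComm' A B C v) = 0 := by
    have a1 : shiftAct ((z - u) ^ N) (fun x : ℤ × ℤ × ℤ =>
        B x.2.1 (A x.1 (C x.2.2 v)) - B x.2.1 (C x.2.2 (A x.1 v))) = 0 := by
      refine shiftAct_eq_zero_of_isLocalAt hAC _ _ _ fun x => ⟨B x.2.1, v, x.1, x.2.2, ?_⟩
      intro j hj
      rw [e2 x N j hj, map_sub]
    have a2 : shiftAct ((w - u) ^ N) (fun x : ℤ × ℤ × ℤ =>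
        B x.2.1 (C x.2.2 (A x.1 v)) - C x.2.2 (B x.2.1 (A x.1 v))) = 0 := by
      refine shiftAct_eq_zero_of_isLocalAt hBC _ _ _ fun x => ⟨1, A x.1 v, x.2.1, x.2.2, ?_⟩
      intro j hj
      rw [e3 x N j hj]; rfl
    have a3 : tripleComm' A B C v = (fun x : ℤ × ℤ × ℤ =>
        B x.2.1 (A x.1 (C x.2.2 v)) - B x.2.1 (C x.2.2 (A x.1 v))) + (fun x : ℤ × ℤ × ℤ =>
        B x.2.1 (C x.2.2 (A x.1 v)) - C x.2.2 (B x.2.1 (A x.1 v))) := by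
      ext x; simp [tripleComm']
    rw [a3, map_add, shiftAct_mul _ _ (fun x : ℤ × ℤ × ℤ =>
        B x.2.1 (A x.1 (C x.2.2 v)) - B x.2.1 (C x.2.2 (A x.1 v))), a1,
      mul_comm, shiftAct_mul, a2, map_zero, map_zero, add_zero]
  refine ⟨?_, ?_⟩
  · set I : Ideal (AddMonoidAlgebra ℂ (ℤ × ℤ × ℤ)) :=
      Ideal.span {(z - u) ^ N, (z - w) ^ (N + 1)} with hI
    have m1 : (z - u) ^ N ∈ I := Ideal.subset_span (by simp)
    have m2 : (w - z) ^ (N + 1) ∈ I := by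
      rw [← neg_sub z w, neg_pow]
      exact I.mul_mem_left _ (Ideal.subset_span (by simp))
    have m3 : (w - u) ^ (2 * N) ∈ I := by
      have := I.add_pow_mem_of_pow_mem_of_le m1 m2 (k := 2 * N) (by omega)
      rwa [sub_add_sub_comm, add_comm z, sub_add_eq_sub_sub, add_sub_right_comm,
        add_sub_cancel_right] at this
    obtain ⟨a, b, hab⟩ := Ideal.mem_span_pair.mp m3
    have hpow : (w - u) ^ (3 * N)
        = a * ((w - u) ^ N * (z - u) ^ N) + ((w - u) ^ N * b) * (z - w) ^ (N + 1) := by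
      rw [show 3 * N = N + 2 * N by ring, pow_add, ← hab]; ring
    refine ⟨(w - u) ^ N * b, ?_, ?_⟩
    · rw [hpow, map_add, LinearMap.add_apply, shiftAct_mul a, k1, map_zero, zero_add]
    · rw [hpow, map_add, LinearMap.add_apply, shiftAct_mul a, k2, map_zero, zero_add]
  · have : tripleComm A B C v - tripleComm' A B C v = (fun x : ℤ × ℤ × ℤ =>
        A x.1 (B x.2.1 (C x.2.2 v)) - B x.2.1 (A x.1 (C x.2.2 v))) - (fun x : ℤ × ℤ × ℤ =>
        C x.2.2 (A x.1 (B x.2.1 v) - B x.2.1 (A x.1 v))) := by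
      ext x; simp [tripleComm, tripleComm']; abel
    rw [this, map_sub, shiftAct_eq_zero_of_isLocalAt hAB, shiftAct_eq_zero_of_isLocalAt hAB,
      sub_zero]
    · intro x
      refine ⟨C x.2.2, v, x.1, x.2.1, fun j hj => ?_⟩
      rw [e1 x N j hj]
    · intro x
      refine ⟨1, C x.2.2 v, x.1, x.2.1, fun j hj => ?_⟩
      rw [e1 x N j hj]; rfl

/-- The field `Res_z (z - w)^j [A(z), B(w)]`. -/
noncomputable def resComm (j : ℕ) (A B : ℤ → Module.End ℂ V) : ℤ → Module.End ℂ V := fun n =>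
  ∑ i ∈ range (j + 1), ((-1 : ℂ) ^ i * (j.choose i : ℂ)) •
    (A (j - i : ℕ) * B (n + i) - B (n + i) * A (j - i : ℕ))

/-- Dong's lemma for the residue products. -/
theorem IsLocal.resComm {A B C : ℤ → Module.End ℂ V} (hAB : IsLocal A B) (hAC : IsLocal A C)
    (hBC : IsLocal B C) (j : ℕ) : IsLocal (resComm j A B) C := by
  obtain ⟨N1, h1⟩ := hAB
  obtain ⟨N2, h2⟩ := hAC
  obtain ⟨N3, h3⟩ := hBC
  set N := max N1 (max N2 N3)
  refine ⟨3 * N, fun m n => ?_⟩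
  ext v
  obtain ⟨⟨Q, hQ1, hQ2⟩, hD⟩ := dong_core (h1.mono (M := N) (by omega))
    (h2.mono (M := N) (by omega)) (h3.mono (M := N) (by omega)) v
  have key : shiftAct ((mon (0, 1, 0) - mon (0, 0, 1)) ^ (3 * N))
      (shiftAct ((mon (1, 0, 0) - mon (0, 1, 0)) ^ j)
        (tripleComm A B C v - tripleComm' A B C v)) = 0 := by
    rw [← shiftAct_mul, mul_comm, shiftAct_mul, map_sub, hQ1, hQ2, ← map_sub, pow_succ',
      ← mul_assoc, shiftAct_mul, hD, map_zero, map_zero]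
  have := congrFun key (0, m, n)
  rw [shiftAct_mon_sub_mon_pow] at this
  rw [LinearMap.sum_apply, LinearMap.zero_apply]
  refine Eq.trans (sum_congr rfl fun k hk => ?_) this
  have hk' := Nat.lt_succ_iff.mp (mem_range.mp hk)
  rw [LinearMap.smul_apply]
  congr 1
  rw [shiftAct_mon_sub_mon_pow]
  simp only [VertexAlgebra.resComm, LinearMap.sub_apply, Module.End.mul_apply,
    LinearMap.sum_apply, map_sum,
    LinearMap.smul_apply, map_smul, ← sum_sub_distrib, ← smul_sub]
  refine sum_congr rfl fun i hi => ?_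
  have hi' := Nat.lt_succ_iff.mp (mem_range.mp hi)
  simp only [tripleComm, tripleComm', Pi.sub_apply]
  have e : ((0 : ℤ), m, n) + ((3 * N - k) • ((0 : ℤ), (1 : ℤ), (0 : ℤ))
      + k • ((0 : ℤ), (0 : ℤ), (1 : ℤ)))
      + ((j - i) • ((1 : ℤ), (0 : ℤ), (0 : ℤ)) + i • ((0 : ℤ), (1 : ℤ), (0 : ℤ)))
      = (((j - i : ℕ) : ℤ), m + (3 * N : ℕ) - k + i, n + k) := by
    ext <;> simp [hk', add_sub_assoc]
  rw [e]
  simp only [map_sub]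
  congr 1
  abel

/-- Dong's lemma for the normally ordered product. -/
theorem IsLocal.nop {A B C : ℤ → Module.End ℂ V} (hA : IsField A) (hB : IsField B)
    (hAB : IsLocal A B) (hAC : IsLocal A C) (hBC : IsLocal B C) :
    IsLocal (nop A B) C := by
  obtain ⟨N1, h1⟩ := hAB
  obtain ⟨N2, h2⟩ := hAC
  obtain ⟨N3, h3⟩ := hBC
  set N := max N1 (max N2 N3)
  refine ⟨3 * N, fun m n => ?_⟩
  ext v
  obtain ⟨⟨Q, hQ1, hQ2⟩, hD⟩ := dong_core (h1.mono (M := N) (by omega))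
    (h2.mono (M := N) (by omega)) (h3.mono (M := N) (by omega)) v
  set D : AddMonoidAlgebra ℂ (ℤ × ℤ × ℤ) := mon (1, 0, 0) - mon (0, 1, 0) with hDdef
  set E : AddMonoidAlgebra ℂ (ℤ × ℤ × ℤ) := mon (0, 1, 0) - mon (0, 0, 1) with hEdef
  set g := tripleComm A B C v with hg
  set g' := tripleComm' A B C v with hg'
  -- the two halves of the normally ordered product, truncated
  let S : ℕ → (ℤ × ℤ × ℤ → V) → ℤ → ℤ → V := fun K f q r => ∑ i ∈ range K, f (-1 - i, q + i, r)
  let S' : ℕ → (ℤ × ℤ × ℤ → V) → ℤ → ℤ → V := fun K f q r => ∑ i ∈ range K, f (i, q - 1 - i, r)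
  have tel : ∀ K f q r, S K (shiftAct D f) q r = f (0, q, r) - f (-K, q + K, r) := by
    intro K f q r
    have : ∀ i : ℕ, shiftAct D f (-1 - i, q + i, r)
        = f (-(i : ℤ), q + i, r) - f (-((i + 1 : ℕ) : ℤ), q + ((i + 1 : ℕ) : ℤ), r) := by
      intro i
      rw [hDdef, map_sub, LinearMap.sub_apply, Pi.sub_apply, shiftAct_mon, shiftAct_mon]
      congr 2 <;> ext <;> simp <;> ring
    simp only [S, this]
    rw [sum_range_sub']
    simp
  have tel' : ∀ K f q r, S' K (shiftAct D f) q r = f (K, q - K, r) - f (0, q, r) := by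
    intro K f q r
    have : ∀ i : ℕ, shiftAct D f (i, q - 1 - i, r)
        = f (((i + 1 : ℕ) : ℤ), q - ((i + 1 : ℕ) : ℤ), r) - f ((i : ℤ), q - i, r) := by
      intro i
      rw [hDdef, map_sub, LinearMap.sub_apply, Pi.sub_apply, shiftAct_mon, shiftAct_mon]
      congr 2 <;> ext <;> simp <;> ring
    simp only [S', this]
    rw [sum_range_sub (fun i : ℕ => f ((i : ℤ), q - i, r))]
    simp
  have comm : ∀ K f q r, S K (shiftAct (E ^ (3 * N)) f) q r
      = ∑ j ∈ range (3 * N + 1), ((-1 : ℂ) ^ j * ((3 * N).choose j : ℂ)) •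
        S K f (q + (3 * N : ℕ) - j) (r + j) := by
    intro K f q r
    simp only [S, smul_sum]
    rw [sum_comm]
    refine sum_congr rfl fun i _ => ?_
    rw [hEdef, shiftAct_mon_sub_mon_pow]
    refine sum_congr rfl fun j hj => ?_
    have hj' := Nat.lt_succ_iff.mp (mem_range.mp hj)
    congr 2
    ext <;> simp [hj']
    ring
  have comm' : ∀ K f q r, S' K (shiftAct (E ^ (3 * N)) f) q r
      = ∑ j ∈ range (3 * N + 1), ((-1 : ℂ) ^ j * ((3 * N).choose j : ℂ)) •
        S' K f (q + (3 * N : ℕ) - j) (r + j) := by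
    intro K f q r
    simp only [S', smul_sum]
    rw [sum_comm]
    refine sum_congr rfl fun i _ => ?_
    rw [hEdef, shiftAct_mon_sub_mon_pow]
    refine sum_congr rfl fun j hj => ?_
    have hj' := Nat.lt_succ_iff.mp (mem_range.mp hj)
    congr 2
    ext <;> simp [hj']
    ring
  -- the boundary terms vanish for large truncation
  have bd : ∀ r : AddMonoidAlgebra ℂ (ℤ × ℤ × ℤ), ∃ K0 : ℕ, ∀ K : ℕ, K0 ≤ K →
      shiftAct r g (-K, m + K, n) = 0 := by
    intro r
    let P : Submodule ℂ (ℤ × ℤ × ℤ → V) :=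
      { carrier := {f | ∀ p q r : ℤ, ∃ K0 : ℤ, ∀ K : ℤ, K0 ≤ K → f (p - K, q + K, r) = 0}
        add_mem' := by
          intro f f' hf hf' p q r
          obtain ⟨K, hK⟩ := hf p q r
          obtain ⟨K', hK'⟩ := hf' p q r
          exact ⟨max K K', fun L hL => by
            simp [hK L (le_trans (le_max_left _ _) hL), hK' L (le_trans (le_max_right _ _) hL)]⟩
        zero_mem' := fun _ _ _ => ⟨0, fun _ _ => rfl⟩
        smul_mem' := by
          intro c f hf p q r
          obtain ⟨K, hK⟩ := hf p q r
          exact ⟨K, fun L hL => by simp [hK L hL]⟩ }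
    have hP : ∀ s, ∀ f ∈ P, shiftAct (mon s) f ∈ P := by
      intro s f hf p q r
      obtain ⟨K, hK⟩ := hf (p + s.1) (q + s.2.1) (r + s.2.2)
      refine ⟨K, fun L hL => ?_⟩
      rw [shiftAct_mon, ← hK L hL]
      congr 1; ext <;> simp <;> ring
    have hgP : g ∈ P := by
      intro p q r
      obtain ⟨K, hK⟩ := hB (C r v)
      obtain ⟨K', hK'⟩ := hB v
      refine ⟨max K K' - q, fun L hL => ?_⟩
      simp [hg, tripleComm, hK (q + L) (by have := le_max_left K K'; omega),
        hK' (q + L) (by have := le_max_right K K'; omega)]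
    obtain ⟨K0, hK0⟩ := shiftAct_mem P hP r hgP 0 m n
    exact ⟨K0.toNat, fun K hK => by simpa using hK0 K (by omega)⟩
  have bd' : ∀ r : AddMonoidAlgebra ℂ (ℤ × ℤ × ℤ), ∃ K0 : ℕ, ∀ K : ℕ, K0 ≤ K →
      shiftAct r g' (K, m - K, n) = 0 := by
    intro r
    let P : Submodule ℂ (ℤ × ℤ × ℤ → V) :=
      { carrier := {f | ∀ p q r : ℤ, ∃ K0 : ℤ, ∀ K : ℤ, K0 ≤ K → f (p + K, q - K, r) = 0}
        add_mem' := by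
          intro f f' hf hf' p q r
          obtain ⟨K, hK⟩ := hf p q r
          obtain ⟨K', hK'⟩ := hf' p q r
          exact ⟨max K K', fun L hL => by
            simp [hK L (le_trans (le_max_left _ _) hL), hK' L (le_trans (le_max_right _ _) hL)]⟩
        zero_mem' := fun _ _ _ => ⟨0, fun _ _ => rfl⟩
        smul_mem' := by
          intro c f hf p q r
          obtain ⟨K, hK⟩ := hf p q r
          exact ⟨K, fun L hL => by simp [hK L hL]⟩ }
    have hP : ∀ s, ∀ f ∈ P, shiftAct (mon s) f ∈ P := by
      intro s f hf p q r
      obtain ⟨K, hK⟩ := hf (p + s.1) (q + s.2.1) (r + s.2.2)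
      refine ⟨K, fun L hL => ?_⟩
      rw [shiftAct_mon, ← hK L hL]
      congr 1; ext <;> simp <;> ring
    have hgP : g' ∈ P := by
      intro p q r
      obtain ⟨K, hK⟩ := hA (C r v)
      obtain ⟨K', hK'⟩ := hA v
      refine ⟨max K K' - p, fun L hL => ?_⟩
      simp [hg', tripleComm', hK (p + L) (by have := le_max_left K K'; omega),
        hK' (p + L) (by have := le_max_right K K'; omega)]
    obtain ⟨K0, hK0⟩ := shiftAct_mem P hP r hgP 0 m n
    exact ⟨K0.toNat, fun K hK => by simpa using hK0 K (by omega)⟩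
  obtain ⟨K1, hK1⟩ := bd (Q * D ^ N)
  obtain ⟨K2, hK2⟩ := bd' (Q * D ^ N)
  have main : ∀ K, K1 ≤ K → K2 ≤ K →
      S K (shiftAct (E ^ (3 * N)) g) m n + S' K (shiftAct (E ^ (3 * N)) g') m n = 0 := by
    intro K hk1 hk2
    have e : Q * D ^ (N + 1) = D * (Q * D ^ N) := by ring
    rw [hQ1, hQ2, e, shiftAct_mul D, shiftAct_mul D, tel, tel', hK1 K hk1, hK2 K hk2, sub_zero,
      zero_sub, ← sub_eq_add_neg, ← Pi.sub_apply, ← map_sub, shiftAct_mul Q, hD, map_zero]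
    rfl
  have ev : ∀ᶠ K : ℕ in Filter.atTop, ∀ j ∈ range (3 * N + 1),
      (VertexAlgebra.nop A B (m + (3 * N : ℕ) - j) * C (n + j)
        - C (n + j) * VertexAlgebra.nop A B (m + (3 * N : ℕ) - j)) v
      = S K g (m + (3 * N : ℕ) - j) (n + j) + S' K g' (m + (3 * N : ℕ) - j) (n + j) := by
    rw [Filter.eventually_all_finset]
    intro j _
    filter_upwards [nop_apply_eventually hA hB (m + (3 * N : ℕ) - j) (C (n + j) v),
      nop_apply_eventually hA hB (m + (3 * N : ℕ) - j) v] with K e1 e2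
    rw [LinearMap.sub_apply, Module.End.mul_apply, Module.End.mul_apply, e1, e2, map_sum,
      ← sum_sub_distrib, ← sum_add_distrib]
    refine sum_congr rfl fun i _ => ?_
    simp only [hg, hg', tripleComm, tripleComm', map_add]
    abel
  obtain ⟨K, hK, hK1', hK2'⟩ := (ev.and ((Filter.eventually_ge_atTop K1).and
    (Filter.eventually_ge_atTop K2))).exists
  rw [LinearMap.sum_apply, LinearMap.zero_apply, ← main K hK1' hK2', comm, comm',
    ← sum_add_distrib]
  refine sum_congr rfl fun j hj => ?_
  rw [LinearMap.smul_apply, hK j hj, smul_add]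

end Fields

end VertexAlgebra

namespace VertexAlgebra

/-! ### Translation covariance and uniqueness of fields -/

section Covariance

variable {V : Type*} [AddCommGroup V] [Module ℂ V]

/-- `[T, A(z)] = ∂_z A(z)` -/
def IsCovariant (T : Module.End ℂ V) (A : ℤ → Module.End ℂ V) : Prop :=
  ∀ n : ℤ, T * A n - A n * T = (-(n : ℂ)) • A (n - 1)

/-- `A(z) Ω` is regular at `z = 0`. -/
def IsCreative (Ω : V) (A : ℤ → Module.End ℂ V) : Prop := ∀ n : ℤ, 0 ≤ n → A n Ω = 0

variable {T : Module.End ℂ V} {Ω : V} {A B : ℤ → Module.End ℂ V}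

theorem IsCovariant.apply (h : IsCovariant T A) (n : ℤ) (v : V) :
    T (A n v) = A n (T v) - (n : ℂ) • A (n - 1) v := by
  have := LinearMap.congr_fun (h n) v
  simp only [LinearMap.sub_apply, Module.End.mul_apply, LinearMap.smul_apply] at this
  rw [sub_eq_iff_eq_add] at this
  rw [this]; module

theorem isCovariant_of_apply
    (h : ∀ (n : ℤ) (v : V), T (A n v) = A n (T v) - (n : ℂ) • A (n - 1) v) : IsCovariant T A := by
  intro n
  ext v
  simp only [LinearMap.sub_apply, Module.End.mul_apply, LinearMap.smul_apply, h]
  module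

theorem IsCovariant.deriv (h : IsCovariant T A) : IsCovariant T (derivField A) := by
  refine isCovariant_of_apply fun n v => ?_
  simp only [derivField, LinearMap.smul_apply, map_smul, h.apply]
  push_cast
  module

theorem IsCreative.deriv (h : IsCreative Ω A) : IsCreative Ω (derivField A) := by
  intro n hn
  rcases hn.eq_or_lt with rfl | hn
  · simp [derivField]
  · simp [derivField, h (n - 1) (by omega)]

theorem derivField_iterate_apply (A : ℤ → Module.End ℂ V) (k l : ℕ) :
    (derivField^[k] A) (-1 - l) = ((l + 1).ascFactorial k : ℂ) • A (-1 - l - k) := by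
  induction k generalizing l with
  | zero => simp
  | succ k ih =>
    rw [Function.iterate_succ_apply', derivField]
    have := ih (l + 1)
    rw [show (-1 - (l : ℤ) - 1) = -1 - ((l + 1 : ℕ) : ℤ) by push_cast; ring, this, smul_smul,
      show (-1 - ((l + 1 : ℕ) : ℤ) - (k : ℤ)) = -1 - (l : ℤ) - ((k + 1 : ℕ) : ℤ) by push_cast; ring]
    congr 1
    have h : (l + 1).ascFactorial (k + 1) = (l + 1) * (l + 2).ascFactorial k := by
      rw [Nat.ascFactorial_succ, ← Nat.succ_ascFactorial]
    rw [h]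
    push_cast
    ring

theorem derivField_iterate_neg_one (A : ℤ → Module.End ℂ V) (k : ℕ) :
    (derivField^[k] A) (-1) = (k.factorial : ℂ) • A (-1 - k) := by
  have := derivField_iterate_apply A k 0
  simpa [Nat.one_ascFactorial] using this

theorem IsCovariant.nop (hA : IsField A) (hB : IsField B) (hTA : IsCovariant T A)
    (hTB : IsCovariant T B) : IsCovariant T (nop A B) := by
  refine isCovariant_of_apply fun m v => ?_
  have hev : ∀ᶠ K : ℕ in Filter.atTop, B (m - 1 + K) v = 0 ∧ A ((K : ℤ) - 1) v = 0 := by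
    obtain ⟨K, hK⟩ := hB.exists_nat (m - 1) v
    obtain ⟨K', hK'⟩ := hA.exists_nat 0 v
    filter_upwards [Filter.eventually_ge_atTop K, Filter.eventually_ge_atTop (K' + 1)]
      with L h1 h2
    refine ⟨hK L h1, ?_⟩
    have := hK' (L - 1) (by omega)
    rwa [zero_add, Nat.cast_sub (by omega), Nat.cast_one] at this
  obtain ⟨K, e1, e2, e3, e4, e5⟩ := ((nop_apply_eventually hA hB m v).and
    ((nop_apply_eventually hA hB m (T v)).and
    ((nop_apply_eventually hA hB (m - 1) v).and hev))).exists
  have key : ∀ L : ℕ,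
      ∑ i ∈ range L, T (A (-1 - i) (B (m + i) v) + B (m - 1 - i) (A i v)) =
        ∑ i ∈ range L, (A (-1 - i) (B (m + i) (T v)) + B (m - 1 - i) (A i (T v)))
        - (m : ℂ) • ∑ i ∈ range L, (A (-1 - i) (B (m - 1 + i) v) + B (m - 1 - 1 - i) (A i v))
        + (L : ℂ) • (A (-1 - L) (B (m - 1 + L) v) + B (m - 1 - L) (A (L - 1) v)) := by
    intro L
    induction L with
    | zero => simp
    | succ L ih =>
      rw [sum_range_succ, sum_range_succ, sum_range_succ, ih]
      rw [map_add, hTA.apply, hTB.apply, hTB.apply, hTA.apply]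
      have a1 : m - 1 - (L : ℤ) - 1 = m - 1 - 1 - L := by ring
      have a2 : m + (L : ℤ) - 1 = m - 1 + L := by ring
      have a3 : m - 1 + ((L + 1 : ℕ) : ℤ) = m + L := by push_cast; ring
      have a4 : m - 1 - ((L + 1 : ℕ) : ℤ) = m - 1 - 1 - L := by push_cast; ring
      have a5 : (((L + 1 : ℕ) : ℤ) - 1) = L := by push_cast; ring
      have a6 : (-1 - (L : ℤ) - 1) = -1 - ((L + 1 : ℕ) : ℤ) := by push_cast; ring
      rw [a1, a2, a3, a4, a5, a6]
      simp only [map_sub, map_smul]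
      push_cast
      module
  rw [e1, e2, e3, map_sum, key K, e4, e5, map_zero, map_zero, add_zero, smul_zero, add_zero]

theorem nop_neg_one_apply (hA : IsField A) (hB : IsField B) (hA' : IsCreative Ω A)
    (hB' : IsCreative Ω B) : nop A B (-1) Ω = A (-1) (B (-1) Ω) := by
  rw [nop_apply hA hB (-1) Ω (K := 1) (K' := 0) (fun i hi => hB' _ (by omega))
    (fun i _ => hA' _ (by omega))]
  simp

theorem IsCreative.nop (hA : IsField A) (hB : IsField B) (hA' : IsCreative Ω A)
    (hB' : IsCreative Ω B) : IsCreative Ω (nop A B) := by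
  intro n hn
  rw [nop_apply hA hB n Ω (K := 0) (K' := 0) (fun i hi => hB' _ (by omega))
    (fun i _ => hA' _ (by omega))]
  simp

theorem IsCovariant.resComm (hTA : IsCovariant T A) (hTB : IsCovariant T B) (j : ℕ) :
    IsCovariant T (resComm j A B) := by
  refine isCovariant_of_apply fun n v => ?_
  let c : ℕ → ℂ := fun i => (-1 : ℂ) ^ i * (j.choose i : ℂ)
  let D : ℤ → ℤ → Module.End ℂ V := fun p q => A p * B q - B q * A p
  have hD : ∀ p q v, T (D p q v) = D p q (T v) - (p : ℂ) • D (p - 1) q v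
      - (q : ℂ) • D p (q - 1) v := by
    intro p q v
    simp only [D, LinearMap.sub_apply, Module.End.mul_apply, map_sub, hTA.apply, hTB.apply,
      map_smul]
    module
  have hr : ∀ n v, VertexAlgebra.resComm j A B n v
      = ∑ i ∈ range (j + 1), c i • D ((j : ℤ) - i) (n + i) v := by
    intro n v
    rw [VertexAlgebra.resComm, LinearMap.sum_apply]
    refine sum_congr rfl fun i hi => ?_
    rw [Nat.cast_sub (Nat.lt_succ_iff.mp (mem_range.mp hi))]
    rfl
  rw [hr, hr, hr, map_sum, smul_sum, ← sum_sub_distrib, ← sub_eq_zero, ← sum_sub_distrib]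
  have hterm : ∀ i, T (c i • D ((j : ℤ) - i) (n + i) v) - (c i • D ((j : ℤ) - i) (n + i) (T v)
      - (n : ℂ) • c i • D ((j : ℤ) - i) (n - 1 + i) v)
      = (c (i + 1) * ((i + 1 : ℕ) : ℂ)) • D ((j : ℤ) - (i + 1 : ℕ)) (n - 1 + (i + 1 : ℕ)) v
        - (c i * i) • D ((j : ℤ) - i) (n - 1 + i) v := by
    intro i
    have hc : c (i + 1) * ((i + 1 : ℕ) : ℂ) = -(c i * ((j : ℂ) - i)) := by
      have h := Nat.choose_succ_right_eq j i
      have h' : (j.choose (i + 1) : ℂ) * ((i + 1 : ℕ) : ℂ) = j.choose i * ((j : ℂ) - i) := by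
        rcases le_or_gt i j with hij | hij
        · rw [← Nat.cast_sub hij]; exact_mod_cast h
        · rw [Nat.choose_eq_zero_of_lt hij, Nat.choose_eq_zero_of_lt (by omega)]; simp
      simp only [c, pow_succ, mul_assoc, h']
      ring
    rw [hc, map_smul, hD]
    have a1 : (j : ℤ) - ((i + 1 : ℕ) : ℤ) = j - i - 1 := by push_cast; ring
    have a2 : n - 1 + ((i + 1 : ℕ) : ℤ) = n + i := by push_cast; ring
    have a3 : n + (i : ℤ) - 1 = n - 1 + i := by ring
    rw [a1, a2, a3]
    push_cast
    module
  simp only [hterm]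
  rw [sum_range_sub (fun i : ℕ => (c i * i) • D ((j : ℤ) - i) (n - 1 + i) v)]
  simp [c]

theorem IsCreative.resComm (hA : IsCreative Ω A) (hB : IsCreative Ω B) (j : ℕ) :
    IsCreative Ω (resComm j A B) := by
  intro n hn
  rw [VertexAlgebra.resComm, LinearMap.sum_apply]
  refine sum_eq_zero fun i _ => ?_
  simp [hA (j - i : ℕ) (by omega), hB (n + i) (by omega)]

theorem resComm_neg_one_apply (hA : IsCreative Ω A) (hB : IsCreative Ω B) (j : ℕ) :
    resComm j A B (-1) Ω = A j (B (-1) Ω) := by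
  rw [VertexAlgebra.resComm, LinearMap.sum_apply, sum_eq_single 0]
  · simp [hA j (by omega)]
  · intro i _ hi
    simp [hA (j - i : ℕ) (by omega), hB (-1 + i) (by omega)]
  · simp

/-- Goddard's uniqueness argument. -/
theorem apply_eq_zero_of_isLocal (hT : T Ω = 0) (hTA : IsCovariant T A) (hA : IsCreative Ω A)
    (h0 : A (-1) Ω = 0) (hB : IsCreative Ω B) (h : IsLocal A B) (m : ℤ) :
    A m (B (-1) Ω) = 0 := by
  have hneg : ∀ k : ℕ, A (-1 - k) Ω = 0 := by
    intro k
    induction k with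
    | zero => simpa using h0
    | succ k ih =>
      have h1 := hTA.apply (-1 - k) Ω
      rw [ih, hT, map_zero, map_zero, zero_sub, eq_comm, neg_eq_zero, smul_eq_zero] at h1
      rcases h1 with h1 | h1
      · exfalso
        have : (-1 - (k : ℤ)) = 0 := by exact_mod_cast h1
        omega
      · rwa [Nat.cast_succ, ← sub_sub]
  have hall : ∀ n : ℤ, A n Ω = 0 := by
    intro n
    rcases le_or_gt 0 n with hn | hn
    · exact hA n hn
    · have := hneg (-1 - n).toNat
      rwa [show (-1 - ((-1 - n).toNat : ℤ)) = n by omega] at this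
  obtain ⟨N, hN⟩ := h
  have h1 := LinearMap.congr_fun (hN (m - N) (-1)) Ω
  rw [LinearMap.sum_apply, sum_eq_single 0] at h1
  · simpa [hall] using h1
  · intro j _ hj
    simp [hall, hB (-1 + j) (by omega)]
  · simp

end Covariance

/-! ### The reconstruction theorem -/

section Reconstruction

variable {V : Type*} [AddCommGroup V] [Module ℂ V]

theorem isField_one : IsField (fun n : ℤ => if n = -1 then (1 : Module.End ℂ V) else 0) :=
  fun v => ⟨0, fun n hn => by simp [show n ≠ -1 by omega]⟩

theorem isLocal_one (B : ℤ → Module.End ℂ V) :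
    IsLocal (fun n : ℤ => if n = -1 then (1 : Module.End ℂ V) else 0) B := by
  refine ⟨0, fun m n => ?_⟩
  simp only [CharP.cast_eq_zero, add_zero, zero_add, range_one, sum_singleton]
  split_ifs <;> simp

/-- The fields which are covariant, creative and local with respect to the fields `G i`. -/
def covariantFields {ι : Type*} (T : Module.End ℂ V) (Ω : V) (G : ι → ℤ → Module.End ℂ V) :
    Submodule ℂ (ℤ → Module.End ℂ V) where
  carrier := {A | IsField A ∧ IsCovariant T A ∧ IsCreative Ω A ∧ ∀ i, IsLocal A (G i)}
  add_mem' := by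
    rintro A B ⟨h1, h2, h3, h4⟩ ⟨k1, k2, k3, k4⟩
    refine ⟨isField_add h1 k1, isCovariant_of_apply fun n v => ?_, fun n hn => ?_,
      fun i => (h4 i).add (k4 i)⟩
    · simp only [Pi.add_apply, LinearMap.add_apply, map_add, h2.apply, k2.apply]
      module
    · simp [h3 n hn, k3 n hn]
  zero_mem' := ⟨fun v => ⟨0, fun _ _ => rfl⟩, fun n => by simp, fun n _ => rfl,
    fun i => isLocal_zero _⟩
  smul_mem' := by
    rintro c A ⟨h1, h2, h3, h4⟩
    refine ⟨fun v => ?_, isCovariant_of_apply fun n v => ?_, fun n hn => ?_,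
      fun i => (h4 i).smul c⟩
    · obtain ⟨N, hN⟩ := h1 v
      exact ⟨N, fun n hn => by simp [hN n hn]⟩
    · simp only [Pi.smul_apply, LinearMap.smul_apply, map_smul, h2.apply]
      module
    · simp [h3 n hn]

/-- The reconstruction theorem: mutually local, translation covariant homogeneous fields `G i`
whose negative modes generate `V` from `Ω` extend to a vertex algebra structure on `V`. The fields
of the vertex algebra are all covariant, creative fields local with respect to the `G i`; the map
`A ↦ A_(-1) Ω` is injective on these by Goddard's uniqueness argument and surjective since they
are closed under normally ordered products with derivatives of the `G i`. -/
theorem exists_of_generating {ι : Type*} (G : ι → ℤ → Module.End ℂ V) (Ω : V)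
    (T L0 : Module.End ℂ V) (wt : ι → ℂ) (grading : ℕ → Submodule ℂ V)
    (hint : DirectSum.IsInternal grading)
    (hgr : ∀ (n : ℕ) (a : V), a ∈ grading n → L0 a = (n : ℂ) • a)
    (hTΩ : T Ω = 0) (hLΩ : L0 Ω = 0) (hLT : L0 * T - T * L0 = T)
    (hfield : ∀ i, IsField (G i)) (hcov : ∀ i, IsCovariant T (G i))
    (hcre : ∀ i, IsCreative Ω (G i)) (hloc : ∀ i j, IsLocal (G i) (G j))
    (hwt : ∀ i n, L0 * G i n - G i n * L0 = (wt i - n - 1) • G i n)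
    (hspan : ∀ S : Submodule ℂ V, Ω ∈ S →
      (∀ (i : ι) (k : ℕ), ∀ v ∈ S, G i (-1 - k) v ∈ S) → S = ⊤) :
    ∃ 𝒱 : VertexAlgebra V, 𝒱.vac = Ω ∧ 𝒱.T = T ∧ 𝒱.L0 = L0 ∧
      ∀ i, 𝒱.Y (G i (-1) Ω) = G i := by
  set F := covariantFields T Ω G with hF
  -- the elements of `F` local with respect to all of `F`
  let F₁ : Submodule ℂ (ℤ → Module.End ℂ V) :=
    { carrier := {A | A ∈ F ∧ ∀ B ∈ F, IsLocal A B}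
      add_mem' := fun hA hB =>
        ⟨F.add_mem hA.1 hB.1, fun C hC => (hA.2 C hC).add (hB.2 C hC)⟩
      zero_mem' := ⟨F.zero_mem, fun _ _ => isLocal_zero _⟩
      smul_mem' := fun c A hA => ⟨F.smul_mem c hA.1, fun C hC => (hA.2 C hC).smul c⟩ }
  let s : (ℤ → Module.End ℂ V) →ₗ[ℂ] V :=
    LinearMap.applyₗ Ω ∘ₗ LinearMap.proj (-1 : ℤ)
  have hs : ∀ A, s A = A (-1) Ω := fun A => rfl
  have hGder : ∀ i (k : ℕ), derivField^[k] (G i) ∈ F₁ := by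
    intro i k
    induction k with
    | zero => exact ⟨⟨hfield i, hcov i, hcre i, hloc i⟩, fun B hB => (hB.2.2.2 i).symm⟩
    | succ k ih =>
      rw [Function.iterate_succ_apply']
      exact ⟨⟨ih.1.1.deriv, ih.1.2.1.deriv, ih.1.2.2.1.deriv, fun j => (ih.1.2.2.2 j).deriv⟩,
        fun B hB => (ih.2 B hB).deriv⟩
  have hone : (fun n : ℤ => if n = -1 then (1 : Module.End ℂ V) else 0) ∈ F₁ := by
    refine ⟨⟨isField_one, ?_, fun n hn => by simp [show n ≠ -1 by omega], fun i => isLocal_one _⟩,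
      fun B _ => isLocal_one B⟩
    intro n
    by_cases h1 : n = -1
    · simp [h1]
    · by_cases h2 : n = 0
      · simp [h2]
      · simp [h1, show n - 1 ≠ -1 by omega]
  have hnop : ∀ A ∈ F₁, ∀ B ∈ F₁, nop A B ∈ F₁ := by
    intro A hA B hB
    refine ⟨⟨isField_nop hA.1.1 hB.1.1, hA.1.2.1.nop hA.1.1 hB.1.1 hB.1.2.1,
      hA.1.2.2.1.nop hA.1.1 hB.1.1 hB.1.2.2.1, fun i => ?_⟩, fun C hC => ?_⟩
    · exact IsLocal.nop hA.1.1 hB.1.1 (hA.2 B hB.1) (hA.1.2.2.2 i) (hB.1.2.2.2 i)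
    · exact IsLocal.nop hA.1.1 hB.1.1 (hA.2 B hB.1) (hA.2 C hC) (hB.2 C hC)
  have hsurj : F₁.map s = ⊤ := by
    refine hspan _ ⟨_, hone, by simp [hs]⟩ ?_
    rintro i k _ ⟨A, hA, rfl⟩
    refine ⟨((k.factorial : ℂ)⁻¹) • nop (derivField^[k] (G i)) A,
      F₁.smul_mem _ (hnop _ (hGder i k) _ hA), ?_⟩
    rw [map_smul, hs, hs, nop_neg_one_apply (hGder i k).1.1 hA.1.1 (hGder i k).1.2.2.1
      hA.1.2.2.1, derivField_iterate_neg_one, LinearMap.smul_apply,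
      inv_smul_smul₀ (Nat.cast_ne_zero.mpr k.factorial_ne_zero)]
  have hinj : ∀ A ∈ F, s A = 0 → A = 0 := by
    intro A hA h0
    ext m v
    obtain ⟨B, hB, rfl⟩ : v ∈ F₁.map s := hsurj ▸ Submodule.mem_top
    exact apply_eq_zero_of_isLocal hTΩ hA.2.1 hA.2.2.1 h0 hB.1.2.2.1 (hB.2 A hA).symm m
  have hFF : ∀ A ∈ F, A ∈ F₁ := by
    intro A hA
    obtain ⟨B, hB, hBA⟩ : s A ∈ F₁.map s := hsurj ▸ Submodule.mem_top
    have := hinj (A - B) (F.sub_mem hA hB.1) (by rw [map_sub, hBA, sub_self])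
    rw [sub_eq_zero.mp this]; exact hB
  have hbij : Function.Bijective (s ∘ₗ F.subtype) := by
    constructor
    · rw [← LinearMap.ker_eq_bot, LinearMap.ker_eq_bot']
      intro A hA
      exact Subtype.ext (hinj A A.2 hA)
    · intro v
      obtain ⟨B, hB, rfl⟩ : v ∈ F₁.map s := hsurj ▸ Submodule.mem_top
      exact ⟨⟨B, hB.1⟩, rfl⟩
  let e : F ≃ₗ[ℂ] V := LinearEquiv.ofBijective _ hbij
  have he : ∀ A (hA : A ∈ F), e.symm (A (-1) Ω) = ⟨A, hA⟩ := by
    intro A hA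
    rw [LinearEquiv.symm_apply_eq]; rfl
  have hes : ∀ a, (e.symm a : ℤ → Module.End ℂ V) (-1) Ω = a := fun a => e.apply_symm_apply a
  -- `[L₀, A(z)] - z ∂_z A(z)` is in `F` for all `A` in `F`
  have hLF : ∀ A ∈ F, (fun n : ℤ => L0 * A n - A n * L0 + ((n : ℂ) + 1) • A n) ∈ F := by
    intro A hA
    obtain ⟨h1, h2, h3, h4⟩ := hA
    refine ⟨fun v => ?_, isCovariant_of_apply fun n v => ?_, fun n hn => ?_, fun i => ?_⟩
    · obtain ⟨N, hN⟩ := h1 v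
      obtain ⟨M, hM⟩ := h1 (L0 v)
      exact ⟨max N M, fun n hn => by
        simp [hN n (le_trans (le_max_left _ _) hn), hM n (le_trans (le_max_right _ _) hn)]⟩
    · have hc : ∀ u, T (L0 u) = L0 (T u) - T u := by
        intro u
        have := LinearMap.congr_fun hLT u
        simp only [LinearMap.sub_apply, Module.End.mul_apply] at this
        rw [sub_eq_iff_eq_add] at this
        rw [this]; abel
      simp only [LinearMap.add_apply, LinearMap.sub_apply, Module.End.mul_apply,
        LinearMap.smul_apply, map_add, map_sub, map_smul, hc, h2.apply]
      push_cast
      module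
    · simp [h3 n hn, hLΩ]
    · obtain ⟨N, hN⟩ := h4 i
      refine ⟨N, fun m n => ?_⟩
      have e1 := hN m n
      have e2 : L0 * (∑ j ∈ range (N + 1), ((-1 : ℂ) ^ j * (N.choose j : ℂ)) •
          (A (m + N - j) * G i (n + j) - G i (n + j) * A (m + N - j)))
          - (∑ j ∈ range (N + 1), ((-1 : ℂ) ^ j * (N.choose j : ℂ)) •
          (A (m + N - j) * G i (n + j) - G i (n + j) * A (m + N - j))) * L0
          - (wt i - n - 1 - (m + N + 1)) • (∑ j ∈ range (N + 1),
            ((-1 : ℂ) ^ j * (N.choose j : ℂ)) •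
          (A (m + N - j) * G i (n + j) - G i (n + j) * A (m + N - j))) = 0 := by
        rw [e1]; simp
      rw [mul_sum, sum_mul, smul_sum, ← sum_sub_distrib, ← sum_sub_distrib] at e2
      rw [← e2]
      refine sum_congr rfl fun j _ => ?_
      have hG : ∀ v, L0 (G i (n + j) v)
          = G i (n + j) (L0 v) + (wt i - (n + j : ℤ) - 1) • G i (n + j) v := by
        intro v
        have := LinearMap.congr_fun (hwt i (n + j)) v
        simp only [LinearMap.sub_apply, Module.End.mul_apply, LinearMap.smul_apply] at this
        rw [← this]; abel
      ext v
      simp only [LinearMap.add_apply, LinearMap.sub_apply, Module.End.mul_apply,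
        LinearMap.smul_apply, map_add, map_sub, map_smul, hG]
      push_cast
      module
  refine ⟨
    { grading := grading
      isInternal := hint
      vac := Ω
      L0 := L0
      T := T
      Y := F.subtype ∘ₗ e.symm.toLinearMap
      field := fun a b => (e.symm a).2.1 b
      Y_vac := ?_
      Y_apply_vac_of_nonneg := fun a n hn => (e.symm a).2.2.2.1 n hn
      Y_apply_vac := hes
      L0_apply := hgr
      L0_comm := ?_
      T_comm := fun a n => (e.symm a).2.2.1 n
      T_vac := hTΩ
      locality := fun a b => (hFF _ (e.symm a).2).2 _ (e.symm b).2 }, rfl, rfl, rfl, ?_⟩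
  · intro n
    have := he _ hone.1
    simp only [if_true, Module.End.one_apply] at this
    change (e.symm Ω : ℤ → Module.End ℂ V) n = _
    rw [this]
  · intro a n
    have := he _ (hLF _ (e.symm a).2)
    have h2 : ((fun n : ℤ => L0 * (e.symm a : ℤ → Module.End ℂ V) n
        - (e.symm a : ℤ → Module.End ℂ V) n * L0
        + ((n : ℂ) + 1) • (e.symm a : ℤ → Module.End ℂ V) n) (-1)) Ω = L0 a := by
      simp [hes, hLΩ]
    rw [h2] at this
    simp only [LinearMap.comp_apply, LinearEquiv.coe_coe, this, Submodule.subtype_apply]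
    module
  · intro i
    have := he _ (hGder i 0).1
    simp only [Function.iterate_zero, id_eq] at this
    simp [this]

end Reconstruction

end VertexAlgebra

namespace VertexAlgebra

/-! ### Products and commutators in a vertex algebra -/

section Binomial

/-- The binomial coefficient `x (x - 1) ⋯ (x - j + 1) / j!` of a complex number. -/
noncomputable def binom (x : ℂ) : ℕ → ℂ
  | 0 => 1
  | j + 1 => binom x j * (x - j) / (j + 1)

theorem binom_add_one (x : ℂ) (j : ℕ) : binom (x + 1) (j + 1) = binom x (j + 1) + binom x j := by
  have absorb : ∀ j : ℕ, binom (x + 1) (j + 1) = binom x j * (x + 1) / (j + 1) := by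
    intro j
    induction j with
    | zero => simp [binom]
    | succ j ih =>
      have h1 : (j : ℂ) + 1 ≠ 0 := by exact_mod_cast j.succ_ne_zero
      have h2 : (j : ℂ) + 1 + 1 ≠ 0 := by exact_mod_cast (j + 1).succ_ne_zero
      rw [binom, ih, binom]
      push_cast
      field_simp
      ring
  have h1 : (j : ℂ) + 1 ≠ 0 := by exact_mod_cast j.succ_ne_zero
  rw [absorb, binom]
  field_simp
  ring

/-- Newton's interpolation formula for a function on `ℤ` whose `N`-th differences vanish. -/
theorem eq_sum_fwdDiff {X : Type*} [AddCommGroup X] [Module ℂ X] (N : ℕ) (h : ℤ → X)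
    (hN : ∀ m, (fwdDiff 1)^[N] h m = 0) (m : ℤ) :
    h m = ∑ j ∈ range N, binom m j • (fwdDiff 1)^[j] h 0 := by
  induction N generalizing h m with
  | zero => simpa using hN m
  | succ N ih =>
    have h1 := ih (fwdDiff 1 h) (fun m => by simpa using hN m)
    simp only [← Function.iterate_succ_apply] at h1
    have hstep : ∀ m : ℤ, ∑ j ∈ range (N + 1), binom ((m + 1 : ℤ) : ℂ) j • (fwdDiff 1)^[j] h 0
        - ∑ j ∈ range (N + 1), binom m j • (fwdDiff 1)^[j] h 0 = h (m + 1) - h m := by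
      intro m
      rw [← fwdDiff, h1 m, ← sum_sub_distrib, sum_range_succ']
      have b0 : ∀ x, binom x 0 = 1 := fun _ => rfl
      simp only [b0, Int.cast_add, Int.cast_one, sub_self, add_zero]
      refine sum_congr rfl fun j _ => ?_
      rw [binom_add_one]
      module
    induction m using Int.induction_on with
    | zero =>
      rw [sum_range_succ', sum_eq_zero]
      · simp [binom]
      · intro j _
        have : ∀ j : ℕ, binom 0 (j + 1) = 0 := by
          intro j
          induction j with
          | zero => simp [binom]
          | succ j ih => rw [binom, ih]; simp
        simp [this]
    | succ i hi =>
      have := hstep i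
      rw [← hi] at this
      exact (sub_left_inj.mp this).symm
    | pred i hi =>
      have := hstep (-(i : ℤ) - 1)
      rw [sub_add_cancel, ← hi] at this
      exact (sub_right_inj.mp this).symm

end Binomial

variable {V : Type*} [AddCommGroup V] [Module ℂ V] (𝒱 : VertexAlgebra V)

theorem isField_Y (a : V) : IsField (𝒱.Y a) := 𝒱.field a

theorem isCovariant_Y (a : V) : IsCovariant 𝒱.T (𝒱.Y a) := 𝒱.T_comm a

theorem isCreative_Y (a : V) : IsCreative 𝒱.vac (𝒱.Y a) := 𝒱.Y_apply_vac_of_nonneg a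

theorem isLocal_Y (a b : V) : IsLocal (𝒱.Y a) (𝒱.Y b) := 𝒱.locality a b

theorem eq_Y_of_isLocal {A : ℤ → Module.End ℂ V} (hc : IsCovariant 𝒱.T A)
    (hv : IsCreative 𝒱.vac A) (hl : ∀ b, IsLocal A (𝒱.Y b)) : A = 𝒱.Y (A (-1) 𝒱.vac) := by
  have h := fun m b => apply_eq_zero_of_isLocal (A := A + (-1 : ℂ) • 𝒱.Y (A (-1) 𝒱.vac))
    (B := 𝒱.Y b) 𝒱.T_vac
    (isCovariant_of_apply fun n v => by
      simp only [Pi.add_apply, Pi.smul_apply, LinearMap.add_apply, LinearMap.smul_apply, map_add,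
        map_smul, hc.apply, (𝒱.isCovariant_Y _).apply]
      module)
    (fun n hn => by simp [hv n hn, 𝒱.Y_apply_vac_of_nonneg _ n hn])
    (by simp [𝒱.Y_apply_vac]) (𝒱.isCreative_Y b)
    ((hl b).add ((𝒱.isLocal_Y _ b).smul _)) m
  ext m b
  have := h m b
  simpa [𝒱.Y_apply_vac, ← sub_eq_add_neg, sub_eq_zero] using this

theorem T_apply (a : V) : 𝒱.T a = 𝒱.Y a (-2) 𝒱.vac := by
  have := (𝒱.isCovariant_Y a).apply (-1) 𝒱.vac
  simpa [𝒱.Y_apply_vac, 𝒱.T_vac] using this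

theorem Y_T (a : V) : 𝒱.Y (𝒱.T a) = derivField (𝒱.Y a) := by
  have := 𝒱.eq_Y_of_isLocal (𝒱.isCovariant_Y a).deriv (𝒱.isCreative_Y a).deriv
    fun b => (𝒱.isLocal_Y a b).deriv
  rw [this]
  congr 1
  simp [derivField, T_apply]

theorem Y_T_apply (a : V) (n : ℤ) : 𝒱.Y (𝒱.T a) n = (-(n : ℂ)) • 𝒱.Y a (n - 1) := by
  rw [Y_T]; rfl

theorem Y_nop (a b : V) : 𝒱.Y (𝒱.Y a (-1) b) = nop (𝒱.Y a) (𝒱.Y b) := by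
  have ha := 𝒱.isField_Y a
  have hb := 𝒱.isField_Y b
  have := 𝒱.eq_Y_of_isLocal ((𝒱.isCovariant_Y a).nop ha hb (𝒱.isCovariant_Y b))
    ((𝒱.isCreative_Y a).nop ha hb (𝒱.isCreative_Y b))
    fun c => IsLocal.nop ha hb (𝒱.isLocal_Y a b) (𝒱.isLocal_Y a c) (𝒱.isLocal_Y b c)
  rw [this, nop_neg_one_apply ha hb (𝒱.isCreative_Y a) (𝒱.isCreative_Y b), 𝒱.Y_apply_vac]

theorem Y_nop_apply (a b : V) (m : ℤ) (v : V) {K K' : ℕ}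
    (hK : ∀ i : ℕ, K ≤ i → 𝒱.Y b (m + i) v = 0) (hK' : ∀ i : ℕ, K' ≤ i → 𝒱.Y a i v = 0) :
    𝒱.Y (𝒱.Y a (-1) b) m v = ∑ i ∈ range K, 𝒱.Y a (-1 - i) (𝒱.Y b (m + i) v)
      + ∑ i ∈ range K', 𝒱.Y b (m - 1 - i) (𝒱.Y a i v) := by
  rw [Y_nop, nop_apply (𝒱.isField_Y a) (𝒱.isField_Y b) m v hK hK']

theorem Y_resComm (a b : V) (j : ℕ) : 𝒱.Y (𝒱.Y a j b) = resComm j (𝒱.Y a) (𝒱.Y b) := by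
  have := 𝒱.eq_Y_of_isLocal ((𝒱.isCovariant_Y a).resComm (𝒱.isCovariant_Y b) j)
    ((𝒱.isCreative_Y a).resComm (𝒱.isCreative_Y b) j)
    fun c => IsLocal.resComm (𝒱.isLocal_Y a b) (𝒱.isLocal_Y a c) (𝒱.isLocal_Y b c) j
  rw [this, resComm_neg_one_apply (𝒱.isCreative_Y a) (𝒱.isCreative_Y b), 𝒱.Y_apply_vac]

/-- Borcherds' commutator formula. -/
theorem commutator (a b : V) {M : ℕ} (hM : ∀ j : ℕ, M ≤ j → 𝒱.Y a j b = 0) (m n : ℤ) :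
    𝒱.Y a m * 𝒱.Y b n - 𝒱.Y b n * 𝒱.Y a m =
      ∑ j ∈ range M, binom m j • 𝒱.Y (𝒱.Y a j b) (m + n - j) := by
  obtain ⟨N, hN⟩ := 𝒱.isLocal_Y a b
  let h : ℤ → Module.End ℂ V := fun k => 𝒱.Y a k * 𝒱.Y b (m + n - k) - 𝒱.Y b (m + n - k) * 𝒱.Y a k
  have hd : ∀ (j : ℕ) (k : ℤ), (fwdDiff 1)^[j] h k = ∑ i ∈ range (j + 1),
      ((-1 : ℂ) ^ i * (j.choose i : ℂ)) • h (k + j - i) := by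
    intro j k
    rw [fwdDiff_iter_eq_sum_shift, ← sum_range_reflect]
    refine sum_congr rfl fun i hi => ?_
    have hi' := Nat.lt_succ_iff.mp (mem_range.mp hi)
    have e1 : j + 1 - 1 - i = j - i := by omega
    have e2 : j - (j - i) = i := by omega
    have e3 : k + (j - i : ℕ) • (1 : ℤ) = k + j - i := by simp [hi']; ring
    rw [e1, e2, e3, Nat.choose_symm hi', ← Int.cast_smul_eq_zsmul ℂ]
    push_cast
    rfl
  have h0 : ∀ k, (fwdDiff 1)^[max N M] h k = 0 := by
    intro k
    rw [hd, ← (hN.mono (le_max_left N M)) k (m + n - k - (max N M : ℕ))]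
    refine sum_congr rfl fun i _ => ?_
    simp only [h]
    rw [show m + n - (k + ((max N M : ℕ) : ℤ) - i) = m + n - k - ((max N M : ℕ) : ℤ) + i by ring]
  have h1 := eq_sum_fwdDiff (max N M) h h0 m
  have h2 : ∀ j : ℕ, (fwdDiff 1)^[j] h 0 = 𝒱.Y (𝒱.Y a j b) (m + n - j) := by
    intro j
    rw [hd, Y_resComm, resComm]
    refine sum_congr rfl fun i hi => ?_
    have hi' := Nat.lt_succ_iff.mp (mem_range.mp hi)
    simp only [h, zero_add]
    rw [Nat.cast_sub hi', show m + n - ((j : ℤ) - i) = m + n - j + i by ring]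
  simp only [h2] at h1
  have h3 : h m = 𝒱.Y a m * 𝒱.Y b n - 𝒱.Y b n * 𝒱.Y a m := by
    simp only [h, add_sub_cancel_left]
  rw [← h3, h1]
  symm
  refine sum_subset (range_subset_range.mpr (le_max_right N M)) fun j _ hj => ?_
  rw [hM j (by simpa using hj)]
  simp

/-! ### The grading and Zhu's operations -/

theorem L0_vac : 𝒱.L0 𝒱.vac = 0 := by
  have h := 𝒱.L0_comm 𝒱.vac (-1)
  rw [𝒱.Y_vac] at h
  have := LinearMap.congr_fun h 𝒱.vac
  simpa [𝒱.Y_apply_vac] using this.symm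

theorem L0_Y_apply (a : V) (n : ℤ) (v : V) :
    𝒱.L0 (𝒱.Y a n v) = 𝒱.Y a n (𝒱.L0 v) + (-(n : ℂ) - 1) • 𝒱.Y a n v + 𝒱.Y (𝒱.L0 a) n v := by
  have := LinearMap.congr_fun (𝒱.L0_comm a n) v
  simp only [LinearMap.sub_apply, Module.End.mul_apply, LinearMap.smul_apply,
    LinearMap.add_apply] at this
  rw [sub_eq_iff_eq_add] at this
  rw [this]; abel

theorem grading_induction {P : V → Prop} (hom : ∀ n, ∀ a ∈ 𝒱.grading n, P a) (zero : P 0)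
    (add : ∀ a b, P a → P b → P (a + b)) (a : V) : P a := by
  have ha : a ∈ iSup 𝒱.grading := by
    rw [𝒱.isInternal.submodule_iSup_eq_top]; exact Submodule.mem_top
  exact Submodule.iSup_induction 𝒱.grading (motive := P) ha hom zero add

theorem decomp_L0 (a : V) (i : ℕ) : ((𝒱.decomp (𝒱.L0 a) i : 𝒱.grading i) : V)
    = (i : ℂ) • (𝒱.decomp a i : V) := by
  induction a using 𝒱.grading_induction with
  | hom k a ha =>
    have e : 𝒱.decomp a = DirectSum.lof ℂ ℕ (fun n => 𝒱.grading n) k ⟨a, ha⟩ := by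
      rw [decomp, LinearEquiv.symm_apply_eq]
      simp [DirectSum.coeLinearMap_lof]
    rw [𝒱.L0_apply k a ha, map_smul, DirectSum.smul_apply, e]
    by_cases hki : k = i
    · subst hki; simp
    · rw [DirectSum.lof_eq_of, DirectSum.of_eq_of_ne _ _ _ (Ne.symm hki)]; simp
  | zero => simp
  | add a b ha hb => simp [ha, hb, smul_add]

theorem mem_grading_iff {n : ℕ} {a : V} : a ∈ 𝒱.grading n ↔ 𝒱.L0 a = (n : ℂ) • a := by
  refine ⟨𝒱.L0_apply n a, fun h => ?_⟩
  have h1 : ∀ i, i ≠ n → 𝒱.decomp a i = 0 := by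
    intro i hi
    have := 𝒱.decomp_L0 a i
    rw [h, map_smul, DirectSum.smul_apply, Submodule.coe_smul, ← sub_eq_zero, ← sub_smul,
      smul_eq_zero] at this
    rcases this with h2 | h2
    · exact absurd (by exact_mod_cast (sub_eq_zero.mp h2).symm) hi
    · exact Subtype.ext h2
  have h2 : 𝒱.decomp a = DirectSum.lof ℂ ℕ (fun n => 𝒱.grading n) n (𝒱.decomp a n) := by
    refine DFinsupp.ext fun i => ?_
    by_cases hi : i = n
    · subst hi; rw [DirectSum.lof_eq_of, DirectSum.of_eq_same]
    · rw [h1 i hi, DirectSum.lof_eq_of, DirectSum.of_eq_of_ne _ _ _ hi]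
  have h3 : 𝒱.decomp.symm (𝒱.decomp a) = (𝒱.decomp a n : V) := by
    rw [h2]
    simp [decomp, DirectSum.coeLinearMap_lof]
  rw [LinearEquiv.symm_apply_apply] at h3
  rw [h3]; exact Subtype.mem _

theorem T_mem_grading {p : ℕ} {a : V} (ha : a ∈ 𝒱.grading p) : 𝒱.T a ∈ 𝒱.grading (p + 1) := by
  rw [mem_grading_iff] at ha ⊢
  rw [T_apply, L0_Y_apply, ha, L0_vac]
  simp only [map_zero, map_smul, Pi.smul_apply, LinearMap.smul_apply]
  push_cast
  module

theorem Y_mem_grading {p q r : ℕ} {a b : V} (ha : a ∈ 𝒱.grading p) (hb : b ∈ 𝒱.grading q) {n : ℤ}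
    (hr : (r : ℤ) = p + q - n - 1) : 𝒱.Y a n b ∈ 𝒱.grading r := by
  rw [mem_grading_iff] at ha hb ⊢
  have : (r : ℂ) = p + q - n - 1 := by exact_mod_cast congrArg (Int.cast : ℤ → ℂ) hr
  rw [L0_Y_apply, ha, hb, this]
  simp only [map_smul, Pi.smul_apply, LinearMap.smul_apply]
  module

theorem residue_apply (p : ℕ) (k : ℤ) (a b : V) : 𝒱.residue p k a b =
    ∑ j ∈ range (p + 1), (p.choose j : ℂ) • 𝒱.Y a ((j : ℤ) - k) b := by
  simp [residue, LinearMap.sum_apply]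

/-- Integration by parts: `Res_z (∂_z Y(a, z)) (1 + z)^(p + 1) / z^k b`. -/
theorem residue_T (p : ℕ) (k : ℤ) (a b : V) : 𝒱.residue (p + 1) k (𝒱.T a) b =
    ((k : ℂ) - p - 1) • 𝒱.residue p k a b + (k : ℂ) • 𝒱.residue p (k + 1) a b := by
  have h : ∑ j ∈ range (p + 1), (p.choose j : ℂ) • 𝒱.Y a ((j : ℤ) - (k + 1)) b
      = ∑ j ∈ range (p + 2), (p.choose j : ℂ) • 𝒱.Y a ((j : ℤ) - (k + 1)) b := by
    rw [sum_range_succ _ (p + 1)]; simp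
  rw [residue_apply, residue_apply, residue_apply, h, sum_range_succ', sum_range_succ' _ (p + 1),
    smul_add, ← add_assoc, smul_sum, smul_sum, ← sum_add_distrib]
  congr 1
  · refine sum_congr rfl fun j _ => ?_
    have e : ((j + 1 : ℕ) : ℤ) - k - 1 = j - k := by push_cast; ring
    have e' : ((j + 1 : ℕ) : ℤ) - (k + 1) = j - k := by push_cast; ring
    rw [Y_T_apply, e, e', LinearMap.smul_apply, smul_smul, smul_smul, smul_smul, ← add_smul]
    congr 1
    have h1 : ((p + 1).choose (j + 1) : ℂ) * ((j : ℂ) + 1) = (p + 1) * p.choose j := by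
      exact_mod_cast (Nat.add_one_mul_choose_eq p j).symm
    have h2 : ((p + 1).choose (j + 1) : ℂ) = p.choose j + p.choose (j + 1) := by
      exact_mod_cast Nat.choose_succ_succ p j
    push_cast
    linear_combination -h1 + (k : ℂ) * h2
  · rw [Y_T_apply, show ((0 : ℕ) : ℤ) - (k + 1) = ((0 : ℕ) : ℤ) - k - 1 by ring]
    simp

theorem residue_mem_O {p : ℕ} {a : V} (ha : a ∈ 𝒱.grading p) (b : V) (i : ℕ) :
    𝒱.residue p (2 + i) a b ∈ 𝒱.O := by
  induction i generalizing p a with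
  | zero =>
    refine Submodule.subset_span ⟨a, b, ?_⟩
    rw [circ, 𝒱.zhuOp_of_mem 2 ha, residue_apply]; simp
  | succ i ih =>
    have h1 := ih (𝒱.T_mem_grading ha)
    have h2 := ih ha
    rw [residue_T] at h1
    have h3 := (Submodule.add_mem_iff_right _ (𝒱.O.smul_mem _ h2)).mp h1
    have h4 : (((2 + (i : ℤ)) : ℤ) : ℂ) ≠ 0 := by
      have : (2 + (i : ℤ)) ≠ 0 := by omega
      exact_mod_cast this
    have h5 := (Submodule.smul_mem_iff _ h4).mp h3
    rwa [Nat.cast_succ, ← add_assoc]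

theorem star_of_mem {p : ℕ} {a : V} (ha : a ∈ 𝒱.grading p) (b : V) :
    𝒱.star a b = 𝒱.residue p 1 a b := by
  rw [star, 𝒱.zhuOp_of_mem 1 ha, residue_apply]

/-- The vector `a ∘ |0⟩` is `T a + L₀ a`. -/
theorem T_add_L0_mem_O (a : V) : 𝒱.T a + 𝒱.L0 a ∈ 𝒱.O := by
  induction a using 𝒱.grading_induction with
  | hom p a ha =>
    have h := 𝒱.residue_mem_O ha 𝒱.vac 0
    rw [residue_apply, Nat.cast_zero, add_zero] at h
    have : ∑ j ∈ range (p + 1), (p.choose j : ℂ) • 𝒱.Y a ((j : ℤ) - 2) 𝒱.vac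
        = 𝒱.T a + 𝒱.L0 a := by
      rw [𝒱.L0_apply p a ha, T_apply]
      rcases p with _ | p
      · simp
      · rw [sum_range_succ', sum_range_succ', sum_eq_zero]
        · have e : (((0 + 1 : ℕ) : ℤ) - 2) = -1 := by norm_num
          rw [e, 𝒱.Y_apply_vac]
          simp [add_comm]
        · intro j _
          rw [𝒱.Y_apply_vac_of_nonneg _ _ (by push_cast; omega), smul_zero]
    rwa [this] at h
  | zero => simp
  | add a b ha hb =>
    rw [map_add, map_add, add_add_add_comm]
    exact 𝒱.O.add_mem ha hb

end VertexAlgebra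

namespace WThree

/-! ### Vacuum representations of the `W₃` algebra -/

/-- The coefficient of `L_{m+n}` in `[W_m, W_n]`. -/
noncomputable def coeffL (m n : ℤ) : ℂ :=
  ((m : ℂ) - n) * (1 / 15 * ((m : ℂ) + n + 3) * ((m : ℂ) + n + 2)
          - 1 / 6 * ((m : ℂ) + 2) * ((n : ℂ) + 2))

/-- The vector `x₁ x₂ ⋯ x_k Ω`, for operators `L_n`, `W_n` on `V`. -/
def wordOf {V : Type*} [AddCommGroup V] [Module ℂ V] (L W : ℤ → Module.End ℂ V) (Ω : V)
    (l : List Gen) : V :=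
  l.foldr (fun g v => match g with | .L n => L n v | .W n => W n v) Ω

/-- The operator given by the truncation of `Λ_m` to summation indices between `-K` and `K`. -/
noncomputable def lambdaOf {V : Type*} [AddCommGroup V] [Module ℂ V] (L : ℤ → Module.End ℂ V)
    (K m : ℤ) (v : V) : V :=
  ∑ n ∈ Finset.Icc (-K) (-2), L n (L (m - n) v)
    + ∑ n ∈ Finset.Icc (-1) K, L (m - n) (L n v)
    - (3 / 10 * ((m : ℂ) + 2) * ((m : ℂ) + 3)) • L m v

/-- Operators `L_n`, `W_n` on a complex vector space `V` and a vector `Ω` satisfying the defining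
relations of the vacuum module. Working with these, rather than with the quotient that defines
the vacuum module, allows the same lemmas to be used for the free field realization. -/
structure VacuumRep (c : ℂ) (V : Type*) [AddCommGroup V] [Module ℂ V] where
  /-- the operators `L_n` -/
  L : ℤ → Module.End ℂ V
  /-- the operators `W_n` -/
  W : ℤ → Module.End ℂ V
  /-- the vacuum vector -/
  Ω : V
  L_vac : ∀ n : ℤ, -1 ≤ n → L n Ω = 0
  W_vac : ∀ n : ℤ, -2 ≤ n → W n Ω = 0
  word_eq_zero : ∀ l : List Gen, 0 < degree l → wordOf L W Ω l = 0
  LL : ∀ (m n : ℤ) (v : V), L m (L n v) = L n (L m v) + (((m : ℂ) - n) • L (m + n) v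
      + (if m + n = 0 then c / 12 * ((m : ℂ) ^ 3 - m) else 0) • v)
  LW : ∀ (m n : ℤ) (v : V), L m (W n v) = W n (L m v) + (2 * (m : ℂ) - n) • W (m + n) v
  WW : ∀ (m n K : ℤ) (l : List Gen), |m + n| + |degree l| ≤ K →
    W m (W n (wordOf L W Ω l)) = W n (W m (wordOf L W Ω l))
      + (coeffL m n • L (m + n) (wordOf L W Ω l)
      + (16 / (22 + 5 * c) * ((m : ℂ) - n)) • lambdaOf L K (m + n) (wordOf L W Ω l)
      + (if m + n = 0 then c / 360 * (m : ℂ) * ((m : ℂ) ^ 2 - 1) * ((m : ℂ) ^ 2 - 4) else 0)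
          • wordOf L W Ω l)

section VacuumModule

variable (c : ℂ)

/-- The vector `x₁ x₂ ⋯ x_k |0⟩` of the vacuum module. -/
noncomputable def word (l : List Gen) : VacuumModule c := monomial l • vac c

theorem opL_apply (n : ℤ) (v : VacuumModule c) : opL c n v = genL n • v := rfl

theorem opW_apply (n : ℤ) (v : VacuumModule c) : opW c n v = genW n • v := rfl

theorem word_nil : word c [] = vac c := by simp [word, monomial]

theorem word_L (n : ℤ) (l : List Gen) : word c (Gen.L n :: l) = opL c n (word c l) := by
  simp [word, monomial, genL, mul_smul, opL_apply]

theorem word_W (n : ℤ) (l : List Gen) : word c (Gen.W n :: l) = opW c n (word c l) := by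
  simp [word, monomial, genW, mul_smul, opW_apply]

theorem smul_vac_eq_mk (x : FreeAlg) :
    x • vac c = Submodule.Quotient.mk (Submodule.Quotient.mk x : Verma c 0 0) := by
  rw [vac, ← Submodule.Quotient.mk_smul, hwVec, ← Submodule.Quotient.mk_smul, smul_eq_mul, mul_one]

theorem exists_smul_vac (v : VacuumModule c) : ∃ x : FreeAlg, x • vac c = v := by
  obtain ⟨v, rfl⟩ := Submodule.Quotient.mk_surjective _ v
  obtain ⟨x, rfl⟩ := Submodule.Quotient.mk_surjective _ v
  exact ⟨x, smul_vac_eq_mk c x⟩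

theorem rel_smul_vac {x : FreeAlg} (h : VermaRel c 0 0 x) : x • vac c = 0 := by
  rw [smul_vac_eq_mk, (Submodule.Quotient.mk_eq_zero (vermaIdeal c 0 0)).mpr
    (Submodule.subset_span h)]
  rfl

theorem mem_span_word (v : VacuumModule c) : v ∈ Submodule.span ℂ (Set.range (word c)) := by
  obtain ⟨x, rfl⟩ := exists_smul_vac c v
  have : ∀ v ∈ Submodule.span ℂ (Set.range (word c)),
      x • v ∈ Submodule.span ℂ (Set.range (word c)) := by
    induction x using FreeAlgebra.induction with
    | grade0 r =>
      intro v hv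
      rw [algebraMap_smul]
      exact Submodule.smul_mem _ _ hv
    | grade1 g =>
      intro v hv
      induction hv using Submodule.span_induction with
      | mem v hv =>
        obtain ⟨l, rfl⟩ := hv
        refine Submodule.subset_span ⟨g :: l, ?_⟩
        simp [word, monomial, mul_smul]
      | zero => simp
      | add a b _ _ ha hb => rw [smul_add]; exact Submodule.add_mem _ ha hb
      | smul r a _ ha => rw [smul_comm]; exact Submodule.smul_mem _ _ ha
    | mul x y hx hy => intro v hv; rw [mul_smul]; exact hx _ (hy _ hv)
    | add x y hx hy => intro v hv; rw [add_smul]; exact Submodule.add_mem _ (hx _ hv) (hy _ hv)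
  exact this _ (Submodule.subset_span ⟨[], word_nil c⟩)

theorem word_induction {P : VacuumModule c → Prop} (hw : ∀ l, P (word c l)) (zero : P 0)
    (add : ∀ a b, P a → P b → P (a + b)) (smul : ∀ (r : ℂ) a, P a → P (r • a))
    (v : VacuumModule c) : P v := by
  have hv := mem_span_word c v
  induction hv using Submodule.span_induction with
  | mem v hv => obtain ⟨l, rfl⟩ := hv; exact hw l
  | zero => exact zero
  | add a b _ _ ha hb => exact add a b ha hb
  | smul r a _ ha => exact smul r a ha

theorem L_vac {n : ℤ} (hn : -1 ≤ n) : opL c n (vac c) = 0 := by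
  rcases hn.eq_or_lt with rfl | hn
  · rw [opL_apply, vac, ← Submodule.Quotient.mk_smul, Submodule.Quotient.mk_eq_zero]
    exact Submodule.subset_span (by simp)
  · rcases (show 0 ≤ n by omega).eq_or_lt with rfl | hn
    · simpa [opL_apply] using rel_smul_vac c (VermaRel.L_zero (c := c) (t := 0) (w := 0))
    · exact rel_smul_vac c (VermaRel.L_pos n hn)

theorem W_vac {n : ℤ} (hn : -2 ≤ n) : opW c n (vac c) = 0 := by
  rcases hn.eq_or_lt with rfl | hn
  · rw [opW_apply, vac, ← Submodule.Quotient.mk_smul, Submodule.Quotient.mk_eq_zero]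
    exact Submodule.subset_span (by simp)
  rcases (show -1 ≤ n by omega).eq_or_lt with rfl | hn
  · rw [opW_apply, vac, ← Submodule.Quotient.mk_smul, Submodule.Quotient.mk_eq_zero]
    exact Submodule.subset_span (by simp)
  · rcases (show 0 ≤ n by omega).eq_or_lt with rfl | hn
    · simpa [opW_apply] using rel_smul_vac c (VermaRel.W_zero (c := c) (t := 0) (w := 0))
    · exact rel_smul_vac c (VermaRel.W_pos n hn)

theorem word_eq_zero {l : List Gen} (h : 0 < degree l) : word c l = 0 :=
  rel_smul_vac c (VermaRel.degree_pos l h)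

theorem lsmul_word_eq_zero {x : FreeAlg} {l : List Gen} (h : VermaRel c 0 0 (x * monomial l)) :
    Algebra.lsmul ℂ ℂ (VacuumModule c) x (word c l) = 0 := by
  have := rel_smul_vac c h
  rwa [mul_smul, ← word] at this

theorem LL_apply (m n : ℤ) (v : VacuumModule c) : opL c m (opL c n v) =
    opL c n (opL c m v) + (((m : ℂ) - n) • opL c (m + n) v
      + (if m + n = 0 then c / 12 * ((m : ℂ) ^ 3 - m) else 0) • v) := by
  induction v using word_induction with
  | hw l =>
    have h := lsmul_word_eq_zero c (VermaRel.LL m n l)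
    simp only [relLL, map_sub, map_add, map_mul, map_smul, map_one, LinearMap.sub_apply,
      LinearMap.add_apply, LinearMap.smul_apply, Module.End.mul_apply, Module.End.one_apply] at h
    rw [sub_eq_zero, sub_eq_iff_eq_add'] at h
    simp only [opL, h, ← eq_neg_iff_add_eq_zero]
  | zero => simp only [map_zero]; module
  | add a b ha hb => simp only [map_add, ha, hb]; module
  | smul r a ha => simp only [map_smul, ha]; module

theorem LW_apply (m n : ℤ) (v : VacuumModule c) : opL c m (opW c n v) =
    opW c n (opL c m v) + (2 * (m : ℂ) - n) • opW c (m + n) v := by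
  induction v using word_induction with
  | hw l =>
    have h := lsmul_word_eq_zero c (VermaRel.LW m n l)
    simp only [relLW, map_sub, map_mul, map_smul, LinearMap.sub_apply, LinearMap.smul_apply,
      Module.End.mul_apply] at h
    rw [sub_eq_zero, sub_eq_iff_eq_add'] at h
    simp only [opL, opW, h]
  | zero => simp only [map_zero]; module
  | add a b ha hb => simp only [map_add, ha, hb]; module
  | smul r a ha => simp only [map_smul, ha]; module

theorem truncLambda_smul (K m : ℤ) (v : VacuumModule c) :
    Algebra.lsmul ℂ ℂ (VacuumModule c) (truncLambda K m) v = lambdaOf (opL c) K m v := by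
  simp only [lambdaOf, truncLambda, map_sub, map_add, map_mul, map_smul, map_sum,
    LinearMap.sub_apply, LinearMap.add_apply, LinearMap.smul_apply, Module.End.mul_apply,
    LinearMap.sum_apply, opL]

theorem WW_apply (m n K : ℤ) (l : List Gen) (hK : |m + n| + |degree l| ≤ K) :
    opW c m (opW c n (word c l)) = opW c n (opW c m (word c l))
      + (coeffL m n • opL c (m + n) (word c l)
      + (16 / (22 + 5 * c) * ((m : ℂ) - n)) • lambdaOf (opL c) K (m + n) (word c l)
      + (if m + n = 0 then c / 360 * (m : ℂ) * ((m : ℂ) ^ 2 - 1) * ((m : ℂ) ^ 2 - 4) else 0)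
          • word c l) := by
  have h := lsmul_word_eq_zero c (VermaRel.WW m n K l hK)
  simp only [relWW, map_sub, map_add, map_mul, map_smul, map_one, LinearMap.sub_apply,
    LinearMap.add_apply, LinearMap.smul_apply, Module.End.mul_apply, Module.End.one_apply] at h
  rw [sub_eq_zero, sub_eq_iff_eq_add'] at h
  rw [← truncLambda_smul]
  simp only [opL, opW, h, ← eq_neg_iff_add_eq_zero, coeffL]

theorem wordOf_eq_word (l : List Gen) : wordOf (opL c) (opW c) (vac c) l = word c l := by
  induction l with
  | nil => exact (word_nil c).symm
  | cons g l ih =>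
    cases g with
    | L n => rw [word_L, ← ih]; rfl
    | W n => rw [word_W, ← ih]; rfl

/-- The vacuum module as a vacuum representation. -/
noncomputable def vacRep : VacuumRep c (VacuumModule c) where
  L := opL c
  W := opW c
  Ω := vac c
  L_vac _ hn := L_vac c hn
  W_vac _ hn := W_vac c hn
  word_eq_zero l hl := by rw [wordOf_eq_word, word_eq_zero c hl]
  LL := LL_apply c
  LW := LW_apply c
  WW m n K l hK := by rw [wordOf_eq_word]; exact WW_apply c m n K l hK

end VacuumModule

namespace VacuumRep

section Words

variable {c : ℂ} {V : Type*} [AddCommGroup V] [Module ℂ V] (R : VacuumRep c V)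

/-- The vector `x₁ x₂ ⋯ x_k Ω`. -/
def word (l : List Gen) : V := wordOf R.L R.W R.Ω l

/-- The operator of a generator. -/
def act : Gen → Module.End ℂ V
  | .L n => R.L n
  | .W n => R.W n

/-- `V` is generated by `Ω`. -/
def Generated : Prop := ∀ v : V, v ∈ Submodule.span ℂ (Set.range R.word)

theorem word_nil : R.word [] = R.Ω := rfl

theorem word_L (n : ℤ) (l : List Gen) : R.word (Gen.L n :: l) = R.L n (R.word l) := rfl

theorem word_W (n : ℤ) (l : List Gen) : R.word (Gen.W n :: l) = R.W n (R.word l) := rfl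

theorem WW_word (m n K : ℤ) (l : List Gen) (hK : |m + n| + |degree l| ≤ K) :
    R.W m (R.W n (R.word l)) = R.W n (R.W m (R.word l)) + (coeffL m n • R.L (m + n) (R.word l)
      + (16 / (22 + 5 * c) * ((m : ℂ) - n)) • lambdaOf R.L K (m + n) (R.word l)
      + (if m + n = 0 then c / 360 * (m : ℂ) * ((m : ℂ) ^ 2 - 1) * ((m : ℂ) ^ 2 - 4) else 0)
          • R.word l) := R.WW m n K l hK

theorem word_cons (g : Gen) (l : List Gen) : R.word (g :: l) = R.act g (R.word l) := by
  cases g <;> rfl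

variable {R} in
theorem Generated.induction (hR : R.Generated) {P : V → Prop} (hw : ∀ l, P (R.word l))
    (zero : P 0) (add : ∀ a b, P a → P b → P (a + b)) (smul : ∀ (r : ℂ) a, P a → P (r • a))
    (v : V) : P v := by
  have hv := hR v
  induction hv using Submodule.span_induction with
  | mem v hv => obtain ⟨l, rfl⟩ := hv; exact hw l
  | zero => exact zero
  | add a b _ _ ha hb => exact add a b ha hb
  | smul r a _ ha => exact smul r a ha

theorem degree_cons (g : Gen) (l : List Gen) : degree (g :: l) = g.index + degree l := by
  simp [degree]

theorem L0_word (l : List Gen) : R.L 0 (R.word l) = (-(degree l : ℂ)) • R.word l := by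
  induction l with
  | nil =>
    rw [R.word_nil, R.L_vac (n := 0) (by norm_num)]
    simp only [degree, List.map_nil, List.sum_nil]
    module
  | cons g l ih =>
    rw [degree_cons]
    cases g with
    | L n =>
      rw [R.word_L, R.LL, ih, zero_add, map_smul]
      simp only [Gen.index]
      push_cast
      split_ifs <;> module
    | W n =>
      rw [R.word_W, R.LW, ih, zero_add, map_smul]
      simp only [Gen.index]
      push_cast
      module

/-- The vectors of `L₀`-weight `n`. -/
noncomputable def weightSpace (n : ℕ) : Submodule ℂ V :=
  (R.L 0).eigenspace (n : ℂ)

theorem isInternal_weightSpace (hR : R.Generated) : DirectSum.IsInternal R.weightSpace := by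
  rw [DirectSum.isInternal_submodule_iff_iSupIndep_and_iSup_eq_top]
  constructor
  · exact (Module.End.eigenspaces_iSupIndep (R.L 0)).comp
      (f := fun n : ℕ => (n : ℂ)) Nat.cast_injective
  · rw [eq_top_iff]
    rintro v -
    induction v using hR.induction with
    | hw l =>
      rcases lt_or_ge 0 (degree l) with h | h
      · rw [word, R.word_eq_zero l h]; exact zero_mem _
      · refine Submodule.mem_iSup_of_mem (-degree l).toNat ?_
        rw [weightSpace, Module.End.mem_eigenspace_iff, L0_word]
        congr 1
        have : (((-degree l).toNat : ℤ) : ℂ) = ((-degree l : ℤ) : ℂ) := by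
          congr 1; omega
        push_cast at this
        exact this.symm
    | zero => exact zero_mem _
    | add a b ha hb => exact add_mem ha hb
    | smul r a ha => exact Submodule.smul_mem _ r ha

/-! ### Spanning by words in negative modes -/

/-- The filtration degree of a word: `L_n` counts `1` and `W_n` counts `2`. -/
def filtDegree (l : List Gen) : ℕ := (l.map fun g => match g with | .L _ => 1 | .W _ => 2).sum

theorem filtDegree_L (n : ℤ) (l : List Gen) : filtDegree (Gen.L n :: l) = filtDegree l + 1 := by
  simp [filtDegree, add_comm]

theorem filtDegree_W (n : ℤ) (l : List Gen) : filtDegree (Gen.W n :: l) = filtDegree l + 2 := by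
  simp [filtDegree, add_comm]

/-- The generators `L_n`, `n ≤ -2`, and `W_n`, `n ≤ -3`. -/
def IsCreator : Gen → Prop
  | .L n => n ≤ -2
  | .W n => n ≤ -3

/-- The span of the words of filtration degree at most `d`. -/
noncomputable def filt (d : ℕ) : Submodule ℂ V :=
  Submodule.span ℂ (R.word '' {l | filtDegree l ≤ d})

/-- The span of the words in creators of filtration degree at most `d`. -/
noncomputable def negFilt (d : ℕ) : Submodule ℂ V :=
  Submodule.span ℂ (R.word '' {l | filtDegree l ≤ d ∧ ∀ g ∈ l, IsCreator g})

theorem word_mem_filt {l : List Gen} {d : ℕ} (h : filtDegree l ≤ d) : R.word l ∈ R.filt d :=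
  Submodule.subset_span ⟨l, h, rfl⟩

theorem filt_mono {d e : ℕ} (h : d ≤ e) : R.filt d ≤ R.filt e :=
  Submodule.span_mono (Set.image_mono fun _ hl => le_trans hl h)

theorem negFilt_mono {d e : ℕ} (h : d ≤ e) : R.negFilt d ≤ R.negFilt e :=
  Submodule.span_mono (Set.image_mono fun _ hl => ⟨hl.1.trans h, hl.2⟩)

theorem lambdaOf_word_mem_filt (K m : ℤ) (l : List Gen) :
    lambdaOf R.L K m (R.word l) ∈ R.filt (filtDegree l + 2) := by
  rw [lambdaOf]
  have h2 : ∀ p q : ℤ, R.L p (R.L q (R.word l)) ∈ R.filt (filtDegree l + 2) := by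
    intro p q
    rw [← R.word_L, ← R.word_L]
    exact R.word_mem_filt (by simp [filtDegree_L])
  refine Submodule.sub_mem _ (Submodule.add_mem _ (Submodule.sum_mem _ fun _ _ => h2 _ _)
    (Submodule.sum_mem _ fun _ _ => h2 _ _)) (Submodule.smul_mem _ _ ?_)
  rw [← R.word_L]
  exact R.word_mem_filt (by simp [filtDegree_L])

/-- Commuting two generators lowers the filtration degree. -/
theorem word_swap_mem_filt (g y : Gen) (l : List Gen) : ∃ x ∈ R.filt (filtDegree (g :: y :: l) - 1),
    R.word (g :: y :: l) = R.word (y :: g :: l) + x := by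
  have hL : ∀ (n : ℤ) d, filtDegree l + 1 ≤ d → R.L n (R.word l) ∈ R.filt d := by
    intro n d hd; rw [← R.word_L]; exact R.word_mem_filt (by rwa [filtDegree_L])
  have hW : ∀ (n : ℤ) d, filtDegree l + 2 ≤ d → R.W n (R.word l) ∈ R.filt d := by
    intro n d hd; rw [← R.word_W]; exact R.word_mem_filt (by rwa [filtDegree_W])
  have h0 : ∀ d, filtDegree l ≤ d → R.word l ∈ R.filt d := fun d hd => R.word_mem_filt hd
  cases g with
  | L m =>
    cases y with
    | L n =>
      simp only [word_L, filtDegree_L]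
      exact ⟨_, Submodule.add_mem _ (Submodule.smul_mem _ _ (hL _ _ (by omega)))
        (Submodule.smul_mem _ _ (h0 _ (by omega))), R.LL m n _⟩
    | W n =>
      simp only [word_L, word_W, filtDegree_L, filtDegree_W]
      exact ⟨_, Submodule.smul_mem _ _ (hW _ _ (by omega)), R.LW m n _⟩
  | W m =>
    cases y with
    | L n =>
      simp only [word_L, word_W, filtDegree_L, filtDegree_W]
      refine ⟨_, Submodule.smul_mem _ (-(2 * (n : ℂ) - m)) (hW (n + m) _ (by omega)), ?_⟩
      rw [R.LW n m]
      module
    | W n =>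
      simp only [word_W, filtDegree_W, show filtDegree l + 2 + 2 - 1 = filtDegree l + 3 by omega]
      refine ⟨_, Submodule.add_mem _ (Submodule.add_mem _ (Submodule.smul_mem _ _
        (hL _ _ (by omega))) (Submodule.smul_mem _ _
        (R.filt_mono (by omega) (R.lambdaOf_word_mem_filt _ _ l))))
        (Submodule.smul_mem _ _ (h0 _ (by omega))), R.WW_word m n _ l le_rfl⟩

theorem creator_cons_mem {g : Gen} (hg : IsCreator g) {d e : ℕ} (hd : filtDegree [g] + e ≤ d)
    {v : V} (hv : v ∈ R.negFilt e) : R.act g v ∈ R.negFilt d := by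
  induction hv using Submodule.span_induction with
  | mem v hv =>
    obtain ⟨l, hl, rfl⟩ := hv
    refine Submodule.subset_span ⟨g :: l, ⟨?_, ?_⟩, ?_⟩
    · have := hl.1
      simp only [filtDegree, List.map_cons, List.sum_cons, List.map_nil, List.sum_nil] at *
      omega
    · intro y hy
      rcases List.mem_cons.mp hy with rfl | hy
      · exact hg
      · exact hl.2 y hy
    · rw [R.word_cons]
  | zero => simp
  | add a b _ _ ha hb => rw [map_add]; exact Submodule.add_mem _ ha hb
  | smul r a _ ha => rw [map_smul]; exact Submodule.smul_mem _ _ ha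

theorem filtDegree_cons (g : Gen) (l : List Gen) :
    filtDegree (g :: l) = filtDegree [g] + filtDegree l := by
  simp [filtDegree]

theorem filt_le_negFilt (d : ℕ) : R.filt d ≤ R.negFilt d := by
  induction d using Nat.strong_induction_on with
  | _ d ih =>
    refine Submodule.span_le.mpr ?_
    rintro _ ⟨l, hl, rfl⟩
    have pos : ∀ g, 0 < filtDegree [g] := by intro g; cases g <;> simp [filtDegree]
    cases l with
    | nil => exact Submodule.subset_span ⟨[], ⟨by simp [filtDegree], by simp⟩, rfl⟩
    | cons g u =>
      have hl' : filtDegree [g] + filtDegree u ≤ d := by rw [← filtDegree_cons]; exact hl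
      have hpg := pos g
      have hu := ih (filtDegree u) (by omega) (R.word_mem_filt le_rfl)
      have key : ∀ v ∈ R.negFilt (filtDegree u), R.act g v ∈ R.negFilt d := by
        intro v hv
        induction hv using Submodule.span_induction with
        | mem v hv =>
          obtain ⟨u', ⟨hu1, hu2⟩, rfl⟩ := hv
          by_cases hg : IsCreator g
          · refine R.creator_cons_mem hg (e := filtDegree u') (by omega) ?_
            exact Submodule.subset_span ⟨u', ⟨le_rfl, hu2⟩, rfl⟩
          · cases u' with
            | nil =>
              have : R.word [g] = 0 := by
                cases g with
                | L n =>
                  rw [R.word_L, R.word_nil]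
                  exact R.L_vac _ (by simp only [IsCreator] at hg; omega)
                | W n =>
                  rw [R.word_W, R.word_nil]
                  exact R.W_vac _ (by simp only [IsCreator] at hg; omega)
              rw [← R.word_cons, this]; exact zero_mem _
            | cons y w =>
              obtain ⟨x, hx, he⟩ := R.word_swap_mem_filt g y w
              rw [filtDegree_cons] at hu1
              have hpy := pos y
              have e1 := filtDegree_cons g (y :: w)
              have e2 := filtDegree_cons y w
              have e3 := filtDegree_cons g w
              rw [← R.word_cons, he]
              refine Submodule.add_mem _ ?_ ?_
              · rw [R.word_cons]
                exact R.creator_cons_mem (hu2 y (by simp)) (e := filtDegree (g :: w)) (by omega)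
                  (ih _ (by omega) (R.word_mem_filt le_rfl))
              · exact R.negFilt_mono (by omega) (ih _ (by omega) hx)
        | zero => simp
        | add a b _ _ ha hb => rw [map_add]; exact Submodule.add_mem _ ha hb
        | smul r a _ ha => rw [map_smul]; exact Submodule.smul_mem _ _ ha
      rw [SetLike.mem_coe, R.word_cons]
      exact key _ hu

/-- The vacuum module is generated from `|0⟩` by the creators. -/
theorem eq_top_of_creators (hR : R.Generated) {S : Submodule ℂ V} (hv : R.Ω ∈ S)
    (hL : ∀ n : ℤ, n ≤ -2 → ∀ v ∈ S, R.L n v ∈ S)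
    (hW : ∀ n : ℤ, n ≤ -3 → ∀ v ∈ S, R.W n v ∈ S) : S = ⊤ := by
  rw [eq_top_iff]
  rintro v -
  have hS : ∀ l : List Gen, (∀ g ∈ l, IsCreator g) → R.word l ∈ S := by
    intro l
    induction l with
    | nil => intro _; rwa [word_nil]
    | cons g l ih =>
      intro h
      have h1 := ih fun y hy => h y (by simp [hy])
      cases g with
      | L n => rw [R.word_L]; exact hL n (h (.L n) (by simp)) _ h1
      | W n => rw [R.word_W]; exact hW n (h (.W n) (by simp)) _ h1
  induction v using hR.induction with
  | hw l =>
    have := R.filt_le_negFilt _ (R.word_mem_filt (le_refl (filtDegree l)))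
    refine (Submodule.span_le.mpr ?_ : R.negFilt (filtDegree l) ≤ S) this
    rintro _ ⟨l', h, rfl⟩
    exact hS l' h.2
  | zero => exact zero_mem _
  | add a b ha hb => exact add_mem ha hb
  | smul r a ha => exact Submodule.smul_mem _ r ha

/-! ### The vertex algebra structure of the vacuum module -/

/-- The modes of `T(z)`, numbered so that `T(z) = ∑ₙ (modesT n) z^(-n-1)`. -/
noncomputable def modesT (n : ℤ) : Module.End ℂ V := R.L (n - 1)

/-- The modes of `W(z)`, numbered so that `W(z) = ∑ₙ (modesW n) z^(-n-1)`. -/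
noncomputable def modesW (n : ℤ) : Module.End ℂ V := R.W (n - 2)

theorem isField_of_word (hR : R.Generated) {A : ℤ → Module.End ℂ V}
    (h : ∀ l, ∃ N : ℤ, ∀ n : ℤ, N ≤ n → A n (R.word l) = 0) : VertexAlgebra.IsField A := by
  intro v
  induction v using hR.induction with
  | hw l => exact h l
  | zero => exact ⟨0, fun n _ => map_zero _⟩
  | add a b ha hb =>
    obtain ⟨N, hN⟩ := ha
    obtain ⟨M, hM⟩ := hb
    exact ⟨max N M, fun n hn => by
      rw [map_add, hN n (le_trans (le_max_left _ _) hn), hM n (le_trans (le_max_right _ _) hn),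
        add_zero]⟩
  | smul r a ha =>
    obtain ⟨N, hN⟩ := ha
    exact ⟨N, fun n hn => by rw [map_smul, hN n hn, smul_zero]⟩

theorem isField_modesT (hR : R.Generated) : VertexAlgebra.IsField R.modesT := by
  refine R.isField_of_word hR fun l => ⟨2 - degree l, fun n hn => ?_⟩
  rw [modesT, ← R.word_L]
  exact R.word_eq_zero _ (by rw [degree_cons]; simp only [Gen.index]; omega)

theorem isField_modesW (hR : R.Generated) : VertexAlgebra.IsField (R.modesW) := by
  refine R.isField_of_word hR fun l => ⟨3 - degree l, fun n hn => ?_⟩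
  rw [modesW, ← R.word_W]
  exact R.word_eq_zero _ (by rw [degree_cons]; simp only [Gen.index]; omega)

theorem isCovariant_modesT : VertexAlgebra.IsCovariant (R.L (-1)) R.modesT := by
  refine VertexAlgebra.isCovariant_of_apply fun n v => ?_
  rw [modesT, R.LL, modesT, show (-1 + (n - 1)) = n - 1 - 1 by ring]
  push_cast
  split_ifs <;> module

theorem isCovariant_modesW : VertexAlgebra.IsCovariant (R.L (-1)) (R.modesW) := by
  refine VertexAlgebra.isCovariant_of_apply fun n v => ?_
  rw [modesW, R.LW, modesW, show (-1 + (n - 2)) = n - 1 - 2 by ring]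
  push_cast
  module

theorem isCreative_modesT : VertexAlgebra.IsCreative (R.Ω) R.modesT :=
  fun n hn => R.L_vac _ (by omega)

theorem isCreative_modesW : VertexAlgebra.IsCreative (R.Ω) (R.modesW) :=
  fun n hn => R.W_vac _ (by omega)

theorem isLocal_TT : VertexAlgebra.IsLocal R.modesT R.modesT := by
  refine ⟨4, fun m n => ?_⟩
  ext v
  have key : ∀ p q : ℤ, p + q = m + n + 4 → (R.modesT p * R.modesT q - R.modesT q * R.modesT p) v
      = ((p : ℂ) - q) • R.L (m + n + 2) v
        + (if m + n + 2 = 0 then c / 12 * (((p : ℂ) - 1) ^ 3 - (p - 1)) else 0) • v := by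
    intro p q hpq
    simp only [modesT, LinearMap.sub_apply, Module.End.mul_apply]
    rw [R.LL, show p - 1 + (q - 1) = m + n + 2 by omega]
    push_cast
    module
  rw [LinearMap.sum_apply, LinearMap.zero_apply]
  simp only [LinearMap.smul_apply]
  rw [sum_congr rfl fun j _ => by rw [key (m + (4 : ℕ) - j) (n + j) (by push_cast; ring)]]
  simp only [sum_range_succ, range_zero, sum_empty]
  split_ifs
  · simp [Nat.choose]
    module
  · simp [Nat.choose]
    module

theorem isLocal_TW : VertexAlgebra.IsLocal R.modesT (R.modesW) := by
  refine ⟨2, fun m n => ?_⟩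
  ext v
  have key : ∀ p q : ℤ, p + q = m + n + 2 → (R.modesT p * R.modesW q - R.modesW q * R.modesT p) v
      = (2 * ((p : ℂ) - 1) - (q - 2)) • R.W (m + n - 1) v := by
    intro p q hpq
    simp only [modesT, modesW, LinearMap.sub_apply, Module.End.mul_apply]
    rw [R.LW, show p - 1 + (q - 2) = m + n - 1 by omega]
    push_cast
    module
  rw [LinearMap.sum_apply, LinearMap.zero_apply]
  simp only [LinearMap.smul_apply]
  rw [sum_congr rfl fun j _ => by rw [key (m + (2 : ℕ) - j) (n + j) (by push_cast; ring)]]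
  simp only [sum_range_succ, range_zero, sum_empty]
  simp [Nat.choose]
  module

theorem isLocal_WW (hR : R.Generated) : VertexAlgebra.IsLocal (R.modesW) (R.modesW) := by
  refine ⟨6, fun m n => ?_⟩
  refine LinearMap.ext fun v => ?_
  induction v using hR.induction with
  | hw l =>
    have key : ∀ p q : ℤ, p + q = m + n + 6 →
        (R.modesW p * R.modesW q - R.modesW q * R.modesW p) (R.word l)
        = coeffL (p - 2) (q - 2) • R.L (m + n + 2) (R.word l)
          + (16 / (22 + 5 * c) * ((p : ℂ) - q)) •
            lambdaOf R.L (|m + n + 2| + |degree l|) (m + n + 2) (R.word l)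
          + (if m + n + 2 = 0 then c / 360 * ((p : ℂ) - 2) * (((p : ℂ) - 2) ^ 2 - 1)
            * (((p : ℂ) - 2) ^ 2 - 4) else 0) • R.word l := by
      intro p q hpq
      simp only [modesW, LinearMap.sub_apply, Module.End.mul_apply]
      have e : p - 2 + (q - 2) = m + n + 2 := by omega
      rw [R.WW_word _ _ (|m + n + 2| + |degree l|) l (by rw [e]), e]
      push_cast
      module
    rw [LinearMap.sum_apply, LinearMap.zero_apply]
    simp only [LinearMap.smul_apply]
    rw [sum_congr rfl fun j _ => by rw [key (m + (6 : ℕ) - j) (n + j) (by push_cast; ring)]]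
    simp only [sum_range_succ, range_zero, sum_empty, coeffL]
    split_ifs
    · simp [Nat.choose]
      module
    · simp [Nat.choose]
      module
  | zero => simp only [map_zero]
  | add a b ha hb => rw [map_add, map_add, ha, hb]
  | smul r a ha => rw [map_smul, map_smul, ha]

/-- A generated vacuum representation is a vertex algebra. -/
theorem exists_vertexAlgebra (hR : R.Generated) : ∃ 𝒱 : VertexAlgebra V, 𝒱.vac = R.Ω ∧
    𝒱.L0 = R.L 0 ∧ 𝒱.Y (R.L (-2) R.Ω) = R.modesT ∧ 𝒱.Y (R.W (-3) R.Ω) = R.modesW := by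
  let G : Bool → ℤ → Module.End ℂ V := fun b => cond b R.modesT R.modesW
  obtain ⟨𝒱, h1, -, h3, h4⟩ := VertexAlgebra.exists_of_generating G R.Ω (R.L (-1)) (R.L 0)
    (fun b => cond b 2 3) R.weightSpace (R.isInternal_weightSpace hR)
    (fun n a ha => Module.End.mem_eigenspace_iff.mp ha)
    (R.L_vac _ (by norm_num)) (R.L_vac _ (by norm_num))
    (by
      ext v
      simp only [LinearMap.sub_apply, Module.End.mul_apply]
      rw [R.LL]
      norm_num)
    (Bool.forall_bool.mpr ⟨R.isField_modesW hR, R.isField_modesT hR⟩)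
    (Bool.forall_bool.mpr ⟨R.isCovariant_modesW, R.isCovariant_modesT⟩)
    (Bool.forall_bool.mpr ⟨R.isCreative_modesW, R.isCreative_modesT⟩)
    (Bool.forall_bool.mpr ⟨Bool.forall_bool.mpr ⟨R.isLocal_WW hR, R.isLocal_TW.symm⟩,
      Bool.forall_bool.mpr ⟨R.isLocal_TW, R.isLocal_TT⟩⟩)
    (by
      refine Bool.forall_bool.mpr ⟨fun n => ?_, fun n => ?_⟩
      · ext v
        simp only [G, cond_false, modesW, LinearMap.sub_apply, Module.End.mul_apply,
          LinearMap.smul_apply]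
        rw [R.LW, zero_add]
        push_cast
        module
      · ext v
        simp only [G, cond_true, modesT, LinearMap.sub_apply, Module.End.mul_apply,
          LinearMap.smul_apply]
        rw [R.LL, zero_add]
        push_cast
        split_ifs with h
        · have : (n : ℂ) = 1 := by exact_mod_cast (by omega : n = 1)
          rw [this]; module
        · module)
    (by
      intro S hv hS
      refine R.eq_top_of_creators hR hv (fun n hn v h => ?_) fun n hn v h => ?_
      · have := hS true (-2 - n).toNat v h
        simp only [G, cond_true, modesT] at this
        rwa [show -1 - ((-2 - n).toNat : ℤ) - 1 = n by omega] at this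
      · have := hS false (-3 - n).toNat v h
        simp only [G, cond_false, modesW] at this
        rwa [show -1 - ((-3 - n).toNat : ℤ) - 2 = n by omega] at this)
  exact ⟨𝒱, h1, h3, h4 true, h4 false⟩

end Words

section UniversalProperty

variable {c : ℂ} {V : Type*} [AddCommGroup V] [Module ℂ V] (R : VacuumRep c V)

/-- The free algebra acts on `V` through the operators `L_n` and `W_n`. -/
noncomputable def rep : FreeAlg →ₐ[ℂ] Module.End ℂ V := FreeAlgebra.lift ℂ R.act

theorem rep_L (n : ℤ) : R.rep (genL n) = R.L n := FreeAlgebra.lift_ι_apply _ _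

theorem rep_W (n : ℤ) : R.rep (genW n) = R.W n := FreeAlgebra.lift_ι_apply _ _

theorem rep_monomial (l : List Gen) : R.rep (monomial l) R.Ω = R.word l := by
  induction l with
  | nil => simp [monomial, word_nil]
  | cons g l ih =>
    rw [word_cons, ← ih, monomial, List.map_cons, List.prod_cons, map_mul, rep,
      FreeAlgebra.lift_ι_apply]
    rfl

theorem rep_truncLambda (K m : ℤ) (v : V) : R.rep (truncLambda K m) v = lambdaOf R.L K m v := by
  simp only [lambdaOf, truncLambda, map_sub, map_add, map_mul, map_smul, map_sum,
    LinearMap.sub_apply, LinearMap.add_apply, LinearMap.smul_apply, Module.End.mul_apply,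
    LinearMap.sum_apply, rep_L]

theorem rep_apply_eq_zero {x : FreeAlg} (h : VermaRel c 0 0 x) : R.rep x R.Ω = 0 := by
  cases h with
  | L_pos n hn => rw [rep_L, R.L_vac n (by omega)]
  | W_pos n hn => rw [rep_W, R.W_vac n (by omega)]
  | L_zero => simp [rep_L, R.L_vac 0 (by norm_num)]
  | W_zero => simp [rep_W, R.W_vac 0 (by norm_num)]
  | degree_pos l hl => rw [rep_monomial, word, R.word_eq_zero l hl]
  | LL m n l =>
    rw [map_mul, Module.End.mul_apply, rep_monomial]
    simp only [relLL, map_sub, map_add, map_mul, map_smul, map_one, LinearMap.sub_apply,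
      LinearMap.add_apply, LinearMap.smul_apply, Module.End.mul_apply, Module.End.one_apply, rep_L,
      R.LL m n, ← eq_neg_iff_add_eq_zero]
    abel
  | LW m n l =>
    rw [map_mul, Module.End.mul_apply, rep_monomial]
    simp only [relLW, map_sub, map_mul, map_smul, LinearMap.sub_apply,
      LinearMap.smul_apply, Module.End.mul_apply, rep_L, rep_W, R.LW m n]
    abel
  | WW m n K l hK =>
    rw [map_mul, Module.End.mul_apply, rep_monomial]
    simp only [relWW, map_sub, map_add, map_mul, map_smul, map_one, LinearMap.sub_apply,
      LinearMap.add_apply, LinearMap.smul_apply, Module.End.mul_apply, Module.End.one_apply, rep_L,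
      rep_W, rep_truncLambda, R.WW_word m n K l hK, ← eq_neg_iff_add_eq_zero, coeffL]
    abel

/-- The universal property of the vacuum module. -/
theorem exists_hom : ∃ f : VacuumModule c →ₗ[ℂ] V, f (vac c) = R.Ω ∧
    (∀ n v, f (opL c n v) = R.L n (f v)) ∧ (∀ n v, f (opW c n v) = R.W n (f v)) := by
  let _ : Module FreeAlg V := Module.compHom V R.rep.toRingHom
  have hsmul : ∀ (x : FreeAlg) (v : V), x • v = R.rep x v := fun _ _ => rfl
  let f₀ : FreeAlg →ₗ[FreeAlg] V := LinearMap.toSpanSingleton FreeAlg V R.Ω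
  have h₀ : ∀ x, f₀ x = R.rep x R.Ω := fun _ => rfl
  have hI : vermaIdeal c 0 0 ≤ LinearMap.ker f₀ := by
    refine Submodule.span_le.mpr fun x hx => ?_
    rw [SetLike.mem_coe, LinearMap.mem_ker, h₀, R.rep_apply_eq_zero hx]
  let f₁ : Verma c 0 0 →ₗ[FreeAlg] V := (vermaIdeal c 0 0).liftQ f₀ hI
  have h₁ : f₁ (hwVec c 0 0) = R.Ω := by
    rw [hwVec, Submodule.liftQ_apply, h₀, map_one, Module.End.one_apply]
  have hS : vacuumSub c ≤ LinearMap.ker f₁ := by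
    refine Submodule.span_le.mpr ?_
    rintro x (rfl | rfl | rfl)
    · rw [SetLike.mem_coe, LinearMap.mem_ker, map_smul, h₁, hsmul, rep_L, R.L_vac _ (by norm_num)]
    · rw [SetLike.mem_coe, LinearMap.mem_ker, map_smul, h₁, hsmul, rep_W, R.W_vac _ (by norm_num)]
    · rw [SetLike.mem_coe, LinearMap.mem_ker, map_smul, h₁, hsmul, rep_W, R.W_vac _ (by norm_num)]
  let f₂ : VacuumModule c →ₗ[FreeAlg] V := (vacuumSub c).liftQ f₁ hS
  let f : VacuumModule c →ₗ[ℂ] V :=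
    { toFun := f₂
      map_add' := map_add f₂
      map_smul' := by
        intro r v
        rw [← algebraMap_smul FreeAlg r v, map_smul, hsmul, AlgHom.commutes]
        rfl }
  have hf : ∀ (x : FreeAlg) v, f (x • v) = R.rep x (f v) := fun x v => map_smul f₂ x v
  refine ⟨f, ?_, fun n v => ?_, fun n v => ?_⟩
  · change f₂ (vac c) = R.Ω
    rw [vac, Submodule.liftQ_apply, h₁]
  · rw [opL_apply, hf, rep_L]
  · rw [opW_apply, hf, rep_W]

end UniversalProperty

end VacuumRep

theorem vacRep_word (c : ℂ) : (vacRep c).word = word c := funext fun l => wordOf_eq_word c l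

theorem vacRep_generated (c : ℂ) : (vacRep c).Generated := by
  intro v
  rw [vacRep_word]
  exact mem_span_word c v

theorem exists_isVacuumVertexAlgebra (c : ℂ) :
    ∃ 𝒱 : VertexAlgebra (VacuumModule c), IsVacuumVertexAlgebra c 𝒱 := by
  obtain ⟨𝒱, h1, h2, h3, h4⟩ := (vacRep c).exists_vertexAlgebra (vacRep_generated c)
  exact ⟨𝒱, h1, h2, fun n => congrFun h3 n, fun n => congrFun h4 n⟩

end WThree

namespace Heisenberg

/-! ### The vertex algebra of two free bosons -/

/-- The Fock space of two free bosons: the variable `X (i, n)` is the creation operator with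
mode `-n - 1` of the `i`-th boson. -/
abbrev Fock : Type := MvPolynomial (Fin 2 × ℕ) ℂ

open MvPolynomial

/-- The normalization `[α_m, α_{-m}] = m * level i` of the `i`-th boson. -/
noncomputable def level : Fin 2 → ℂ := ![1, 1 / 3]

/-- The modes of the `i`-th boson, with vanishing zero mode. -/
noncomputable def boson (i : Fin 2) : ℤ → Module.End ℂ Fock
  | Int.negSucc k => LinearMap.mulLeft ℂ (X (i, k))
  | Int.ofNat k => (level i * k) • (pderiv (i, k - 1) : Derivation ℂ Fock Fock).toLinearMap

theorem boson_neg (i : Fin 2) (k : ℕ) (p : Fock) : boson i (-1 - k) p = X (i, k) * p := by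
  rw [show (-1 - (k : ℤ)) = Int.negSucc k by omega]
  rfl

theorem boson_natCast (i : Fin 2) (k : ℕ) (p : Fock) :
    boson i k p = (level i * k) • pderiv (i, k - 1) p := rfl

/-- The translation operator. -/
noncomputable def transl : Derivation ℂ Fock Fock :=
  mkDerivation ℂ fun x => ((x.2 : ℂ) + 1) • X (x.1, x.2 + 1)

/-- The degree operator. -/
noncomputable def degOp : Derivation ℂ Fock Fock :=
  mkDerivation ℂ fun x => ((x.2 : ℂ) + 1) • X x

/-- The translation operator as an endomorphism. -/
noncomputable def translOp : Module.End ℂ Fock := (transl : Fock →ₗ[ℂ] Fock)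

theorem translOp_apply (p : Fock) : translOp p = transl p := rfl

/-- The degree operator as an endomorphism. -/
noncomputable def degOpEnd : Module.End ℂ Fock := (degOp : Fock →ₗ[ℂ] Fock)

theorem degOpEnd_apply (p : Fock) : degOpEnd p = degOp p := rfl

theorem boson_zero (i : Fin 2) (p : Fock) : boson i 0 p = 0 := by
  have := boson_natCast i 0 p
  simpa using this

theorem transl_X (x : Fin 2 × ℕ) : transl (X x) = ((x.2 : ℂ) + 1) • X (x.1, x.2 + 1) :=
  mkDerivation_X _ _ _

theorem degOp_X (x : Fin 2 × ℕ) : degOp (X x) = ((x.2 : ℂ) + 1) • X x := mkDerivation_X _ _ _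

theorem int_cases (n : ℤ) : (∃ k : ℕ, n = -1 - k) ∨ ∃ k : ℕ, n = k := by
  rcases lt_or_ge n 0 with h | h
  · exact Or.inl ⟨(-1 - n).toNat, by omega⟩
  · exact Or.inr ⟨n.toNat, by omega⟩

theorem boson_comm (i j : Fin 2) (m n : ℤ) (p : Fock) : boson i m (boson j n p) =
    boson j n (boson i m p) + (if i = j ∧ m + n = 0 then level i * m else 0) • p := by
  have mixed : ∀ (i j : Fin 2) (k l : ℕ) (p : Fock), boson i k (boson j (-1 - l) p) =
      boson j (-1 - l) (boson i k p)
        + (if i = j ∧ (k : ℤ) + (-1 - l) = 0 then level i * k else 0) • p := by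
    intro i j k l p
    rw [boson_natCast, boson_neg, boson_neg, boson_natCast, Derivation.leibniz, pderiv_X,
      smul_add, add_comm, smul_eq_mul, smul_eq_mul, mul_smul_comm]
    rcases k with _ | k
    · simp
    · have : Pi.single (M := fun _ => Fock) (i, k + 1 - 1) (1 : Fock) (j, l)
          = if i = j ∧ ((k + 1 : ℕ) : ℤ) + (-1 - l) = 0 then 1 else 0 := by
        rw [Pi.single_apply]
        congr 1
        rw [eq_iff_iff, Prod.mk.injEq]
        constructor
        · rintro ⟨rfl, rfl⟩; exact ⟨rfl, by push_cast; ring⟩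
        · rintro ⟨rfl, h⟩; exact ⟨rfl, by omega⟩
      rw [this]
      split_ifs
      · simp [add_comm]
      · simp
  rcases int_cases m with ⟨k, rfl⟩ | ⟨k, rfl⟩ <;> rcases int_cases n with ⟨l, rfl⟩ | ⟨l, rfl⟩
  · rw [boson_neg, boson_neg, boson_neg, boson_neg, if_neg (by omega), zero_smul, add_zero]
    ring
  · have := mixed j i l k p
    rw [this]
    by_cases h : i = j ∧ -1 - (k : ℤ) + l = 0
    · obtain ⟨rfl, h⟩ := h
      have hl : (l : ℂ) = k + 1 := by exact_mod_cast (by omega : (l : ℤ) = k + 1)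
      rw [if_pos ⟨rfl, by omega⟩, if_pos ⟨rfl, h⟩, hl, add_assoc, ← add_smul]
      push_cast
      ring_nf
      simp
    · rw [if_neg h, if_neg (by rintro ⟨rfl, h'⟩; exact h ⟨rfl, by omega⟩)]
      simp
  · exact_mod_cast mixed i j k l p
  · simp only [boson_natCast, map_smul]
    have hc : pderiv (R := ℂ) (i, k - 1) (pderiv (j, l - 1) p)
        = pderiv (j, l - 1) (pderiv (i, k - 1) p) := by
      have : ⁅(pderiv (i, k - 1) : Derivation ℂ Fock Fock),
            (pderiv (j, l - 1) : Derivation ℂ Fock Fock)⁆ = 0 := by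
        refine MvPolynomial.derivation_ext fun x => ?_
        rw [Derivation.commutator_apply, pderiv_X, pderiv_X, Pi.single_apply, Pi.single_apply]
        split_ifs <;> simp
      have h2 := congrArg (fun D : Derivation ℂ Fock Fock => D p) this
      rw [Derivation.commutator_apply] at h2
      exact sub_eq_zero.mp h2
    rw [hc, smul_comm]
    have : (if i = j ∧ (k : ℤ) + l = 0 then level i * ((k : ℤ) : ℂ) else 0) = 0 := by
      split_ifs with h
      · rw [show k = 0 by omega]; simp
      · rfl
    rw [this, zero_smul, add_zero]

theorem isCovariant_boson (i : Fin 2) :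
    VertexAlgebra.IsCovariant translOp (boson i) := by
  refine VertexAlgebra.isCovariant_of_apply fun n p => ?_
  simp only [translOp_apply]
  rcases int_cases n with ⟨k, rfl⟩ | ⟨k, rfl⟩
  · rw [show -1 - (k : ℤ) - 1 = -1 - ((k + 1 : ℕ) : ℤ) by push_cast; ring, boson_neg, boson_neg,
      boson_neg, Derivation.leibniz, transl_X, smul_eq_mul, smul_eq_mul, mul_smul_comm, mul_comm p]
    push_cast
    module
  · rcases k with _ | k
    · rw [Nat.cast_zero, boson_zero, boson_zero]; simp
    · have hc : ⁅transl, (pderiv (i, k) : Derivation ℂ Fock Fock)⁆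
          = (-(k : ℂ)) • pderiv (i, k - 1) := by
        refine MvPolynomial.derivation_ext fun x => ?_
        obtain ⟨j, l⟩ := x
        rw [Derivation.commutator_apply, pderiv_X, transl_X, Derivation.smul_apply, pderiv_X,
          Derivation.map_smul, pderiv_X, Pi.single_apply, Pi.single_apply, Pi.single_apply]
        have h0 : transl (if (j, l) = (i, k) then (1 : Fock) else 0) = 0 := by
          split_ifs <;> simp
        rw [h0, zero_sub, neg_smul, ← smul_neg, ← smul_neg]
        rcases k with _ | k
        · simp
        · by_cases h : (j, l) = (i, k)
          · obtain ⟨rfl, rfl⟩ := Prod.mk.injEq .. ▸ h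
            simp
          · rw [if_neg (by simpa using h), if_neg (by simpa using h)]; simp
      have h2 := congrArg (fun D : Derivation ℂ Fock Fock => D p) hc
      simp only [Derivation.commutator_apply, Derivation.smul_apply] at h2
      rw [sub_eq_iff_eq_add] at h2
      rw [show (((k + 1 : ℕ) : ℤ) - 1) = (k : ℤ) by push_cast; ring, boson_natCast, boson_natCast,
        boson_natCast, Derivation.map_smul, Nat.add_sub_cancel, h2]
      push_cast
      module

theorem degOp_boson (i : Fin 2) (n : ℤ) (p : Fock) :
    degOp (boson i n p) = boson i n (degOp p) - (n : ℂ) • boson i n p := by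
  rcases int_cases n with ⟨k, rfl⟩ | ⟨k, rfl⟩
  · rw [boson_neg, boson_neg, Derivation.leibniz, degOp_X, smul_eq_mul, smul_eq_mul, mul_smul_comm,
      mul_comm p]
    push_cast
    module
  · rcases k with _ | k
    · rw [Nat.cast_zero, boson_zero, boson_zero]; simp
    · have hc : ⁅degOp, (pderiv (i, k) : Derivation ℂ Fock Fock)⁆
          = (-((k : ℂ) + 1)) • pderiv (i, k) := by
        refine MvPolynomial.derivation_ext fun x => ?_
        rw [Derivation.commutator_apply, pderiv_X, degOp_X, Derivation.smul_apply, pderiv_X,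
          Derivation.map_smul, pderiv_X, Pi.single_apply]
        split_ifs with h
        · subst h; simp; module
        · simp
      have h2 := congrArg (fun D : Derivation ℂ Fock Fock => D p) hc
      simp only [Derivation.commutator_apply, Derivation.smul_apply] at h2
      rw [sub_eq_iff_eq_add] at h2
      rw [boson_natCast, boson_natCast, Derivation.map_smul, Nat.add_sub_cancel, h2]
      push_cast
      module

theorem isField_boson (i : Fin 2) : VertexAlgebra.IsField (boson i) := by
  intro p
  have : ∃ N : ℕ, ∀ k : ℕ, N ≤ k → pderiv (R := ℂ) (i, k) p = 0 := by
    induction p using MvPolynomial.induction_on with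
    | C a => exact ⟨0, fun k _ => pderiv_C⟩
    | add p q hp hq =>
      obtain ⟨N, hN⟩ := hp
      obtain ⟨M, hM⟩ := hq
      exact ⟨max N M, fun k hk => by
        rw [map_add, hN k (le_trans (le_max_left _ _) hk), hM k (le_trans (le_max_right _ _) hk),
          add_zero]⟩
    | mul_X p x hp =>
      obtain ⟨N, hN⟩ := hp
      refine ⟨max N (x.2 + 1), fun k hk => ?_⟩
      rw [Derivation.leibniz, hN k (le_trans (le_max_left _ _) hk), pderiv_X_of_ne]
      · simp
      · rintro rfl
        have := le_max_right N (k + 1)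
        simp only at hk
        omega
  obtain ⟨N, hN⟩ := this
  refine ⟨N + 1, fun n hn => ?_⟩
  obtain ⟨k, rfl⟩ : ∃ k : ℕ, n = k := ⟨n.toNat, by omega⟩
  rw [boson_natCast, hN (k - 1) (by omega), smul_zero]

theorem isCreative_boson (i : Fin 2) : VertexAlgebra.IsCreative 1 (boson i) := by
  intro n hn
  obtain ⟨k, rfl⟩ : ∃ k : ℕ, n = k := ⟨n.toNat, by omega⟩
  rw [boson_natCast, Derivation.map_one_eq_zero, smul_zero]

theorem isLocal_boson (i j : Fin 2) : VertexAlgebra.IsLocal (boson i) (boson j) := by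
  refine ⟨2, fun m n => LinearMap.ext fun p => ?_⟩
  have key : ∀ k l : ℤ, k + l = m + n + 2 →
      (boson i k * boson j l - boson j l * boson i k) p
        = (if i = j ∧ m + n + 2 = 0 then level i * k else 0) • p := by
    intro k l h
    rw [LinearMap.sub_apply, Module.End.mul_apply, Module.End.mul_apply, boson_comm, h]
    abel
  rw [LinearMap.sum_apply, LinearMap.zero_apply]
  simp only [LinearMap.smul_apply]
  rw [sum_congr rfl fun j _ => by rw [key (m + (2 : ℕ) - j) (n + j) (by push_cast; ring)]]
  simp only [sum_range_succ, range_zero, sum_empty]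
  split_ifs
  · simp [Nat.choose]
    module
  · simp

theorem eq_top_of_mul_X_mem {S : Submodule ℂ Fock} (h1 : (1 : Fock) ∈ S)
    (hX : ∀ x, ∀ p ∈ S, X x * p ∈ S) : S = ⊤ := by
  rw [eq_top_iff]
  rintro p -
  induction p using MvPolynomial.induction_on with
  | C a => rw [← mul_one (C a), ← smul_eq_C_mul]; exact S.smul_mem a h1
  | add p q hp hq => exact S.add_mem hp hq
  | mul_X p x hp => rw [mul_comm]; exact hX x p hp

/-- The polynomials of degree `n`, where `X (i, k)` has degree `k + 1`. -/
noncomputable def degSpace (n : ℕ) : Submodule ℂ Fock :=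
  degOpEnd.eigenspace (n : ℂ)

theorem isInternal_degSpace : DirectSum.IsInternal degSpace := by
  rw [DirectSum.isInternal_submodule_iff_iSupIndep_and_iSup_eq_top]
  constructor
  · exact (Module.End.eigenspaces_iSupIndep
      degOpEnd).comp (f := fun n : ℕ => (n : ℂ))
      Nat.cast_injective
  · refine eq_top_of_mul_X_mem ?_ fun x p hp => ?_
    · refine Submodule.mem_iSup_of_mem 0 ?_
      rw [degSpace, Module.End.mem_eigenspace_iff, degOpEnd_apply]
      simp
    · refine Submodule.iSup_induction degSpace (motive := fun p => X x * p ∈ iSup degSpace) hp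
        ?_ (by simp) (fun p q hp hq => by rw [mul_add]; exact add_mem hp hq)
      intro n p hp
      refine Submodule.mem_iSup_of_mem (n + (x.2 + 1)) ?_
      rw [degSpace, Module.End.mem_eigenspace_iff, degOpEnd_apply] at hp ⊢
      rw [Derivation.leibniz, degOp_X, hp, smul_eq_mul, smul_eq_mul, mul_smul_comm, mul_smul_comm,
        mul_comm p]
      push_cast
      module

theorem exists_vertexAlgebra : ∃ 𝓗 : VertexAlgebra Fock, 𝓗.vac = 1 ∧
    𝓗.T = translOp ∧
    𝓗.L0 = degOpEnd ∧
    ∀ i, 𝓗.Y (X (i, 0)) = boson i := by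
  obtain ⟨𝓗, h1, h2, h3, h4⟩ := VertexAlgebra.exists_of_generating boson (1 : Fock)
    translOp degOpEnd
    (fun _ => 1) degSpace isInternal_degSpace
    (fun n a ha => Module.End.mem_eigenspace_iff.mp ha) (by simp [translOp_apply])
    (by simp [degOpEnd_apply])
    (by
      have hc : ⁅degOp, transl⁆ = transl := by
        refine MvPolynomial.derivation_ext fun x => ?_
        rw [Derivation.commutator_apply, transl_X, degOp_X, Derivation.map_smul,
          Derivation.map_smul, degOp_X, transl_X]
        push_cast
        module
      refine LinearMap.ext fun p => ?_
      exact congrArg (fun D : Derivation ℂ Fock Fock => D p) hc)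
    isField_boson isCovariant_boson isCreative_boson isLocal_boson
    (by
      intro i n
      refine LinearMap.ext fun p => ?_
      simp only [LinearMap.sub_apply, Module.End.mul_apply, degOpEnd_apply, degOp_boson,
        LinearMap.smul_apply]
      module)
    (by
      intro S h1 hS
      refine eq_top_of_mul_X_mem h1 fun x p hp => ?_
      rw [← boson_neg]
      exact hS _ _ p hp)
  refine ⟨𝓗, h1, h2, h3, fun i => ?_⟩
  rw [← h4 i]
  congr 1
  have := boson_neg i 0 1
  rw [Nat.cast_zero, sub_zero, mul_one] at this
  exact this.symm

end Heisenberg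

namespace VertexAlgebra

variable {V : Type*} [AddCommGroup V] [Module ℂ V] (𝒱 : VertexAlgebra V)

theorem Y_vac_apply (n : ℤ) (v : V) : 𝒱.Y 𝒱.vac n v = if n = -1 then v else 0 := by
  rw [𝒱.Y_vac]; split_ifs <;> rfl

theorem T_Y_apply (a : V) (n : ℤ) (v : V) :
    𝒱.T (𝒱.Y a n v) = 𝒱.Y a n (𝒱.T v) - (n : ℂ) • 𝒱.Y a (n - 1) v :=
  (𝒱.isCovariant_Y a).apply n v

theorem vac_mem_grading : 𝒱.vac ∈ 𝒱.grading 0 := by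
  rw [mem_grading_iff, L0_vac]; simp

/-- There are no vectors of negative weight. -/
theorem eq_zero_of_L0_eq {v : V} {z : ℤ} (hz : z < 0) (hv : 𝒱.L0 v = (z : ℂ) • v) : v = 0 := by
  have h1 : 𝒱.decomp v = 0 := by
    refine DFinsupp.ext fun i => ?_
    have := 𝒱.decomp_L0 v i
    rw [hv, map_smul, DirectSum.smul_apply, Submodule.coe_smul, ← sub_eq_zero, ← sub_smul,
      smul_eq_zero] at this
    rcases this with h2 | h2
    · have : z = i := by exact_mod_cast sub_eq_zero.mp h2
      omega
    · exact Subtype.ext h2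
  simpa using h1

theorem Y_eq_zero_of_L0 {p : ℕ} {a v : V} {z : ℤ} (ha : a ∈ 𝒱.grading p)
    (hv : 𝒱.L0 v = (z : ℂ) • v) {n : ℤ} (hn : p + z ≤ n) : 𝒱.Y a n v = 0 := by
  refine 𝒱.eq_zero_of_L0_eq (z := p + z - n - 1) (by omega) ?_
  rw [L0_Y_apply, hv, 𝒱.L0_apply p a ha]
  simp only [map_smul, Pi.smul_apply, LinearMap.smul_apply]
  push_cast
  module

theorem Y_eq_zero {p q : ℕ} {a b : V} (ha : a ∈ 𝒱.grading p) (hb : b ∈ 𝒱.grading q) {n : ℤ}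
    (hn : p + q ≤ n) : 𝒱.Y a n b = 0 :=
  𝒱.Y_eq_zero_of_L0 ha (z := q) (by exact_mod_cast 𝒱.L0_apply q b hb) hn

/-- The commutator formula for states with `a_(j) b = 0` for `j ≥ 6`. -/
theorem commutator_apply (a b : V) (h : ∀ j : ℕ, 6 ≤ j → 𝒱.Y a j b = 0) (m n : ℤ) (v : V) :
    𝒱.Y a m (𝒱.Y b n v) = 𝒱.Y b n (𝒱.Y a m v) + (𝒱.Y (𝒱.Y a 0 b) (m + n) v
      + (m : ℂ) • 𝒱.Y (𝒱.Y a 1 b) (m + n - 1) v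
      + ((m : ℂ) * (m - 1) / 2) • 𝒱.Y (𝒱.Y a 2 b) (m + n - 2) v
      + ((m : ℂ) * (m - 1) * (m - 2) / 6) • 𝒱.Y (𝒱.Y a 3 b) (m + n - 3) v
      + ((m : ℂ) * (m - 1) * (m - 2) * (m - 3) / 24) • 𝒱.Y (𝒱.Y a 4 b) (m + n - 4) v
      + ((m : ℂ) * (m - 1) * (m - 2) * (m - 3) * (m - 4) / 120) •
        𝒱.Y (𝒱.Y a 5 b) (m + n - 5) v) := by
  have h1 := LinearMap.congr_fun (𝒱.commutator a b h m n) v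
  rw [LinearMap.sub_apply, sub_eq_iff_eq_add'] at h1
  rw [← Module.End.mul_apply, h1]
  simp only [LinearMap.add_apply, LinearMap.smul_apply, sum_range_succ,
    range_zero, sum_empty, binom, Module.End.mul_apply, Nat.cast_zero, Nat.cast_one,
    Nat.cast_ofNat, sub_zero, zero_add]
  module

end VertexAlgebra

/-! ### Two free bosons: the Virasoro field with central charge `0` -/

namespace FreeField

open VertexAlgebra

variable {V : Type*} [AddCommGroup V] [Module ℂ V] {𝒱 : VertexAlgebra V}

/-- The state `S = (3/2) b_(-1) b + (1/2) b_(-2) |0⟩`. For a boson `b` of level `1/3`, the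
background charge `1/2` is the one for which the central charge of `S` vanishes. -/
noncomputable def vir (𝒱 : VertexAlgebra V) (b : V) : V :=
  (3 / 2 : ℂ) • 𝒱.Y b (-1) (𝒱.Y b (-1) 𝒱.vac) + (1 / 2 : ℂ) • 𝒱.Y b (-2) 𝒱.vac

section Vir

-- `b` is a free boson of level `1 / 3`
variable {b : V} (hb : b ∈ 𝒱.grading 1)
  (hbb : ∀ m n v, 𝒱.Y b m (𝒱.Y b n v) = 𝒱.Y b n (𝒱.Y b m v)
    + (if m + n = 0 then 1 / 3 * (m : ℂ) else 0) • v)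

include hb in
theorem vir_mem_grading : vir 𝒱 b ∈ 𝒱.grading 2 := by
  refine Submodule.add_mem _ (Submodule.smul_mem _ _ ?_) (Submodule.smul_mem _ _ ?_)
  · exact 𝒱.Y_mem_grading hb (𝒱.Y_mem_grading hb 𝒱.vac_mem_grading (r := 1) (by norm_num))
      (by norm_num)
  · exact 𝒱.Y_mem_grading hb 𝒱.vac_mem_grading (by norm_num)

include hbb in
theorem boson_vir (m n : ℤ) (v : V) : 𝒱.Y b m (𝒱.Y (vir 𝒱 b) n v) = 𝒱.Y (vir 𝒱 b) n (𝒱.Y b m v)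
    + ((m : ℂ) • 𝒱.Y b (m + n - 1) v
      + (if m + n = 1 then (m : ℂ) * (m - 1) / 6 else 0) • v) := by
  have hv : ∀ j : ℤ, 0 ≤ j → 𝒱.Y b j 𝒱.vac = 0 := 𝒱.Y_apply_vac_of_nonneg b
  have e : ∀ j : ℤ, 0 ≤ j → 𝒱.Y b j (vir 𝒱 b) = (if j = 1 then b else 0)
      + (if j = 2 then (1 / 3 : ℂ) • 𝒱.vac else 0) := by
    intro j hj
    simp only [vir, map_add, map_smul]
    simp only [hbb j (-1), hbb j (-2), hv j hj, map_zero, zero_add, map_smul]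
    by_cases h1 : j = 1
    · subst h1
      norm_num [𝒱.Y_apply_vac]
      module
    · by_cases h2 : j = 2
      · subst h2
        norm_num
        module
      · simp [h1, h2, show j + -1 ≠ 0 by omega, show j + -2 ≠ 0 by omega]
  rw [𝒱.commutator_apply b (vir 𝒱 b)
    (fun j hj => by
      rw [e _ (by omega)]; simp [show (j : ℤ) ≠ 1 by omega, show (j : ℤ) ≠ 2 by omega])]
  rw [e 0 (by norm_num), e 1 (by norm_num), e 2 (by norm_num), e 3 (by norm_num),
    e 4 (by norm_num), e 5 (by norm_num)]
  norm_num [𝒱.Y_vac_apply]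
  by_cases h : m + n = 1
  · simp [h]
    module
  · simp [h, show m + n - 2 ≠ -1 by omega]

include hbb in
theorem vir_boson (m n : ℤ) (v : V) : 𝒱.Y (vir 𝒱 b) n (𝒱.Y b m v) = 𝒱.Y b m (𝒱.Y (vir 𝒱 b) n v)
    - (m : ℂ) • 𝒱.Y b (m + n - 1) v
      - (if m + n = 1 then (m : ℂ) * (m - 1) / 6 else 0) • v := by
  rw [boson_vir hbb]; module

include hb hbb in
/-- The field of `vir 𝒱 b` is a Virasoro field with central charge `0`. -/
theorem vir_vir (m n : ℤ) (v : V) : 𝒱.Y (vir 𝒱 b) m (𝒱.Y (vir 𝒱 b) n v) =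
    𝒱.Y (vir 𝒱 b) n (𝒱.Y (vir 𝒱 b) m v) + ((m : ℂ) - n) • 𝒱.Y (vir 𝒱 b) (m + n - 1) v := by
  have hv : ∀ j : ℤ, 0 ≤ j → 𝒱.Y b j 𝒱.vac = 0 := 𝒱.Y_apply_vac_of_nonneg b
  have hv' : ∀ j : ℤ, 0 ≤ j → 𝒱.Y (vir 𝒱 b) j 𝒱.vac = 0 := 𝒱.Y_apply_vac_of_nonneg _
  have hc : 𝒱.Y b (-2) (𝒱.Y b (-1) 𝒱.vac) = 𝒱.Y b (-1) (𝒱.Y b (-2) 𝒱.vac) := by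
    rw [hbb]; norm_num
  have hS : ∀ f : Module.End ℂ V, f (vir 𝒱 b) = (3 / 2 : ℂ) • f (𝒱.Y b (-1) (𝒱.Y b (-1) 𝒱.vac))
      + (1 / 2 : ℂ) • f (𝒱.Y b (-2) 𝒱.vac) := fun f => by
    rw [← f.map_smul, ← f.map_smul, ← f.map_add]; rfl
  have e0 : 𝒱.Y (vir 𝒱 b) 0 (vir 𝒱 b) = 𝒱.T (vir 𝒱 b) := by
    rw [hS, hS]
    norm_num [vir_boson hbb, 𝒱.T_Y_apply, hv', 𝒱.T_vac, hc]
  have e1 : 𝒱.Y (vir 𝒱 b) 1 (vir 𝒱 b) = (2 : ℂ) • vir 𝒱 b := by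
    rw [hS]
    conv_rhs => rw [vir]
    norm_num [vir_boson hbb, hv']
    module
  have e2 : 𝒱.Y (vir 𝒱 b) 2 (vir 𝒱 b) = 0 := by
    rw [hS]
    norm_num [vir_boson hbb, hv', hv, hbb 0 (-1)]
    module
  have e3 : 𝒱.Y (vir 𝒱 b) 3 (vir 𝒱 b) = 0 := by
    rw [hS]
    norm_num [vir_boson hbb, hv', hv, hbb 1 (-1)]
    module
  have e4 : ∀ j : ℤ, 4 ≤ j → 𝒱.Y (vir 𝒱 b) j (vir 𝒱 b) = 0 := fun j hj =>
    𝒱.Y_eq_zero (vir_mem_grading hb) (vir_mem_grading hb) (by push_cast; omega)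
  rw [𝒱.commutator_apply _ _ (fun j hj => e4 j (by omega)), e0, e1, e2, e3, e4 4 (by norm_num),
    e4 5 (by norm_num), 𝒱.Y_T_apply]
  simp only [map_smul, map_zero, Pi.smul_apply, Pi.zero_apply, LinearMap.smul_apply,
    LinearMap.zero_apply]
  push_cast
  module

end Vir

end FreeField

/-! ### The `W₃` algebra at `c = -2` inside the free field vertex algebra -/

namespace VertexAlgebra

variable {V : Type*} [AddCommGroup V] [Module ℂ V] (𝒱 : VertexAlgebra V)

theorem Y_neg_two_vac (a : V) : 𝒱.Y a (-2) 𝒱.vac = 𝒱.T a := (𝒱.T_apply a).symm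

theorem Y_neg_three_vac (a : V) : 𝒱.Y a (-3) 𝒱.vac = (1 / 2 : ℂ) • 𝒱.T (𝒱.T a) := by
  rw [𝒱.T_apply (𝒱.T a), Y_T_apply]; norm_num [smul_smul]

theorem Y_neg_four_vac (a : V) : 𝒱.Y a (-4) 𝒱.vac = (1 / 6 : ℂ) • 𝒱.T (𝒱.T (𝒱.T a)) := by
  rw [𝒱.T_apply (𝒱.T (𝒱.T a)), Y_T_apply, Y_T_apply]; norm_num [smul_smul]

end VertexAlgebra

namespace FreeField

open VertexAlgebra

variable {V : Type*} [AddCommGroup V] [Module ℂ V] {𝒱 : VertexAlgebra V}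

/-- The conformal vector `ω = S + (1/2) a_(-1) a_(-1) |0⟩ + (1/2) a_(-2) |0⟩`, of central charge
`-2` when `a` is a boson of level `1` and `S` has central charge `0`. -/
noncomputable def conf (𝒱 : VertexAlgebra V) (a S : V) : V :=
  S + (1 / 2 : ℂ) • 𝒱.Y a (-1) (𝒱.Y a (-1) 𝒱.vac) + (1 / 2 : ℂ) • 𝒱.Y a (-2) 𝒱.vac

/-- The state of weight `3` whose field is the free field realization of
`W̃(z) = (√6/2) W(z)`. -/
noncomputable def cub (𝒱 : VertexAlgebra V) (a S : V) : V :=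
  (1 / 3 : ℂ) • 𝒱.Y a (-1) (𝒱.Y a (-1) (𝒱.Y a (-1) 𝒱.vac))
    + (1 / 2 : ℂ) • 𝒱.Y a (-1) (𝒱.Y a (-2) 𝒱.vac) + (1 / 6 : ℂ) • 𝒱.Y a (-3) 𝒱.vac
    - (2 : ℂ) • 𝒱.Y a (-1) S - (1 / 2 : ℂ) • 𝒱.Y S (-2) 𝒱.vac

/-- The state `a_(1) W̃`. -/
noncomputable def quad (𝒱 : VertexAlgebra V) (a S : V) : V :=
  𝒱.Y a (-1) (𝒱.Y a (-1) 𝒱.vac) + (1 / 2 : ℂ) • 𝒱.Y a (-2) 𝒱.vac - (2 : ℂ) • S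

/-- A free boson `a` of level `1` and a commuting Virasoro vector `S` of central charge `0`. -/
structure IsBosonVir (𝒱 : VertexAlgebra V) (a S : V) : Prop where
  ha : a ∈ 𝒱.grading 1
  hS : S ∈ 𝒱.grading 2
  haa : ∀ m n v, 𝒱.Y a m (𝒱.Y a n v) = 𝒱.Y a n (𝒱.Y a m v)
    + (if m + n = 0 then (m : ℂ) else 0) • v
  haS : ∀ m n v, 𝒱.Y a m (𝒱.Y S n v) = 𝒱.Y S n (𝒱.Y a m v)
  hSS : ∀ m n v, 𝒱.Y S m (𝒱.Y S n v) = 𝒱.Y S n (𝒱.Y S m v)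
    + ((m : ℂ) - n) • 𝒱.Y S (m + n - 1) v

namespace IsBosonVir

variable {a S : V} (h : IsBosonVir 𝒱 a S)
include h

omit h in
theorem conf_map (f : Module.End ℂ V) : f (conf 𝒱 a S) = f (𝒱.Y S (-1) 𝒱.vac)
    + (1 / 2 : ℂ) • f (𝒱.Y a (-1) (𝒱.Y a (-1) 𝒱.vac)) + (1 / 2 : ℂ) • f (𝒱.Y a (-2) 𝒱.vac) := by
  rw [𝒱.Y_apply_vac, conf, map_add, map_add, map_smul, map_smul]

omit h in
theorem quad_map (f : Module.End ℂ V) : f (quad 𝒱 a S) =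
    f (𝒱.Y a (-1) (𝒱.Y a (-1) 𝒱.vac)) + (1 / 2 : ℂ) • f (𝒱.Y a (-2) 𝒱.vac)
      - (2 : ℂ) • f (𝒱.Y S (-1) 𝒱.vac) := by
  rw [𝒱.Y_apply_vac S, quad, map_sub, map_add, map_smul, map_smul]

omit h in
theorem cub_map (f : Module.End ℂ V) : f (cub 𝒱 a S) =
    (1 / 3 : ℂ) • f (𝒱.Y a (-1) (𝒱.Y a (-1) (𝒱.Y a (-1) 𝒱.vac)))
    + (1 / 2 : ℂ) • f (𝒱.Y a (-1) (𝒱.Y a (-2) 𝒱.vac)) + (1 / 6 : ℂ) • f (𝒱.Y a (-3) 𝒱.vac)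
    - (2 : ℂ) • f (𝒱.Y a (-1) (𝒱.Y S (-1) 𝒱.vac)) - (1 / 2 : ℂ) • f (𝒱.Y S (-2) 𝒱.vac) := by
  rw [𝒱.Y_apply_vac S, cub]; simp only [map_sub, map_add, map_smul]

theorem a_a {m n : ℤ} (_ : 0 ≤ m) (_ : n < 0) (v : V) : 𝒱.Y a m (𝒱.Y a n v) =
    𝒱.Y a n (𝒱.Y a m v) + (if m + n = 0 then (m : ℂ) else 0) • v := h.haa m n v

theorem a_a_neg {m n : ℤ} (hm : m < n) (hn : n < 0) (v : V) :
    𝒱.Y a m (𝒱.Y a n v) = 𝒱.Y a n (𝒱.Y a m v) := by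
  rw [h.haa, if_neg (by omega), zero_smul, add_zero]

theorem S_a (m n : ℤ) (v : V) : 𝒱.Y S m (𝒱.Y a n v) = 𝒱.Y a n (𝒱.Y S m v) := (h.haS n m v).symm

theorem S_S {m n : ℤ} (_ : 0 ≤ m) (_ : n < 0) (v : V) : 𝒱.Y S m (𝒱.Y S n v) =
    𝒱.Y S n (𝒱.Y S m v) + ((m : ℂ) - n) • 𝒱.Y S (m + n - 1) v := h.hSS m n v

theorem conf_mem : conf 𝒱 a S ∈ 𝒱.grading 2 := by
  have h1 : 𝒱.Y a (-1) 𝒱.vac ∈ 𝒱.grading 1 := by rw [𝒱.Y_apply_vac]; exact h.ha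
  refine Submodule.add_mem _ (Submodule.add_mem _ h.hS (Submodule.smul_mem _ _ ?_))
    (Submodule.smul_mem _ _ ?_)
  · exact 𝒱.Y_mem_grading h.ha h1 (by norm_num)
  · exact 𝒱.Y_mem_grading h.ha 𝒱.vac_mem_grading (by norm_num)

theorem cub_mem : cub 𝒱 a S ∈ 𝒱.grading 3 := by
  have h1 : 𝒱.Y a (-1) 𝒱.vac ∈ 𝒱.grading 1 := by rw [𝒱.Y_apply_vac]; exact h.ha
  have h2 : 𝒱.Y a (-2) 𝒱.vac ∈ 𝒱.grading 2 :=
    𝒱.Y_mem_grading h.ha 𝒱.vac_mem_grading (by norm_num)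
  have h3 : 𝒱.Y a (-1) (𝒱.Y a (-1) 𝒱.vac) ∈ 𝒱.grading 2 := 𝒱.Y_mem_grading h.ha h1 (by norm_num)
  refine Submodule.sub_mem _ (Submodule.sub_mem _ (Submodule.add_mem _ (Submodule.add_mem _
    (Submodule.smul_mem _ _ ?_) (Submodule.smul_mem _ _ ?_)) (Submodule.smul_mem _ _ ?_))
    (Submodule.smul_mem _ _ ?_)) (Submodule.smul_mem _ _ ?_)
  · exact 𝒱.Y_mem_grading h.ha h3 (by norm_num)
  · exact 𝒱.Y_mem_grading h.ha h2 (by norm_num)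
  · exact 𝒱.Y_mem_grading h.ha 𝒱.vac_mem_grading (by norm_num)
  · exact 𝒱.Y_mem_grading h.ha h.hS (by norm_num)
  · exact 𝒱.Y_mem_grading h.hS 𝒱.vac_mem_grading (by norm_num)

theorem conf_a (m n : ℤ) (v : V) : 𝒱.Y (conf 𝒱 a S) n (𝒱.Y a m v) =
    𝒱.Y a m (𝒱.Y (conf 𝒱 a S) n v) - (m : ℂ) • 𝒱.Y a (m + n - 1) v
      - (if m + n = 1 then (m : ℂ) * (m - 1) / 2 else 0) • v := by
  have hv := fun (x : V) (j : ℤ) (hj : 0 ≤ j) => 𝒱.Y_apply_vac_of_nonneg x j hj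
  have e0 : 𝒱.Y a 0 (conf 𝒱 a S) = 0 := by rw [conf_map]; norm_num [h.haS, h.a_a, hv]
  have e1 : 𝒱.Y a 1 (conf 𝒱 a S) = a := by
    conv_rhs => rw [← 𝒱.Y_apply_vac a]
    rw [conf_map]; norm_num [h.haS, h.a_a, hv]; module
  have e2 : 𝒱.Y a 2 (conf 𝒱 a S) = 𝒱.vac := by
    rw [conf_map]; norm_num [h.haS, h.a_a, hv, smul_smul]
  have e3 : ∀ j : ℤ, 3 ≤ j → 𝒱.Y a j (conf 𝒱 a S) = 0 := fun j hj =>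
    𝒱.Y_eq_zero h.ha h.conf_mem (by push_cast; omega)
  rw [𝒱.commutator_apply a _ (fun j hj => e3 j (by omega)), e0, e1, e2, e3 3 (by norm_num),
    e3 4 (by norm_num), e3 5 (by norm_num)]
  norm_num [𝒱.Y_vac_apply]
  by_cases h : m + n = 1
  · simp [h]; module
  · simp [h, show m + n - 2 ≠ -1 by omega]

theorem conf_S (m n : ℤ) (v : V) : 𝒱.Y (conf 𝒱 a S) m (𝒱.Y S n v) =
    𝒱.Y S n (𝒱.Y (conf 𝒱 a S) m v) + ((m : ℂ) - n) • 𝒱.Y S (m + n - 1) v := by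
  have hv := fun (x : V) (j : ℤ) (hj : 0 ≤ j) => 𝒱.Y_apply_vac_of_nonneg x j hj
  have e0 : 𝒱.Y S 0 (conf 𝒱 a S) = 𝒱.T S := by
    rw [← 𝒱.Y_neg_two_vac S, conf_map]; norm_num [h.S_a, h.S_S, hv]
  have e1 : 𝒱.Y S 1 (conf 𝒱 a S) = (2 : ℂ) • S := by
    conv_rhs => rw [← 𝒱.Y_apply_vac S]
    rw [conf_map]; norm_num [h.S_a, h.S_S, hv]
  have e2 : ∀ j : ℤ, 2 ≤ j → 𝒱.Y S j (conf 𝒱 a S) = 0 := fun j hj => by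
    rw [conf_map]; norm_num [h.S_a, h.S_S (show 0 ≤ j by omega), hv, show 0 ≤ j by omega,
      hv S (j + -1 - 1) (by omega)]
  rw [← sub_eq_iff_eq_add', ← neg_sub, 𝒱.commutator_apply S _ (fun j hj => e2 j (by omega)), e0, e1,
    e2 2 (by norm_num), e2 3 (by norm_num), e2 4 (by norm_num), e2 5 (by norm_num), 𝒱.Y_T_apply]
  norm_num [add_comm n m]
  module

/-- `ω(z)` is a Virasoro field with central charge `-2`. -/
theorem conf_conf (m n : ℤ) (v : V) : 𝒱.Y (conf 𝒱 a S) m (𝒱.Y (conf 𝒱 a S) n v) =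
    𝒱.Y (conf 𝒱 a S) n (𝒱.Y (conf 𝒱 a S) m v) + (((m : ℂ) - n) • 𝒱.Y (conf 𝒱 a S) (m + n - 1) v
      - (if m + n = 2 then (m : ℂ) * (m - 1) * (m - 2) / 6 else 0) • v) := by
  have hv := fun (x : V) (j : ℤ) (hj : 0 ≤ j) => 𝒱.Y_apply_vac_of_nonneg x j hj
  have e0 : 𝒱.Y (conf 𝒱 a S) 0 (conf 𝒱 a S) = 𝒱.T (conf 𝒱 a S) := by
    rw [conf_map, conf_map]
    norm_num [h.conf_a, h.conf_S, hv, 𝒱.T_Y_apply, 𝒱.T_vac]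
  have e1 : 𝒱.Y (conf 𝒱 a S) 1 (conf 𝒱 a S) = (2 : ℂ) • conf 𝒱 a S := by
    rw [conf_map]
    conv_rhs => rw [conf, ← 𝒱.Y_apply_vac S]
    norm_num [h.conf_a, h.conf_S, hv]
    module
  have e2 : 𝒱.Y (conf 𝒱 a S) 2 (conf 𝒱 a S) = 0 := by
    rw [conf_map]
    norm_num [h.conf_a, h.conf_S, hv, h.a_a]
    module
  have e3 : 𝒱.Y (conf 𝒱 a S) 3 (conf 𝒱 a S) = (-1 : ℂ) • 𝒱.vac := by
    rw [conf_map]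
    norm_num [h.conf_a, h.conf_S, hv, h.a_a]
    module
  have e4 : ∀ j : ℤ, 4 ≤ j → 𝒱.Y (conf 𝒱 a S) j (conf 𝒱 a S) = 0 := fun j hj =>
    𝒱.Y_eq_zero h.conf_mem h.conf_mem (by push_cast; omega)
  rw [𝒱.commutator_apply _ _ (fun j hj => e4 j (by omega)), e0, e1, e2, e3, e4 4 (by norm_num),
    e4 5 (by norm_num), 𝒱.Y_T_apply]
  norm_num [𝒱.Y_vac_apply]
  by_cases h : m + n = 2
  · simp [h]; module
  · simp [h, show m + n - 3 ≠ -1 by omega]; module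

theorem quad_a (m n : ℤ) (v : V) : 𝒱.Y (quad 𝒱 a S) n (𝒱.Y a m v) =
    𝒱.Y a m (𝒱.Y (quad 𝒱 a S) n v) - (2 * m : ℂ) • 𝒱.Y a (m + n - 1) v
      - (if m + n = 1 then (m : ℂ) * (m - 1) / 2 else 0) • v := by
  have hv := fun (x : V) (j : ℤ) (hj : 0 ≤ j) => 𝒱.Y_apply_vac_of_nonneg x j hj
  have e0 : 𝒱.Y a 0 (quad 𝒱 a S) = 0 := by rw [quad_map]; norm_num [h.haS, h.a_a, hv]
  have e1 : 𝒱.Y a 1 (quad 𝒱 a S) = (2 : ℂ) • a := by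
    conv_rhs => rw [← 𝒱.Y_apply_vac a]
    rw [quad_map]; norm_num [h.haS, h.a_a, hv]; module
  have e2 : 𝒱.Y a 2 (quad 𝒱 a S) = 𝒱.vac := by
    rw [quad_map]; norm_num [h.haS, h.a_a, hv, smul_smul]
  have e3 : ∀ j : ℤ, 3 ≤ j → 𝒱.Y a j (quad 𝒱 a S) = 0 := fun j hj => by
    rw [quad_map]
    norm_num [h.haS, h.a_a (show 0 ≤ j by omega), hv, show 0 ≤ j by omega,
      show j + -1 ≠ 0 by omega, show j + -2 ≠ 0 by omega]
  rw [𝒱.commutator_apply a _ (fun j hj => e3 j (by omega)), e0, e1, e2, e3 3 (by norm_num),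
    e3 4 (by norm_num), e3 5 (by norm_num)]
  norm_num [𝒱.Y_vac_apply]
  by_cases h : m + n = 1
  · simp [h]; module
  · simp [h, show m + n - 2 ≠ -1 by omega]; module

theorem quad_S (m n : ℤ) (v : V) : 𝒱.Y (quad 𝒱 a S) m (𝒱.Y S n v) =
    𝒱.Y S n (𝒱.Y (quad 𝒱 a S) m v) - (2 * ((m : ℂ) - n)) • 𝒱.Y S (m + n - 1) v := by
  have hv := fun (x : V) (j : ℤ) (hj : 0 ≤ j) => 𝒱.Y_apply_vac_of_nonneg x j hj
  have e0 : 𝒱.Y S 0 (quad 𝒱 a S) = (-2 : ℂ) • 𝒱.T S := by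
    rw [← 𝒱.Y_neg_two_vac S, quad_map]; norm_num [h.S_a, h.S_S, hv]
  have e1 : 𝒱.Y S 1 (quad 𝒱 a S) = (-4 : ℂ) • S := by
    conv_rhs => rw [← 𝒱.Y_apply_vac S]
    rw [quad_map]; norm_num [h.S_a, h.S_S, hv, smul_smul]
  have e2 : ∀ j : ℤ, 2 ≤ j → 𝒱.Y S j (quad 𝒱 a S) = 0 := fun j hj => by
    rw [quad_map]; norm_num [h.S_a, h.S_S (show 0 ≤ j by omega), hv, show 0 ≤ j by omega,
      hv S (j + -1 - 1) (by omega)]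
  rw [𝒱.commutator_apply S (quad 𝒱 a S) (fun j hj => e2 j (by omega)) n m, e0, e1,
    e2 2 (by norm_num), e2 3 (by norm_num), e2 4 (by norm_num), e2 5 (by norm_num), map_smul,
    map_smul, Pi.smul_apply, Pi.smul_apply, 𝒱.Y_T_apply]
  norm_num [add_comm n m]
  module

theorem cub_a (m n : ℤ) (v : V) : 𝒱.Y (cub 𝒱 a S) n (𝒱.Y a m v) =
    𝒱.Y a m (𝒱.Y (cub 𝒱 a S) n v) - (m : ℂ) • 𝒱.Y (quad 𝒱 a S) (m + n - 1) v
      - ((m : ℂ) * (m - 1) / 2) • 𝒱.Y a (m + n - 2) v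
      - (if m + n = 2 then (m : ℂ) * (m - 1) * (m - 2) / 12 else 0) • v := by
  have hv := fun (x : V) (j : ℤ) (hj : 0 ≤ j) => 𝒱.Y_apply_vac_of_nonneg x j hj
  have e0 : 𝒱.Y a 0 (cub 𝒱 a S) = 0 := by rw [cub_map]; norm_num [h.haS, h.a_a, hv]
  have e1 : 𝒱.Y a 1 (cub 𝒱 a S) = quad 𝒱 a S := by
    conv_rhs => rw [quad, ← 𝒱.Y_apply_vac S]
    rw [cub_map]; norm_num [h.haS, h.a_a, hv]; module
  have e2 : 𝒱.Y a 2 (cub 𝒱 a S) = a := by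
    conv_rhs => rw [← 𝒱.Y_apply_vac a]
    rw [cub_map]; norm_num [h.haS, h.a_a, hv, smul_smul]
  have e3 : 𝒱.Y a 3 (cub 𝒱 a S) = (1 / 2 : ℂ) • 𝒱.vac := by
    rw [cub_map]; norm_num [h.haS, h.a_a, hv]; module
  have e4 : ∀ j : ℤ, 4 ≤ j → 𝒱.Y a j (cub 𝒱 a S) = 0 := fun j hj =>
    𝒱.Y_eq_zero h.ha h.cub_mem (by push_cast; omega)
  rw [𝒱.commutator_apply a _ (fun j hj => e4 j (by omega)), e0, e1, e2, e3,
    e4 4 (by norm_num), e4 5 (by norm_num)]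
  norm_num [𝒱.Y_vac_apply]
  by_cases h : m + n = 2
  · simp [h]; module
  · simp [h, show m + n - 3 ≠ -1 by omega]; module

end IsBosonVir

end FreeField

namespace FreeField

open VertexAlgebra

variable {V : Type*} [AddCommGroup V] [Module ℂ V] {𝒱 : VertexAlgebra V}

/-- The state `S_(0) W̃`. -/
noncomputable def cubS₀ (𝒱 : VertexAlgebra V) (a S : V) : V :=
  (-2 : ℂ) • 𝒱.Y a (-1) (𝒱.Y S (-2) 𝒱.vac) - 𝒱.Y S (-3) 𝒱.vac

/-- The state `S_(1) W̃`. -/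
noncomputable def cubS₁ (𝒱 : VertexAlgebra V) (a S : V) : V :=
  (-4 : ℂ) • 𝒱.Y a (-1) (𝒱.Y S (-1) 𝒱.vac) - (3 / 2 : ℂ) • 𝒱.Y S (-2) 𝒱.vac

namespace IsBosonVir

variable {a S : V} (h : IsBosonVir 𝒱 a S)
include h

omit h in
theorem cub_eq : cub 𝒱 a S = (1 / 3 : ℂ) • 𝒱.Y a (-1) (𝒱.Y a (-1) (𝒱.Y a (-1) 𝒱.vac))
    + (1 / 2 : ℂ) • 𝒱.Y a (-1) (𝒱.Y a (-2) 𝒱.vac) + (1 / 6 : ℂ) • 𝒱.Y a (-3) 𝒱.vac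
    - (2 : ℂ) • 𝒱.Y a (-1) (𝒱.Y S (-1) 𝒱.vac) - (1 / 2 : ℂ) • 𝒱.Y S (-2) 𝒱.vac :=
  cub_map LinearMap.id

theorem a_S_vac {m n : ℤ} (hm : 0 ≤ m) : 𝒱.Y a m (𝒱.Y S n 𝒱.vac) = 0 := by
  rw [h.haS, 𝒱.Y_apply_vac_of_nonneg _ _ hm, map_zero]

theorem cub_S (m n : ℤ) (v : V) : 𝒱.Y (cub 𝒱 a S) n (𝒱.Y S m v) =
    𝒱.Y S m (𝒱.Y (cub 𝒱 a S) n v) - 𝒱.Y (cubS₀ 𝒱 a S) (m + n) v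
      - (m : ℂ) • 𝒱.Y (cubS₁ 𝒱 a S) (m + n - 1) v
      + ((m : ℂ) * (m - 1)) • 𝒱.Y S (m + n - 2) v := by
  have hv := fun (x : V) (j : ℤ) (hj : 0 ≤ j) => 𝒱.Y_apply_vac_of_nonneg x j hj
  have e0 : 𝒱.Y S 0 (cub 𝒱 a S) = cubS₀ 𝒱 a S := by
    rw [cub_map, cubS₀]; norm_num [h.S_a, h.S_S, hv]; module
  have e1 : 𝒱.Y S 1 (cub 𝒱 a S) = cubS₁ 𝒱 a S := by
    rw [cub_map, cubS₁]; norm_num [h.S_a, h.S_S, hv]; module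
  have e2 : 𝒱.Y S 2 (cub 𝒱 a S) = (-2 : ℂ) • S := by
    conv_rhs => rw [← 𝒱.Y_apply_vac S]
    rw [cub_map]; norm_num [h.S_a, h.S_S, hv]; module
  have e3 : ∀ j : ℤ, 3 ≤ j → 𝒱.Y S j (cub 𝒱 a S) = 0 := fun j hj => by
    rw [cub_map]; norm_num [h.S_a, h.S_S (show 0 ≤ j by omega), hv, show 0 ≤ j by omega,
      hv S (j + -1 - 1) (by omega), hv S (j + -2 - 1) (by omega)]
  rw [𝒱.commutator_apply S _ (fun j hj => e3 j (by omega)), e0, e1, e2, e3 3 (by norm_num),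
    e3 4 (by norm_num), e3 5 (by norm_num)]
  norm_num
  module

/-- `W̃(z)` is a primary field of weight `3`. -/
theorem conf_cub (m n : ℤ) (v : V) : 𝒱.Y (conf 𝒱 a S) m (𝒱.Y (cub 𝒱 a S) n v) =
    𝒱.Y (cub 𝒱 a S) n (𝒱.Y (conf 𝒱 a S) m v)
      + (2 * (m : ℂ) - n) • 𝒱.Y (cub 𝒱 a S) (m + n - 1) v := by
  have hv := fun (x : V) (j : ℤ) (hj : 0 ≤ j) => 𝒱.Y_apply_vac_of_nonneg x j hj
  have n1 := fun v => h.a_a_neg (show -2 < -1 by norm_num) (by norm_num) v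
  have n2 := fun v => h.a_a_neg (show -3 < -1 by norm_num) (by norm_num) v
  have e0 : 𝒱.Y (conf 𝒱 a S) 0 (cub 𝒱 a S) = 𝒱.T (cub 𝒱 a S) := by
    rw [cub_map, cub_map]
    norm_num [h.conf_a, h.conf_S, hv, 𝒱.T_Y_apply, 𝒱.T_vac]
  have e1 : 𝒱.Y (conf 𝒱 a S) 1 (cub 𝒱 a S) = (3 : ℂ) • cub 𝒱 a S := by
    rw [cub_map]
    conv_rhs => rw [cub_eq]
    norm_num [h.conf_a, h.conf_S, hv, n1]
    module
  have e2 : 𝒱.Y (conf 𝒱 a S) 2 (cub 𝒱 a S) = 0 := by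
    rw [cub_map]
    norm_num [h.conf_a, h.conf_S, hv, h.a_S_vac, h.a_a, n1]
    module
  have e3 : 𝒱.Y (conf 𝒱 a S) 3 (cub 𝒱 a S) = 0 := by
    rw [cub_map]
    norm_num [h.conf_a, h.conf_S, hv, h.a_S_vac, h.a_a]
    module
  have e4 : 𝒱.Y (conf 𝒱 a S) 4 (cub 𝒱 a S) = 0 := by
    rw [cub_map]
    norm_num [h.conf_a, h.conf_S, hv, h.a_S_vac, h.a_a]
    module
  have e5 : ∀ j : ℤ, 5 ≤ j → 𝒱.Y (conf 𝒱 a S) j (cub 𝒱 a S) = 0 := fun j hj =>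
    𝒱.Y_eq_zero h.conf_mem h.cub_mem (by push_cast; omega)
  rw [𝒱.commutator_apply _ _ (fun j hj => e5 j (by omega)), e0, e1, e2, e3, e4,
    e5 5 (by norm_num), 𝒱.Y_T_apply]
  norm_num
  module

/-- The odd coefficients of the operator product of `W̃` with itself; the even ones follow from
these by skew-symmetry. -/
theorem cub_cub_states : 𝒱.Y (cub 𝒱 a S) 5 (cub 𝒱 a S) = (-1 : ℂ) • 𝒱.vac ∧
    𝒱.Y (cub 𝒱 a S) 3 (cub 𝒱 a S) = (3 : ℂ) • conf 𝒱 a S ∧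
    𝒱.Y (cub 𝒱 a S) 1 (cub 𝒱 a S) = (4 : ℂ) • 𝒱.Y (conf 𝒱 a S) (-1) (conf 𝒱 a S)
      - (3 / 4 : ℂ) • 𝒱.T (𝒱.T (conf 𝒱 a S)) := by
  have hv := fun (x : V) (j : ℤ) (hj : 0 ≤ j) => 𝒱.Y_apply_vac_of_nonneg x j hj
  have n1 := fun v => h.a_a_neg (show -2 < -1 by norm_num) (by norm_num) v
  have n2 := fun v => h.a_a_neg (show -3 < -1 by norm_num) (by norm_num) v
  have q1 : 𝒱.Y (quad 𝒱 a S) (-1) 𝒱.vac = 𝒱.Y a (-1) (𝒱.Y a (-1) 𝒱.vac)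
      + (1 / 2 : ℂ) • 𝒱.Y a (-2) 𝒱.vac - (2 : ℂ) • 𝒱.Y S (-1) 𝒱.vac := by
    rw [𝒱.Y_apply_vac, 𝒱.Y_apply_vac S, quad]
  have q2 : 𝒱.Y (quad 𝒱 a S) (-2) 𝒱.vac = (2 : ℂ) • 𝒱.Y a (-1) (𝒱.Y a (-2) 𝒱.vac)
      + 𝒱.Y a (-3) 𝒱.vac - (2 : ℂ) • 𝒱.Y S (-2) 𝒱.vac := by
    rw [𝒱.Y_neg_two_vac (quad 𝒱 a S), quad_map]
    norm_num [𝒱.T_Y_apply, 𝒱.T_vac, n1]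
    module
  have q3 : 𝒱.Y (quad 𝒱 a S) (-3) 𝒱.vac = (2 : ℂ) • 𝒱.Y a (-1) (𝒱.Y a (-3) 𝒱.vac)
      + 𝒱.Y a (-2) (𝒱.Y a (-2) 𝒱.vac)
      + (3 / 2 : ℂ) • 𝒱.Y a (-4) 𝒱.vac - (2 : ℂ) • 𝒱.Y S (-3) 𝒱.vac := by
    rw [𝒱.Y_neg_three_vac (quad 𝒱 a S), quad_map]
    norm_num [𝒱.T_Y_apply, 𝒱.T_vac, n1, n2]
    module
  have z1 : 𝒱.Y (cubS₀ 𝒱 a S) (-1) 𝒱.vac = (-2 : ℂ) • 𝒱.Y a (-1) (𝒱.Y S (-2) 𝒱.vac)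
      - 𝒱.Y S (-3) 𝒱.vac := by rw [𝒱.Y_apply_vac, cubS₀]
  have z2 : 𝒱.Y (cubS₀ 𝒱 a S) (-2) 𝒱.vac = (-2 : ℂ) • 𝒱.Y a (-2) (𝒱.Y S (-2) 𝒱.vac)
      - (4 : ℂ) • 𝒱.Y a (-1) (𝒱.Y S (-3) 𝒱.vac) - (3 : ℂ) • 𝒱.Y S (-4) 𝒱.vac := by
    rw [𝒱.Y_neg_two_vac, cubS₀]
    norm_num [𝒱.T_Y_apply, 𝒱.T_vac]
    module
  have y1 : 𝒱.Y (cubS₁ 𝒱 a S) (-1) 𝒱.vac = (-4 : ℂ) • 𝒱.Y a (-1) (𝒱.Y S (-1) 𝒱.vac)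
      - (3 / 2 : ℂ) • 𝒱.Y S (-2) 𝒱.vac := by rw [𝒱.Y_apply_vac, cubS₁]
  have y2 : 𝒱.Y (cubS₁ 𝒱 a S) (-2) 𝒱.vac = (-4 : ℂ) • 𝒱.Y a (-2) (𝒱.Y S (-1) 𝒱.vac)
      - (4 : ℂ) • 𝒱.Y a (-1) (𝒱.Y S (-2) 𝒱.vac) - (3 : ℂ) • 𝒱.Y S (-3) 𝒱.vac := by
    rw [𝒱.Y_neg_two_vac, cubS₁]
    norm_num [𝒱.T_Y_apply, 𝒱.T_vac]
    module
  have y3 : 𝒱.Y (cubS₁ 𝒱 a S) (-3) 𝒱.vac = (-4 : ℂ) • 𝒱.Y a (-3) (𝒱.Y S (-1) 𝒱.vac)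
      - (4 : ℂ) • 𝒱.Y a (-2) (𝒱.Y S (-2) 𝒱.vac)
      - (4 : ℂ) • 𝒱.Y a (-1) (𝒱.Y S (-3) 𝒱.vac) - (9 / 2 : ℂ) • 𝒱.Y S (-4) 𝒱.vac := by
    rw [𝒱.Y_neg_three_vac, cubS₁]
    norm_num [𝒱.T_Y_apply, 𝒱.T_vac]
    module
  have c1 : 𝒱.Y (conf 𝒱 a S) (-1) 𝒱.vac = 𝒱.Y S (-1) 𝒱.vac
      + (1 / 2 : ℂ) • 𝒱.Y a (-1) (𝒱.Y a (-1) 𝒱.vac) + (1 / 2 : ℂ) • 𝒱.Y a (-2) 𝒱.vac := by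
    rw [𝒱.Y_apply_vac, 𝒱.Y_apply_vac S, conf]
  refine ⟨?_, ?_, ?_⟩
  · rw [cub_map]
    norm_num [h.cub_a, h.cub_S, h.quad_a, h.quad_S, hv, h.a_S_vac, h.a_a, h.S_a, h.S_S,
      q1, q2, q3, z1, z2, y1, y2, y3]
    module
  · rw [cub_map]
    conv_rhs => rw [conf, ← 𝒱.Y_apply_vac S]
    norm_num [h.cub_a, h.cub_S, h.quad_a, h.quad_S, hv, h.a_S_vac, h.a_a, h.S_a, h.S_S,
      q1, q2, q3, z1, z2, y1, y2, y3, n1, n2]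
    module
  · rw [cub_map, conf_map (𝒱.Y (conf 𝒱 a S) (-1)), conf_map 𝒱.T]
    norm_num [h.cub_a, h.cub_S, h.quad_a, h.quad_S, hv, h.a_S_vac, h.a_a, h.S_a, h.S_S,
      q1, q2, q3, z1, z2, y1, y2, y3, n1, n2, 𝒱.T_Y_apply, 𝒱.T_vac, h.conf_a, h.conf_S, c1]
    module

end IsBosonVir

end FreeField

namespace VertexAlgebra

variable {V : Type*} [AddCommGroup V] [Module ℂ V] (𝒱 : VertexAlgebra V)

/-- The operators `Λ_m` are the modes of `ω_(-1) ω - (3/10) T² ω`. -/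
theorem lambdaOf_eq (ω : V) {K m : ℤ} {v : V} (hK : |m| ≤ K)
    (h1 : ∀ k : ℤ, m + K + 1 ≤ k → 𝒱.Y ω (k + 1) v = 0)
    (h2 : ∀ k : ℤ, K + 1 ≤ k → 𝒱.Y ω (k + 1) v = 0) :
    WThree.lambdaOf (fun n => 𝒱.Y ω (n + 1)) K m v = 𝒱.Y (𝒱.Y ω (-1) ω) (m + 3) v
      - (3 / 10 * ((m : ℂ) + 2) * ((m : ℂ) + 3)) • 𝒱.Y ω (m + 1) v := by
  have hK0 : 0 ≤ K := (abs_nonneg m).trans hK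
  rw [𝒱.Y_nop_apply ω ω (m + 3) v (K := (K - 1).toNat) (K' := (K + 2).toNat)
    (fun i hi => by rw [show m + 3 + (i : ℤ) = m + 2 + i + 1 by ring]; exact h1 _ (by omega))
    (fun i hi => by rw [show (i : ℤ) = i - 1 + 1 by ring]; exact h2 _ (by omega)), WThree.lambdaOf]
  congr 2
  · refine sum_nbij' (fun n => (-2 - n).toNat) (fun i => -2 - (i : ℤ)) ?_ ?_ ?_ ?_ ?_
    · intro n hn; simp only [mem_Icc, mem_range] at hn ⊢; omega
    · intro n hn; simp only [mem_Icc, mem_range] at hn ⊢; omega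
    · intro n hn; simp only [mem_Icc] at hn; omega
    · intro n hn; omega
    · intro n hn
      simp only [mem_Icc] at hn
      rw [show (-1 - ((-2 - n).toNat : ℤ)) = n + 1 by omega,
        show m + 3 + ((-2 - n).toNat : ℤ) = m - n + 1 by omega]
  · refine sum_nbij' (fun n => (n + 1).toNat) (fun i => (i : ℤ) - 1) ?_ ?_ ?_ ?_ ?_
    · intro n hn; simp only [mem_Icc, mem_range] at hn ⊢; omega
    · intro n hn; simp only [mem_Icc, mem_range] at hn ⊢; omega
    · intro n hn; simp only [mem_Icc] at hn; omega
    · intro n hn; omega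
    · intro n hn
      simp only [mem_Icc] at hn
      rw [show (m + 3 - 1 - ((n + 1).toNat : ℤ)) = m - n + 1 by omega,
        show ((n + 1).toNat : ℤ) = n + 1 by omega]

end VertexAlgebra

namespace WThree

theorem rescale_sq : rescale ^ 2 = 3 / 2 := by
  have : ((Real.sqrt 6 : ℝ) : ℂ) ^ 2 = 6 := by
    rw [← Complex.ofReal_pow, Real.sq_sqrt (by norm_num)]; norm_num
  rw [rescale, div_pow, this]; norm_num

theorem rescale_ne_zero : rescale ≠ 0 := fun h => by
  have := rescale_sq
  rw [h] at this; norm_num at this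

end WThree

namespace FreeField

open VertexAlgebra

variable {V : Type*} [AddCommGroup V] [Module ℂ V] {𝒱 : VertexAlgebra V}

namespace IsBosonVir

variable {a S : V} (h : IsBosonVir 𝒱 a S)
include h

/-- The commutator of the modes of `W̃`: the `W₃` relation at `c = -2`, rescaled. -/
theorem cub_cub (m n : ℤ) (v : V) : 𝒱.Y (cub 𝒱 a S) m (𝒱.Y (cub 𝒱 a S) n v) =
    𝒱.Y (cub 𝒱 a S) n (𝒱.Y (cub 𝒱 a S) m v)
      + ((2 * ((m : ℂ) - n)) • 𝒱.Y (𝒱.Y (conf 𝒱 a S) (-1) (conf 𝒱 a S)) (m + n - 1) v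
      + (-(3 / 8) * ((m : ℂ) - n) * (m + n - 1) * (m + n - 2)
        + 1 / 8 * (m + n) * (m + n - 1) * (m + n - 2) - 3 / 4 * m * (m - 1) * (m + n - 2)
        + 1 / 2 * m * (m - 1) * (m - 2)) • 𝒱.Y (conf 𝒱 a S) (m + n - 3) v
      - (if m + n = 4 then (m : ℂ) * (m - 1) * (m - 2) * (m - 3) * (m - 4) / 120 else 0) • v) := by
  obtain ⟨x5, x3, x1⟩ := h.cub_cub_states
  have hv := fun (x : V) (j : ℤ) (hj : 0 ≤ j) => 𝒱.Y_apply_vac_of_nonneg x j hj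
  set W := cub 𝒱 a S with hW
  set ω := conf 𝒱 a S with hω
  have e6 : ∀ j : ℤ, 6 ≤ j → 𝒱.Y W j W = 0 := fun j hj =>
    𝒱.Y_eq_zero h.cub_mem h.cub_mem (by push_cast; omega)
  -- skew-symmetry, from `W_(-1) W_(j) |0⟩ = 0`
  have skew : ∀ j : ℤ, 0 ≤ j → 𝒱.Y W j W = -(𝒱.Y (𝒱.Y W 0 W) (j - 1) 𝒱.vac
      - 𝒱.Y (𝒱.Y W 1 W) (j - 2) 𝒱.vac + 𝒱.Y (𝒱.Y W 2 W) (j - 3) 𝒱.vac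
      - 𝒱.Y (𝒱.Y W 3 W) (j - 4) 𝒱.vac + 𝒱.Y (𝒱.Y W 4 W) (j - 5) 𝒱.vac
      - 𝒱.Y (𝒱.Y W 5 W) (j - 6) 𝒱.vac) := by
    intro j hj
    have := 𝒱.commutator_apply W W (fun j hj => e6 j (by omega)) (-1) j 𝒱.vac
    rw [hv W j hj, map_zero, 𝒱.Y_apply_vac W] at this
    rw [eq_neg_iff_add_eq_zero, this]
    rw [show -1 + j - 1 = j - 2 by ring, show -1 + j - 2 = j - 3 by ring,
      show -1 + j - 3 = j - 4 by ring, show -1 + j - 4 = j - 5 by ring,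
      show -1 + j - 5 = j - 6 by ring, show -1 + j = j - 1 by ring]
    push_cast
    module
  have x4 : 𝒱.Y W 4 W = 0 := by
    have := skew 4 (by norm_num)
    rw [x5, map_smul] at this
    norm_num [hv, 𝒱.Y_apply_vac, 𝒱.Y_vac_apply] at this
    have h2 : (2 : ℂ) • 𝒱.Y W 4 W = 0 := by
      rw [two_smul]; nth_rw 1 [this]; abel
    exact (smul_eq_zero.mp h2).resolve_left two_ne_zero
  have x2 : 𝒱.Y W 2 W = (3 / 2 : ℂ) • 𝒱.T ω := by
    have := skew 2 (by norm_num)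
    rw [x5, x4, x3, map_smul, map_smul] at this
    norm_num [hv, 𝒱.Y_apply_vac, 𝒱.Y_vac_apply, 𝒱.Y_neg_two_vac] at this
    have h2 : (2 : ℂ) • 𝒱.Y W 2 W = (3 : ℂ) • 𝒱.T ω := by
      rw [two_smul]; nth_rw 1 [this]; abel
    refine smul_right_injective V (two_ne_zero (α := ℂ)) ?_
    change (2 : ℂ) • 𝒱.Y W 2 W = (2 : ℂ) • ((3 / 2 : ℂ) • 𝒱.T ω)
    rw [h2, smul_smul]; norm_num
  have x0 : 𝒱.Y W 0 W = (1 / 2 : ℂ) • 𝒱.T (𝒱.Y W 1 W) - (1 / 8 : ℂ) • 𝒱.T (𝒱.T (𝒱.T ω)) := by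
    have := skew 0 (by norm_num)
    rw [x5, x4, x3, x2, map_smul, map_smul, map_smul] at this
    norm_num [hv, 𝒱.Y_apply_vac, 𝒱.Y_vac_apply, 𝒱.Y_neg_two_vac, 𝒱.Y_neg_three_vac,
      𝒱.Y_neg_four_vac] at this
    have h2 : (2 : ℂ) • 𝒱.Y W 0 W = (2 : ℂ) • ((1 / 2 : ℂ) • 𝒱.T (𝒱.Y W 1 W)
        - (1 / 8 : ℂ) • 𝒱.T (𝒱.T (𝒱.T ω))) := by
      rw [two_smul]; nth_rw 1 [this]; module
    exact smul_right_injective V (two_ne_zero (α := ℂ)) h2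
  have y1 : ∀ k : ℤ, 𝒱.Y (𝒱.Y W 1 W) k v = (4 : ℂ) • 𝒱.Y (𝒱.Y ω (-1) ω) k v
      - (3 / 4 * k * (k - 1) : ℂ) • 𝒱.Y ω (k - 2) v := by
    intro k
    rw [x1]
    simp only [map_sub, map_smul, Pi.sub_apply, Pi.smul_apply, 𝒱.Y_T_apply, LinearMap.sub_apply,
      LinearMap.smul_apply]
    rw [show k - 1 - 1 = k - 2 by ring]
    push_cast
    module
  have y0 : ∀ k : ℤ, 𝒱.Y (𝒱.Y W 0 W) k v = (-1 / 2 * k : ℂ) • 𝒱.Y (𝒱.Y W 1 W) (k - 1) v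
      + (1 / 8 * k * (k - 1) * (k - 2) : ℂ) • 𝒱.Y ω (k - 3) v := by
    intro k
    rw [x0]
    simp only [map_sub, map_smul, Pi.sub_apply, Pi.smul_apply, 𝒱.Y_T_apply, LinearMap.sub_apply,
      LinearMap.smul_apply]
    rw [show k - 1 - 1 - 1 = k - 3 by ring]
    push_cast
    module
  rw [𝒱.commutator_apply W W (fun j hj => e6 j (by omega)), y0, y1, x2, x3, x4, x5]
  simp only [map_zero, map_smul, Pi.smul_apply, Pi.zero_apply, 𝒱.Y_T_apply,
    LinearMap.zero_apply, LinearMap.smul_apply, 𝒱.Y_vac_apply]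
  rw [show m + n - 1 - 2 = m + n - 3 by ring, show m + n - 2 - 1 = m + n - 3 by ring]
  by_cases h : m + n = 4
  · simp only [h]; norm_num
    have : (n : ℂ) = 4 - m := by rw [← Int.cast_ofNat, ← h]; push_cast; ring
    rw [this]
    module
  · simp only [h, show m + n - 5 ≠ -1 by omega, if_false]; push_cast; module

theorem L0_word (l : List WThree.Gen) : 𝒱.L0 (WThree.wordOf (fun n => 𝒱.Y (conf 𝒱 a S) (n + 1))
    (fun n => WThree.rescale⁻¹ • 𝒱.Y (cub 𝒱 a S) (n + 2)) 𝒱.vac l) =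
    ((-WThree.degree l : ℤ) : ℂ) • WThree.wordOf (fun n => 𝒱.Y (conf 𝒱 a S) (n + 1))
    (fun n => WThree.rescale⁻¹ • 𝒱.Y (cub 𝒱 a S) (n + 2)) 𝒱.vac l := by
  induction l with
  | nil => simp [WThree.wordOf, WThree.degree, L0_vac]
  | cons g l ih =>
    rcases g with n | n
    · change 𝒱.L0 (𝒱.Y (conf 𝒱 a S) (n + 1) (WThree.wordOf _ _ _ l)) = _ • 𝒱.Y (conf 𝒱 a S) (n + 1)
        (WThree.wordOf _ _ _ l)
      rw [L0_Y_apply, ih, 𝒱.L0_apply 2 _ h.conf_mem, WThree.VacuumRep.degree_cons]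
      simp only [map_smul, Pi.smul_apply, LinearMap.smul_apply, WThree.Gen.index]
      push_cast
      module
    · change 𝒱.L0 (WThree.rescale⁻¹ • 𝒱.Y (cub 𝒱 a S) (n + 2) (WThree.wordOf _ _ _ l)) =
        _ • (WThree.rescale⁻¹ • 𝒱.Y (cub 𝒱 a S) (n + 2) (WThree.wordOf _ _ _ l))
      rw [map_smul, L0_Y_apply, ih, 𝒱.L0_apply 3 _ h.cub_mem, WThree.VacuumRep.degree_cons]
      simp only [map_smul, Pi.smul_apply, LinearMap.smul_apply, WThree.Gen.index]
      push_cast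
      module

/-- The representation of the `W₃` algebra at `c = -2` on the free field vertex algebra. -/
noncomputable def vacuumRep : WThree.VacuumRep (-2) V where
  L n := 𝒱.Y (conf 𝒱 a S) (n + 1)
  W n := WThree.rescale⁻¹ • 𝒱.Y (cub 𝒱 a S) (n + 2)
  Ω := 𝒱.vac
  L_vac n hn := 𝒱.Y_apply_vac_of_nonneg _ _ (by omega)
  W_vac n hn := by rw [LinearMap.smul_apply, 𝒱.Y_apply_vac_of_nonneg _ _ (by omega), smul_zero]
  word_eq_zero l hl := 𝒱.eq_zero_of_L0_eq (by omega) (h.L0_word l)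
  LL m n v := by
    rw [h.conf_conf, show m + 1 + (n + 1) - 1 = m + n + 1 by ring]
    by_cases h : m + n = 0
    · simp only [h, show m + 1 + (n + 1) = 2 by omega, if_true]; push_cast; module
    · simp only [h, show m + 1 + (n + 1) ≠ 2 by omega, if_false]; push_cast; module
  LW m n v := by
    simp only [LinearMap.smul_apply, map_smul]
    rw [h.conf_cub, show m + 1 + (n + 2) - 1 = m + n + 2 by ring]
    push_cast
    module
  WW m n K l hK := by
    have hz : ∀ k : ℤ, 0 < k + WThree.degree l → 𝒱.Y (conf 𝒱 a S) (k + 1)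
        (WThree.wordOf (fun n => 𝒱.Y (conf 𝒱 a S) (n + 1))
          (fun n => WThree.rescale⁻¹ • 𝒱.Y (cub 𝒱 a S) (n + 2)) 𝒱.vac l) = 0 := fun k hk =>
      𝒱.eq_zero_of_L0_eq (z := -(WThree.degree (WThree.Gen.L k :: l)))
        (by rw [WThree.VacuumRep.degree_cons]; simp only [WThree.Gen.index]; omega)
        (h.L0_word (WThree.Gen.L k :: l))
    have h0 := neg_abs_le (WThree.degree l)
    have h0' := neg_abs_le (m + n)
    rw [𝒱.lambdaOf_eq _ (by have := abs_nonneg (WThree.degree l); omega)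
      (fun k hk => hz k (by omega)) (fun k hk => hz k (by have := abs_nonneg (m + n); omega))]
    generalize WThree.wordOf (fun n => 𝒱.Y (conf 𝒱 a S) (n + 1))
      (fun n => WThree.rescale⁻¹ • 𝒱.Y (cub 𝒱 a S) (n + 2)) 𝒱.vac l = v
    simp only [LinearMap.smul_apply, map_smul]
    rw [h.cub_cub, show m + 2 + (n + 2) - 1 = m + n + 3 by ring,
      show m + 2 + (n + 2) - 3 = m + n + 1 by ring]
    have hr : WThree.rescale⁻¹ * WThree.rescale⁻¹ = 2 / 3 := by
      rw [← mul_inv, ← sq, WThree.rescale_sq]; norm_num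
    simp only [smul_add, smul_sub, smul_smul, ← mul_assoc, hr, WThree.coeffL]
    by_cases h : m + n = 0
    · simp only [h, show m + 2 + (n + 2) = 4 by omega, if_true]
      have : (n : ℂ) = -m := by
        rw [eq_neg_iff_add_eq_zero, add_comm]; exact_mod_cast h
      push_cast
      rw [this]
      module
    · simp only [h, show m + 2 + (n + 2) ≠ 4 by omega, if_false]; push_cast; module

end IsBosonVir

end FreeField

namespace Heisenberg

open VertexAlgebra MvPolynomial

theorem isBosonVir {𝓗 : VertexAlgebra Fock} (hL : 𝓗.L0 = degOpEnd)
    (hY : ∀ i, 𝓗.Y (X (i, 0)) = boson i) :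
    FreeField.IsBosonVir 𝓗 (X (0, 0)) (FreeField.vir 𝓗 (X (1, 0))) := by
  have hmem : ∀ i, (X (i, 0) : Fock) ∈ 𝓗.grading 1 := fun i => by
    rw [mem_grading_iff, hL, degOpEnd_apply, degOp_X]; simp
  have hbb : ∀ (m n : ℤ) (v : Fock), 𝓗.Y (X (1, 0)) m (𝓗.Y (X (1, 0)) n v) =
      𝓗.Y (X (1, 0)) n (𝓗.Y (X (1, 0)) m v) + (if m + n = 0 then 1 / 3 * (m : ℂ) else 0) • v := by
    intro m n v
    rw [hY, boson_comm]
    simp [level]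
  have e : ∀ j : ℕ, 𝓗.Y (X (0, 0)) j (FreeField.vir 𝓗 (X (1, 0))) = 0 := by
    intro j
    have hv : boson 0 (j : ℤ) (𝓗.vac) = 0 := by
      rw [← hY]; exact 𝓗.Y_apply_vac_of_nonneg _ _ (by omega)
    simp only [FreeField.vir, map_add, map_smul, hY, boson_comm 0 1, hv]
    simp
  exact {
    ha := hmem 0
    hS := FreeField.vir_mem_grading (hmem 1)
    haa := fun m n v => by
      rw [hY, boson_comm]
      simp [level]
    haS := fun m n v => by
      rw [𝓗.commutator_apply _ _ (fun j _ => e j)]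
      have e' : ∀ j : ℤ, 0 ≤ j → 𝓗.Y (X (0, 0)) j (FreeField.vir 𝓗 (X (1, 0))) = 0 :=
        fun j hj => by lift j to ℕ using hj; exact e j
      simp [e']
    hSS := fun m n v => FreeField.vir_vir (hmem 1) hbb m n v }

end Heisenberg

/-! ### Homomorphisms of vertex algebras -/

namespace VertexAlgebra

variable {V U : Type*} [AddCommGroup V] [Module ℂ V] [AddCommGroup U] [Module ℂ U]
  (𝒱 : VertexAlgebra V) (𝒰 : VertexAlgebra U) (f : V →ₗ[ℂ] U)

/-- The states `x` whose modes are intertwined by the linear map `f`. -/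
def intertwined : Submodule ℂ V where
  carrier := {x | ∀ n v, f (𝒱.Y x n v) = 𝒰.Y (f x) n (f v)}
  zero_mem' := fun n v => by simp
  add_mem' := fun hx hy n v => by
    simp only [map_add, Pi.add_apply, LinearMap.add_apply]; rw [hx n v, hy n v]
  smul_mem' := fun c x hx n v => by
    simp only [map_smul, Pi.smul_apply, LinearMap.smul_apply]; rw [hx n v]

variable {𝒱 𝒰 f}

theorem mem_intertwined {x : V} : x ∈ intertwined 𝒱 𝒰 f ↔
    ∀ n v, f (𝒱.Y x n v) = 𝒰.Y (f x) n (f v) := Iff.rfl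

theorem vac_mem_intertwined (hv : f 𝒱.vac = 𝒰.vac) : 𝒱.vac ∈ intertwined 𝒱 𝒰 f := fun n v => by
  rw [hv, Y_vac_apply, Y_vac_apply]; split_ifs <;> simp

theorem map_T_of_mem_intertwined (hv : f 𝒱.vac = 𝒰.vac) {x : V} (hx : x ∈ intertwined 𝒱 𝒰 f) :
    f (𝒱.T x) = 𝒰.T (f x) := by
  rw [T_apply, hx, hv, T_apply]

theorem T_mem_intertwined (hv : f 𝒱.vac = 𝒰.vac) {x : V} (hx : x ∈ intertwined 𝒱 𝒰 f) :
    𝒱.T x ∈ intertwined 𝒱 𝒰 f := fun n v => by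
  rw [map_T_of_mem_intertwined hv hx, Y_T_apply, Y_T_apply, LinearMap.smul_apply,
    LinearMap.smul_apply, map_smul, hx]

theorem nop_mem_intertwined {x y : V} (hx : x ∈ intertwined 𝒱 𝒰 f)
    (hy : y ∈ intertwined 𝒱 𝒰 f) : 𝒱.Y x (-1) y ∈ intertwined 𝒱 𝒰 f := fun n v => by
  obtain ⟨K, hK⟩ := 𝒱.field y v
  obtain ⟨K', hK'⟩ := 𝒱.field x v
  rw [hx, 𝒱.Y_nop_apply x y n v (K := (K - n).toNat) (K' := K'.toNat)
    (fun i hi => hK _ (by omega)) (fun i hi => hK' _ (by omega)),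
    𝒰.Y_nop_apply (f x) (f y) n (f v) (K := (K - n).toNat) (K' := K'.toNat)
    (fun i hi => by rw [← hy, hK _ (by omega), map_zero])
    (fun i hi => by rw [← hx, hK' _ (by omega), map_zero])]
  simp only [map_add, map_sum, hx _ _, hy _ _]

variable (𝒱) in
theorem Y_neg_sub_one (x : V) (k : ℕ) :
    𝒱.Y x (-1 - k) = ((k.factorial : ℂ)⁻¹) • 𝒱.Y (𝒱.T^[k] x) (-1) := by
  have h1 : ∀ k : ℕ, 𝒱.Y (𝒱.T^[k] x) = derivField^[k] (𝒱.Y x) := fun k => by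
    induction k with
    | zero => rfl
    | succ k ih => rw [Function.iterate_succ_apply', Y_T, ih, Function.iterate_succ_apply']
  rw [h1, derivField_iterate_neg_one, smul_smul, inv_mul_cancel₀ (by
    exact_mod_cast k.factorial_ne_zero), one_smul]

/-- Since `x_(-1-k)` is a multiple of `(T^k x)_(-1)`, the intertwined states are closed under all
products of negative index. -/
theorem Y_neg_mem_intertwined (hv : f 𝒱.vac = 𝒰.vac) {x y : V} (hx : x ∈ intertwined 𝒱 𝒰 f)
    (hy : y ∈ intertwined 𝒱 𝒰 f) {n : ℤ} (hn : n < 0) : 𝒱.Y x n y ∈ intertwined 𝒱 𝒰 f := by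
  have h1 : ∀ k : ℕ, 𝒱.T^[k] x ∈ intertwined 𝒱 𝒰 f := fun k => by
    induction k with
    | zero => exact hx
    | succ k ih => rw [Function.iterate_succ_apply']; exact T_mem_intertwined hv ih
  obtain ⟨k, rfl⟩ : ∃ k : ℕ, n = -1 - k := ⟨(-1 - n).toNat, by omega⟩
  rw [Y_neg_sub_one]
  exact Submodule.smul_mem _ _ (nop_mem_intertwined (h1 k) hy)

theorem map_zhuOp (hf : intertwined 𝒱 𝒰 f = ⊤) (h0 : ∀ v, f (𝒱.L0 v) = 𝒰.L0 (f v)) (k : ℤ)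
    (a b : V) : f (𝒱.zhuOp k a b) = 𝒰.zhuOp k (f a) (f b) := by
  refine 𝒱.grading_induction (P := fun a => f (𝒱.zhuOp k a b) = 𝒰.zhuOp k (f a) (f b))
    ?_ (by simp) (fun a a' h h' => by simp [h, h']) a
  intro p a ha
  have ha' : f a ∈ 𝒰.grading p := by
    rw [mem_grading_iff, ← h0, 𝒱.L0_apply p a ha, map_smul]
  rw [zhuOp_of_mem _ _ ha, zhuOp_of_mem _ _ ha']
  have hh : ∀ n v, f (𝒱.Y a n v) = 𝒰.Y (f a) n (f v) := mem_intertwined.mp (hf ▸ Submodule.mem_top)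
  simp only [map_sum, map_smul, hh]

/-! ### The residue products of a normally ordered product -/

variable (𝒱)

/-- The identity `(z + 1)^(p + 1) = (z + 1)^p + z (z + 1)^p` under the residue. -/
theorem residue_succ (p : ℕ) (k : ℤ) (a b : V) :
    𝒱.residue (p + 1) k a b = 𝒱.residue p k a b + 𝒱.residue p (k - 1) a b := by
  rw [residue_apply, residue_apply, residue_apply, sum_range_succ' _ (p + 1),
    sum_range_succ' (fun j : ℕ => (p.choose j : ℂ) • 𝒱.Y a ((j : ℤ) - k) b) p]
  have h : ∀ j : ℕ, ((j + 1 : ℕ) : ℤ) - k = (j : ℤ) - (k - 1) := fun j => by push_cast; ring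
  simp only [h]
  simp only [Nat.choose_succ_succ', Nat.cast_add, add_smul, sum_add_distrib]
  rw [sum_range_succ (fun j : ℕ => (p.choose (j + 1) : ℂ) • 𝒱.Y a ((j : ℤ) - (k - 1)) b) p,
    Nat.choose_succ_self]
  simp only [Nat.choose_zero_right, Nat.cast_zero, zero_smul, add_zero]
  abel

/-- The residue products of `x_(-1) y`, by the expansion of its field as a normally ordered
product. -/
theorem residue_nop (p : ℕ) (k : ℤ) (x y b : V) {K K' : ℕ}
    (hK : ∀ n : ℤ, K - k ≤ n → 𝒱.Y y n b = 0) (hK' : ∀ i : ℕ, K' ≤ i → 𝒱.Y x i b = 0) :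
    𝒱.residue p k (𝒱.Y x (-1) y) b =
      ∑ s ∈ range K, 𝒱.Y x (-1 - s) (𝒱.residue p (k - s) y b)
        + ∑ s ∈ range K', 𝒱.residue p (k + 1 + s) y (𝒱.Y x s b) := by
  have h : ∀ j : ℕ, 𝒱.Y (𝒱.Y x (-1) y) ((j : ℤ) - k) b =
      ∑ i ∈ range K, 𝒱.Y x (-1 - i) (𝒱.Y y ((j : ℤ) - k + i) b)
      + ∑ i ∈ range K', 𝒱.Y y ((j : ℤ) - k - 1 - i) (𝒱.Y x i b) := fun j =>
    𝒱.Y_nop_apply x y _ b (fun i hi => hK _ (by omega)) hK'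
  rw [residue_apply]
  simp only [h, smul_add, sum_add_distrib, smul_sum]
  congr 1
  · rw [sum_comm]
    refine sum_congr rfl fun s _ => ?_
    rw [residue_apply, map_sum]
    refine sum_congr rfl fun j _ => ?_
    rw [map_smul, show (j : ℤ) - (k - s) = j - k + s by ring]
  · rw [sum_comm]
    refine sum_congr rfl fun s _ => ?_
    rw [residue_apply]
    refine sum_congr rfl fun j _ => ?_
    rw [show (j : ℤ) - (k + 1 + s) = j - k - 1 - s by ring]

end VertexAlgebra

/-! ### A homomorphism from the Zhu algebra of the free bosons to polynomials -/

namespace Heisenberg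

open VertexAlgebra MvPolynomial

/-- The algebra homomorphism `α_{-n-1} ↦ (-1)^n α` from the Fock space to polynomials in the zero
modes of the two bosons. -/
noncomputable def zeroMode : Fock →ₐ[ℂ] MvPolynomial (Fin 2) ℂ :=
  aeval fun x => (-1 : ℂ) ^ x.2 • X x.1

theorem zeroMode_X (x : Fin 2 × ℕ) : zeroMode (X x) = (-1 : ℂ) ^ x.2 • X x.1 := aeval_X _ _

theorem zeroMode_transl_add (p : Fock) : zeroMode (transl p + degOp p) = 0 := by
  induction p using MvPolynomial.induction_on with
  | C a => simp [← algebraMap_eq]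
  | add p q hp hq =>
    rw [map_add transl, map_add degOp, show transl p + transl q + (degOp p + degOp q) =
      (transl p + degOp p) + (transl q + degOp q) by abel, map_add, hp, hq, add_zero]
  | mul_X p x hp =>
    have h1 : zeroMode (transl (X x) + degOp (X x)) = 0 := by
      rw [transl_X, degOp_X, map_add, map_smul, map_smul, zeroMode_X, zeroMode_X, pow_succ]
      module
    rw [Derivation.leibniz, Derivation.leibniz]
    rw [show p • transl (X x) + X x • transl p + (p • degOp (X x) + X x • degOp p) =
      p * (transl (X x) + degOp (X x)) + X x * (transl p + degOp p) by
        simp only [smul_eq_mul]; ring, map_add, map_mul, map_mul, hp, h1]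
    ring

variable {𝓗 : VertexAlgebra Fock}

/-- The homogeneous vectors `a` of weight `p` on whose products `zeroMode` behaves like a
homomorphism on the Zhu algebra. -/
structure IsGood (𝓗 : VertexAlgebra Fock) (p : ℕ) (a : Fock) : Prop where
  mem : a ∈ 𝓗.grading p
  residue_one : ∀ b, zeroMode (𝓗.residue p 1 a b) = zeroMode a * zeroMode b
  residue_zero : ∀ k : ℤ, 2 ≤ k → ∀ b, zeroMode (𝓗.residue p k a b) = 0

theorem IsGood.T (hT : 𝓗.T = translOp) (hL : 𝓗.L0 = degOpEnd) {p : ℕ} {a : Fock}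
    (h : IsGood 𝓗 p a) : IsGood 𝓗 (p + 1) (𝓗.T a) := by
  refine ⟨𝓗.T_mem_grading h.mem, fun b => ?_, fun k hk b => ?_⟩
  · have h1 := zeroMode_transl_add a
    have h2 := 𝓗.L0_apply p a h.mem
    rw [hL, degOpEnd_apply] at h2
    rw [← translOp_apply, ← hT, h2, map_add, map_smul, add_eq_zero_iff_eq_neg] at h1
    rw [residue_T, map_add, map_smul, map_smul, h.residue_one, h.residue_zero _ (by norm_num), h1]
    push_cast
    rw [smul_zero, add_zero, neg_mul, smul_mul_assoc]
    module
  · rw [residue_T, map_add, map_smul, map_smul, h.residue_zero k hk,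
      h.residue_zero (k + 1) (by omega), smul_zero, smul_zero, add_zero]

theorem IsGood.X_zero_mul (hY : ∀ i, 𝓗.Y (X (i, 0)) = boson i)
    (hL : 𝓗.L0 = degOpEnd) (i : Fin 2) {p : ℕ} {a : Fock} (h : IsGood 𝓗 p a) :
    IsGood 𝓗 (p + 1) (X (i, 0) * a) := by
  have hmem : (X (i, 0) : Fock) ∈ 𝓗.grading 1 := by
    rw [mem_grading_iff, hL, degOpEnd_apply, degOp_X]; simp
  have hX : ∀ (s : ℕ) (v : Fock), 𝓗.Y (X (i, 0)) (-1 - s) v = X (i, s) * v := fun s v => by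
    rw [hY, boson_neg]
  have hX' : X (i, 0) * a = 𝓗.Y (X (i, 0)) (-1) a := by simpa using (hX 0 a).symm
  have key : ∀ k : ℤ, 1 ≤ k → ∀ b, zeroMode (𝓗.residue (p + 1) k (X (i, 0) * a) b) =
      X i * zeroMode (𝓗.residue p k a b) := by
    intro k hk b
    obtain ⟨N, hN⟩ := 𝓗.field a b
    obtain ⟨N', hN'⟩ := 𝓗.field (X (i, 0)) b
    rw [hX', 𝓗.residue_nop (p + 1) k (X (i, 0)) a b (K := (N + k).toNat) (K' := N'.toNat)
      (fun n hn => hN _ (by omega)) (fun s hs => hN' _ (by omega)), map_add, map_sum, map_sum]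
    -- the second sum vanishes: its term `s = 0` since `α_0 = 0`, the others since `a` is good
    rw [sum_eq_zero (s := range N'.toNat), add_zero]
    · -- the first sum telescopes
      have tel : ∀ K : ℕ, ∑ s ∈ range K, zeroMode (𝓗.Y (X (i, 0)) (-1 - s)
          (𝓗.residue (p + 1) (k - s) a b)) = X i * zeroMode (𝓗.residue p k a b)
            - (-1 : ℂ) ^ K • (X i * zeroMode (𝓗.residue p (k - K) a b)) := by
        intro K
        induction K with
        | zero => simp
        | succ K ih =>
          rw [sum_range_succ, ih, hX, map_mul, zeroMode_X, residue_succ, map_add, pow_succ]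
          rw [show k - ((K + 1 : ℕ) : ℤ) = k - K - 1 by push_cast; ring]
          simp only [mul_add, smul_mul_assoc]
          module
      rw [tel]
      have : 𝓗.residue p (k - (N + k).toNat) a b = 0 := by
        rw [residue_apply]
        exact sum_eq_zero fun j _ => by rw [hN _ (by omega), smul_zero]
      rw [this, map_zero, mul_zero, smul_zero, sub_zero]
    · intro s _
      rcases Nat.eq_zero_or_pos s with rfl | hs
      · rw [hY]
        simp only [Nat.cast_zero, boson_zero, map_zero]
      · rw [residue_succ, map_add, h.residue_zero _ (by omega), h.residue_zero _ (by omega),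
          add_zero]
  refine ⟨?_, fun b => ?_, fun k hk b => ?_⟩
  · rw [hX']
    exact 𝓗.Y_mem_grading hmem h.mem (by push_cast; ring)
  · rw [key 1 le_rfl, h.residue_one, map_mul, zeroMode_X]
    simp [mul_assoc]
  · rw [key k (by omega), h.residue_zero k hk, mul_zero]

theorem IsGood.sub {p : ℕ} {a b : Fock} (ha : IsGood 𝓗 p a) (hb : IsGood 𝓗 p b) :
    IsGood 𝓗 p (a - b) :=
  ⟨Submodule.sub_mem _ ha.mem hb.mem, fun v => by
    rw [map_sub, LinearMap.sub_apply, map_sub, ha.residue_one, hb.residue_one, map_sub, sub_mul],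
    fun k hk v => by
    rw [map_sub, LinearMap.sub_apply, map_sub, ha.residue_zero k hk, hb.residue_zero k hk,
      sub_zero]⟩

theorem IsGood.smul {p : ℕ} {a : Fock} (c : ℂ) (ha : IsGood 𝓗 p a) : IsGood 𝓗 p (c • a) :=
  ⟨Submodule.smul_mem _ _ ha.mem, fun v => by
    rw [map_smul, LinearMap.smul_apply, map_smul, ha.residue_one, map_smul, smul_mul_assoc],
    fun k hk v => by
    rw [map_smul, LinearMap.smul_apply, map_smul, ha.residue_zero k hk, smul_zero]⟩

theorem IsGood.X_mul (hY : ∀ i, 𝓗.Y (X (i, 0)) = boson i)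
    (hT : 𝓗.T = translOp) (hL : 𝓗.L0 = degOpEnd) (i : Fin 2) (n : ℕ) : ∀ {p : ℕ} {a : Fock},
    IsGood 𝓗 p a → IsGood 𝓗 (p + 1 + n) (X (i, n) * a) := by
  induction n with
  | zero => exact fun h => h.X_zero_mul hY hL i
  | succ n ih =>
    intro p a h
    have h1 : ((n : ℂ) + 1)⁻¹ • (𝓗.T (X (i, n) * a) - X (i, n) * 𝓗.T a) = X (i, n + 1) * a := by
      rw [hT, translOp_apply, translOp_apply, Derivation.leibniz, transl_X, smul_eq_mul,
        smul_eq_mul, add_sub_cancel_left, mul_smul_comm, smul_smul,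
        inv_mul_cancel₀ (by exact_mod_cast n.succ_ne_zero), one_smul, mul_comm]
    rw [← h1]
    refine IsGood.smul _ (IsGood.sub ((ih h).T hT hL) ?_)
    rw [show p + 1 + (n + 1) = p + 1 + 1 + n by ring]
    exact ih (h.T hT hL)

theorem isGood_one (h0 : 𝓗.vac = 1) : IsGood 𝓗 0 (1 : Fock) := by
  refine ⟨h0 ▸ 𝓗.vac_mem_grading, fun b => ?_, fun k hk b => ?_⟩
  · rw [residue_apply, map_one zeroMode, one_mul, ← h0]
    simp [Y_vac_apply]
  · rw [residue_apply, ← h0]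
    simp [Y_vac_apply, show -k ≠ -1 by omega]

/-- The map `zeroMode` kills every `a ∘ b` and takes `a * b` to the product: it induces a
homomorphism from the Zhu algebra of the free bosons. -/
theorem zeroMode_zhuOp (h0 : 𝓗.vac = 1) (hY : ∀ i, 𝓗.Y (X (i, 0)) = boson i)
    (hT : 𝓗.T = translOp) (hL : 𝓗.L0 = degOpEnd) (a b : Fock) :
    zeroMode (𝓗.zhuOp 1 a b) = zeroMode a * zeroMode b ∧ zeroMode (𝓗.zhuOp 2 a b) = 0 := by
  have htop : Submodule.span ℂ {a | ∃ p, IsGood 𝓗 p a} = ⊤ := by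
    refine eq_top_of_mul_X_mem (Submodule.subset_span ⟨0, isGood_one h0⟩) fun x p hp => ?_
    induction hp using Submodule.span_induction with
    | mem a ha =>
      obtain ⟨p, hp⟩ := ha
      exact Submodule.subset_span ⟨_, IsGood.X_mul hY hT hL x.1 x.2 hp⟩
    | zero => rw [mul_zero]; exact Submodule.zero_mem _
    | add a b _ _ ha hb => rw [mul_add]; exact Submodule.add_mem _ ha hb
    | smul c a _ ha => rw [mul_smul_comm]; exact Submodule.smul_mem _ _ ha
  have ha : a ∈ Submodule.span ℂ {a | ∃ p, IsGood 𝓗 p a} := htop ▸ Submodule.mem_top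
  induction ha using Submodule.span_induction with
  | mem a ha =>
    obtain ⟨p, hp⟩ := ha
    rw [zhuOp_of_mem _ _ hp.mem, zhuOp_of_mem _ _ hp.mem]
    have h1 := hp.residue_one b
    have h2 := hp.residue_zero 2 le_rfl b
    rw [residue_apply] at h1 h2
    exact ⟨h1, h2⟩
  | zero => simp
  | add a a' _ _ h h' =>
    simp only [map_add, LinearMap.add_apply, h.1, h'.1, h.2, h'.2, add_mul, add_zero, and_self]
  | smul c a _ h =>
    simp only [map_smul, LinearMap.smul_apply, h.1, h.2, smul_mul_assoc, smul_zero, and_self]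

end Heisenberg

/-! ### The image of the vacuum module in the polynomial ring -/

namespace Heisenberg

open MvPolynomial

/-- The images `τ` and `υ` of `ω` and `W̃` in the zero modes `x`, `y` are algebraically
independent: the map `(x, y) ↦ (τ, υ)` of the plane to itself is onto. -/
theorem injective_aeval_zeroModes (τ υ : MvPolynomial (Fin 2) ℂ)
    (hτ : τ = C (3 / 2) * X 1 ^ 2 - C (1 / 2) * X 1 + C (1 / 2) * X 0 ^ 2 - C (1 / 2) * X 0)
    (hυ : υ = C (1 / 3) * X 0 ^ 3 - C (1 / 2) * X 0 ^ 2 + C (1 / 6) * X 0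
      - (C 2 * X 0 - 1) * (C (3 / 2) * X 1 ^ 2 - C (1 / 2) * X 1)) :
    Function.Injective (aeval (R := ℂ) ![τ, υ]) := by
  have hsurj : ∀ v : Fin 2 → ℂ, ∃ u : Fin 2 → ℂ, eval u τ = v 0 ∧ eval u υ = v 1 := by
    intro v
    -- eliminating `y` leaves a cubic equation for `x`
    obtain ⟨x, hx⟩ : ∃ x : ℂ, 4 / 3 * x ^ 3 - 2 * x ^ 2 + (2 / 3 - 2 * v 0) * x
        + (v 0 - v 1) = 0 := by
      let p : Polynomial ℂ := Polynomial.C (4 / 3) * Polynomial.X ^ 3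
        + Polynomial.C (-2) * Polynomial.X ^ 2
        + Polynomial.C (2 / 3 - 2 * v 0) * Polynomial.X + Polynomial.C (v 0 - v 1)
      have hp : p.degree = 3 := Polynomial.degree_cubic (by norm_num)
      obtain ⟨x, hx⟩ := IsAlgClosed.exists_root p (by rw [hp]; norm_num)
      refine ⟨x, ?_⟩
      simp only [p, Polynomial.IsRoot, Polynomial.eval_add, Polynomial.eval_mul,
        Polynomial.eval_C, Polynomial.eval_pow, Polynomial.eval_X] at hx
      linear_combination hx
    obtain ⟨y, hy⟩ : ∃ y : ℂ, 3 / 2 * y ^ 2 - 1 / 2 * y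
        - (v 0 - 1 / 2 * x ^ 2 + 1 / 2 * x) = 0 := by
      let p : Polynomial ℂ := Polynomial.C (3 / 2) * Polynomial.X ^ 2
        + Polynomial.C (-1 / 2) * Polynomial.X
        + Polynomial.C (-(v 0 - 1 / 2 * x ^ 2 + 1 / 2 * x))
      have hp : p.degree = 2 := Polynomial.degree_quadratic (by norm_num)
      obtain ⟨y, hy⟩ := IsAlgClosed.exists_root p (by rw [hp]; norm_num)
      refine ⟨y, ?_⟩
      simp only [p, Polynomial.IsRoot, Polynomial.eval_add, Polynomial.eval_mul,
        Polynomial.eval_C, Polynomial.eval_pow, Polynomial.eval_X] at hy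
      linear_combination hy
    refine ⟨![x, y], ?_, ?_⟩
    · rw [hτ]; simp; linear_combination hy
    · rw [hυ]; simp; linear_combination hx - (2 * x - 1) * hy
  intro p q hpq
  refine MvPolynomial.funext fun v => ?_
  obtain ⟨u, h0, h1⟩ := hsurj v
  have key : ∀ p : MvPolynomial (Fin 2) ℂ, eval u (aeval ![τ, υ] p) = eval v p := by
    intro p
    induction p using MvPolynomial.induction_on with
    | C a => simp
    | add p q hp hq => simp only [map_add, hp, hq]
    | mul_X p i hp =>
      rw [map_mul, map_mul, hp, map_mul, aeval_X, eval_X]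
      fin_cases i
      · simp [h0]
      · simp [h1]
  rw [← key p, ← key q, hpq]

open VertexAlgebra

variable {𝓗 : VertexAlgebra Fock}

theorem zeroMode_vir (h0 : 𝓗.vac = 1) (hY : ∀ i, 𝓗.Y (X (i, 0)) = boson i) :
    zeroMode (FreeField.vir 𝓗 (X (1, 0))) = C (3 / 2) * X 1 ^ 2 - C (1 / 2) * X 1 := by
  have b1 (i v) : boson i (-1) v = X (i, 0) * v := boson_neg i 0 v
  have b2 (i v) : boson i (-2) v = X (i, 1) * v := boson_neg i 1 v
  rw [FreeField.vir, hY, h0, b1, b1, b2]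
  simp only [map_add, map_smul, map_mul, zeroMode_X, map_one]
  refine MvPolynomial.funext fun u => ?_
  simp
  ring

theorem zeroMode_conf (h0 : 𝓗.vac = 1) (hY : ∀ i, 𝓗.Y (X (i, 0)) = boson i) :
    zeroMode (FreeField.conf 𝓗 (X (0, 0)) (FreeField.vir 𝓗 (X (1, 0)))) =
      C (3 / 2) * X 1 ^ 2 - C (1 / 2) * X 1 + C (1 / 2) * X 0 ^ 2 - C (1 / 2) * X 0 := by
  have b1 (i v) : boson i (-1) v = X (i, 0) * v := boson_neg i 0 v
  have b2 (i v) : boson i (-2) v = X (i, 1) * v := boson_neg i 1 v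
  rw [FreeField.conf, map_add, map_add, zeroMode_vir h0 hY, hY, h0, b1, b1, b2]
  simp only [map_smul, map_mul, zeroMode_X, map_one]
  refine MvPolynomial.funext fun u => ?_
  simp
  ring

theorem zeroMode_cub (h0 : 𝓗.vac = 1) (hY : ∀ i, 𝓗.Y (X (i, 0)) = boson i)
    (hT : 𝓗.T = translOp) (hL : 𝓗.L0 = degOpEnd) :
    zeroMode (FreeField.cub 𝓗 (X (0, 0)) (FreeField.vir 𝓗 (X (1, 0)))) =
      C (1 / 3) * X 0 ^ 3 - C (1 / 2) * X 0 ^ 2 + C (1 / 6) * X 0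
      - (C 2 * X 0 - 1) * (C (3 / 2) * X 1 ^ 2 - C (1 / 2) * X 1) := by
  have b1 (i v) : boson i (-1) v = X (i, 0) * v := boson_neg i 0 v
  have b2 (i v) : boson i (-2) v = X (i, 1) * v := boson_neg i 1 v
  have b3 (i v) : boson i (-3) v = X (i, 2) * v := boson_neg i 2 v
  have hS := zeroMode_transl_add (FreeField.vir 𝓗 (X (1, 0)))
  have hS' := 𝓗.L0_apply 2 _ (isBosonVir hL hY).hS
  rw [hL, degOpEnd_apply] at hS'
  rw [hS', map_add, map_smul, zeroMode_vir h0 hY, add_eq_zero_iff_eq_neg] at hS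
  rw [FreeField.cub, 𝓗.Y_neg_two_vac (FreeField.vir 𝓗 (X (1, 0))), hT, translOp_apply]
  simp only [map_add, map_sub, map_smul, hS, hY, h0, b1, b2, b3, map_mul, zeroMode_X,
    zeroMode_vir h0 hY, map_one]
  refine MvPolynomial.funext fun u => ?_
  simp
  ring

end Heisenberg

namespace WThree

open VertexAlgebra

/-- `𝒱` is a vertex algebra structure on `V` with vacuum vector `Ω`, graded by `L₀`, such that
`L_n` and `W_n` are the modes of the fields of `L_{-2} Ω` and `W_{-3} Ω`. -/
structure VacuumRep.IsStructure {c : ℂ} {V : Type*} [AddCommGroup V] [Module ℂ V]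
    (R : VacuumRep c V) (𝒱 : VertexAlgebra V) : Prop where
  vac_eq : 𝒱.vac = R.Ω
  L0_eq : 𝒱.L0 = R.L 0
  Y_L : ∀ n, 𝒱.Y (R.L (-2) R.Ω) n = R.L (n - 1)
  Y_W : ∀ n, 𝒱.Y (R.W (-3) R.Ω) n = R.W (n - 2)

namespace VacuumRep

variable {c : ℂ} {V : Type*} [AddCommGroup V] [Module ℂ V] {R : VacuumRep c V}
  {𝒱 : VertexAlgebra V}

theorem IsStructure.L_eq (h : R.IsStructure 𝒱) (n : ℤ) :
    R.L n = 𝒱.Y (R.L (-2) R.Ω) (n + 1) := by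
  rw [h.Y_L, add_sub_cancel_right]

theorem IsStructure.W_eq (h : R.IsStructure 𝒱) (n : ℤ) :
    R.W n = 𝒱.Y (R.W (-3) R.Ω) (n + 2) := by
  rw [h.Y_W, add_sub_cancel_right]

theorem map_word {U : Type*} [AddCommGroup U] [Module ℂ U] (R' : VacuumRep c U) (f : V →ₗ[ℂ] U)
    (hΩ : f R.Ω = R'.Ω) (hL : ∀ n v, f (R.L n v) = R'.L n (f v))
    (hW : ∀ n v, f (R.W n v) = R'.W n (f v)) (l : List Gen) : f (R.word l) = R'.word l := by
  induction l with
  | nil => exact hΩ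
  | cons g l ih =>
    cases g with
    | L n => rw [word_L, word_L, hL, ih]
    | W n => rw [word_W, word_W, hW, ih]

/-- At `c = -2`, the free field realization induces a homomorphism from the Zhu algebra of the
vacuum module to polynomials in two variables, and it is injective on polynomials in the classes
of `L_{-2} Ω` and `W̃_{-3} Ω`. -/
theorem exists_map_mvPolynomial {R : VacuumRep (-2) V} (hR : R.Generated)
    (h : R.IsStructure 𝒱)
    (hf : ∀ R' : VacuumRep (-2) Heisenberg.Fock, ∃ f : V →ₗ[ℂ] Heisenberg.Fock,
      f R.Ω = R'.Ω ∧ (∀ n v, f (R.L n v) = R'.L n (f v)) ∧ ∀ n v, f (R.W n v) = R'.W n (f v)) :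
    ∃ Ψ : V →ₗ[ℂ] MvPolynomial (Fin 2) ℂ, Ψ R.Ω = 1 ∧
      (∀ a b, Ψ (𝒱.star a b) = Ψ a * Ψ b) ∧ (∀ a b, Ψ (𝒱.circ a b) = 0) ∧
      Function.Injective (MvPolynomial.aeval (R := ℂ)
        ![Ψ (R.L (-2) R.Ω), Ψ (rescale • R.W (-3) R.Ω)]) := by
  obtain ⟨𝓗, h0, hT, hL, hY⟩ := Heisenberg.exists_vertexAlgebra
  have hb := Heisenberg.isBosonVir hL hY
  obtain ⟨f, fΩ, fL, fW⟩ := hf hb.vacuumRep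
  have fvac : f 𝒱.vac = 𝓗.vac := by rw [h.vac_eq, fΩ]; rfl
  have fω : f (R.L (-2) R.Ω) = FreeField.conf 𝓗 (MvPolynomial.X (0, 0))
      (FreeField.vir 𝓗 (MvPolynomial.X (1, 0))) := by
    rw [fL, fΩ]; exact 𝓗.Y_apply_vac _
  have fw : f (R.W (-3) R.Ω) = rescale⁻¹ • FreeField.cub 𝓗 (MvPolynomial.X (0, 0))
      (FreeField.vir 𝓗 (MvPolynomial.X (1, 0))) := by
    rw [fW, fΩ]
    change rescale⁻¹ • 𝓗.Y _ (-3 + 2) 𝓗.vac = _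
    rw [show (-3 + 2 : ℤ) = -1 by norm_num, 𝓗.Y_apply_vac]
  have fw' : f (rescale • R.W (-3) R.Ω) = FreeField.cub 𝓗 (MvPolynomial.X (0, 0))
      (FreeField.vir 𝓗 (MvPolynomial.X (1, 0))) := by
    rw [map_smul, fw, smul_smul, mul_inv_cancel₀ rescale_ne_zero, one_smul]
  have mω : R.L (-2) R.Ω ∈ intertwined 𝒱 𝓗 f := fun n v => by
    rw [fω, h.Y_L, fL]
    change 𝓗.Y _ (n - 1 + 1) (f v) = _
    rw [sub_add_cancel]
  have mw : R.W (-3) R.Ω ∈ intertwined 𝒱 𝓗 f := fun n v => by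
    rw [fw, h.Y_W, fW, map_smul]
    change rescale⁻¹ • 𝓗.Y _ (n - 2 + 2) (f v) = _
    rw [sub_add_cancel]; rfl
  have htop : intertwined 𝒱 𝓗 f = ⊤ := by
    refine R.eq_top_of_creators hR (h.vac_eq ▸ vac_mem_intertwined fvac) ?_ ?_
    · intro n hn v hv
      rw [h.L_eq]; exact Y_neg_mem_intertwined fvac mω hv (by omega)
    · intro n hn v hv
      rw [h.W_eq]; exact Y_neg_mem_intertwined fvac mw hv (by omega)
  have hL0 : ∀ v, f (𝒱.L0 v) = 𝓗.L0 (f v) := by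
    intro v
    induction v using hR.induction with
    | hw l =>
      rw [h.L0_eq, L0_word, map_smul, R.map_word _ f fΩ fL fW]
      refine Eq.trans ?_ (hb.L0_word l).symm
      push_cast; rfl
    | zero => simp
    | add a b ha hb => simp only [map_add, ha, hb]
    | smul r a ha => simp only [map_smul, ha]
  refine ⟨Heisenberg.zeroMode.toLinearMap ∘ₗ f, ?_, fun a b => ?_, fun a b => ?_, ?_⟩
  · rw [LinearMap.comp_apply, ← h.vac_eq, fvac, h0]; exact map_one Heisenberg.zeroMode
  · rw [LinearMap.comp_apply, VertexAlgebra.star, map_zhuOp htop hL0]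
    exact (Heisenberg.zeroMode_zhuOp h0 hY hT hL _ _).1
  · rw [LinearMap.comp_apply, circ, map_zhuOp htop hL0]
    exact (Heisenberg.zeroMode_zhuOp h0 hY hT hL _ _).2
  · rw [LinearMap.comp_apply, LinearMap.comp_apply, fω, fw']
    exact Heisenberg.injective_aeval_zeroModes _ _ (Heisenberg.zeroMode_conf h0 hY)
      (Heisenberg.zeroMode_cub h0 hY hT hL)

end VacuumRep

end WThree

/-! ### The Zhu algebra of the vacuum module -/

namespace VertexAlgebra

variable {V : Type*} [AddCommGroup V] [Module ℂ V] (𝒱 : VertexAlgebra V)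

/-- The projection of `V` onto its homogeneous component of weight `N`. -/
noncomputable def homComponent (N : ℕ) : V →ₗ[ℂ] V :=
  (𝒱.grading N).subtype ∘ₗ DirectSum.component ℂ ℕ (fun n => 𝒱.grading n) N ∘ₗ
    𝒱.decomp.toLinearMap

theorem homComponent_of_mem {p : ℕ} {a : V} (ha : a ∈ 𝒱.grading p) (N : ℕ) :
    𝒱.homComponent N a = if p = N then a else 0 := by
  have h : 𝒱.decomp a = DirectSum.lof ℂ ℕ (fun n => 𝒱.grading n) p ⟨a, ha⟩ := by
    rw [decomp, LinearEquiv.symm_apply_eq]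
    simp [DirectSum.coeLinearMap_lof]
  rw [homComponent, LinearMap.comp_apply, LinearMap.comp_apply, LinearEquiv.coe_coe, h]
  split_ifs with hp
  · subst hp; rw [DirectSum.component.lof_self]; rfl
  · rw [DirectSum.component.of, dif_neg hp]; rfl

/-- The vectors of weight at most `N`. -/
def weightLE (N : ℕ) : Submodule ℂ V := Submodule.span ℂ {v | ∃ k ≤ N, v ∈ 𝒱.grading k}

theorem weightLE_mono {M N : ℕ} (h : M ≤ N) : 𝒱.weightLE M ≤ 𝒱.weightLE N :=
  Submodule.span_mono fun _ ⟨k, hk, hv⟩ => ⟨k, hk.trans h, hv⟩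

theorem exists_mem_weightLE (v : V) : ∃ N, v ∈ 𝒱.weightLE N := by
  refine 𝒱.grading_induction (P := fun v => ∃ N, v ∈ 𝒱.weightLE N)
    (fun n a ha => ⟨n, Submodule.subset_span ⟨n, le_rfl, ha⟩⟩) ⟨0, zero_mem _⟩ ?_ v
  rintro a b ⟨M, hM⟩ ⟨N, hN⟩
  exact ⟨max M N, add_mem (𝒱.weightLE_mono (le_max_left _ _) hM)
    (𝒱.weightLE_mono (le_max_right _ _) hN)⟩

theorem star_mem_weightLE {p N : ℕ} {a b : V} (ha : a ∈ 𝒱.grading p) (hb : b ∈ 𝒱.weightLE N) :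
    𝒱.star a b ∈ 𝒱.weightLE (p + N) := by
  rw [𝒱.star_of_mem ha]
  induction hb using Submodule.span_induction with
  | mem b hb =>
    obtain ⟨k, hk, hb⟩ := hb
    rw [residue_apply]
    refine Submodule.sum_mem _ fun j hj => Submodule.smul_mem _ _ (Submodule.subset_span
      ⟨p + k - j, by omega, 𝒱.Y_mem_grading ha hb ?_⟩)
    have := mem_range.mp hj
    omega
  | zero => rw [map_zero]; exact zero_mem _
  | add b b' _ _ h h' => rw [map_add]; exact add_mem h h'
  | smul c b _ h => rw [map_smul]; exact Submodule.smul_mem _ _ h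

end VertexAlgebra

namespace WThree

open VertexAlgebra

namespace VacuumRep

variable {c : ℂ} {V : Type*} [AddCommGroup V] [Module ℂ V] {R : VacuumRep c V}
  {𝒱 : VertexAlgebra V}

/-- The word `L_{-2}^i W_{-3}^j`. -/
def basicWord (i j : ℕ) : List Gen := List.replicate i (.L (-2)) ++ List.replicate j (.W (-3))

theorem degree_basicWord (i j : ℕ) : degree (basicWord i j) = -(2 * i + 3 * j) := by
  simp [basicWord, degree, Gen.index]; ring

variable (R)

theorem word_basicWord_succ (i j : ℕ) :
    R.word (basicWord (i + 1) j) = R.L (-2) (R.word (basicWord i j)) := rfl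

/-- The words that begin with `L_n`, `n ≤ -3`, or `W_n`, `n ≤ -4`. -/
inductive IsDeep : List Gen → Prop
  | L (n : ℤ) (hn : n ≤ -3) (l : List Gen) : IsDeep (.L n :: l)
  | W (n : ℤ) (hn : n ≤ -4) (l : List Gen) : IsDeep (.W n :: l)

/-- The span of the vectors `L_n v`, `n ≤ -3`, and `W_n v`, `n ≤ -4`; modulo `O(V)`, these reduce
to vectors of lower weight. -/
noncomputable def deep : Submodule ℂ V := Submodule.span ℂ (R.word '' {l | IsDeep l})

variable {R}

theorem L_mem_deep (hR : R.Generated) {n : ℤ} (hn : n ≤ -3) (v : V) : R.L n v ∈ R.deep := by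
  induction v using hR.induction with
  | hw l => exact Submodule.subset_span ⟨_, IsDeep.L n hn l, rfl⟩
  | zero => rw [map_zero]; exact zero_mem _
  | add a b ha hb => rw [map_add]; exact add_mem ha hb
  | smul r a ha => rw [map_smul]; exact Submodule.smul_mem _ _ ha

theorem W_mem_deep (hR : R.Generated) {n : ℤ} (hn : n ≤ -4) (v : V) : R.W n v ∈ R.deep := by
  induction v using hR.induction with
  | hw l => exact Submodule.subset_span ⟨_, IsDeep.W n hn l, rfl⟩
  | zero => rw [map_zero]; exact zero_mem _
  | add a b ha hb => rw [map_add]; exact add_mem ha hb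
  | smul r a ha => rw [map_smul]; exact Submodule.smul_mem _ _ ha

theorem L_two_mem_deep (hR : R.Generated) {v : V} (hv : v ∈ R.deep) :
    R.L (-2) v ∈ R.deep := by
  induction hv using Submodule.span_induction with
  | mem v hv =>
    obtain ⟨l, hl, rfl⟩ := hv
    cases hl with
    | L n hn l =>
      rw [word_L, R.LL, if_neg (by omega), zero_smul, add_zero]
      exact add_mem (L_mem_deep hR hn _) (Submodule.smul_mem _ _ (L_mem_deep hR (by omega) _))
    | W n hn l =>
      rw [word_W, R.LW]
      exact add_mem (W_mem_deep hR hn _) (Submodule.smul_mem _ _ (W_mem_deep hR (by omega) _))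
  | zero => rw [map_zero]; exact zero_mem _
  | add a b _ _ ha hb => rw [map_add]; exact add_mem ha hb
  | smul r a _ ha => rw [map_smul]; exact Submodule.smul_mem _ _ ha

theorem lambdaOf_mem_deep (hR : R.Generated) {K m : ℤ} (hm : m ≤ -7) (v : V) :
    lambdaOf R.L K m v ∈ R.deep := by
  refine sub_mem (add_mem (sum_mem fun n hn => ?_) (sum_mem fun n hn => ?_))
    (Submodule.smul_mem _ _ (L_mem_deep hR (by omega) _))
  · rw [mem_Icc] at hn
    rcases hn.2.eq_or_lt with rfl | h
    · exact L_two_mem_deep hR (L_mem_deep hR (by omega) _)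
    · exact L_mem_deep hR (by omega) _
  · rw [mem_Icc] at hn
    exact L_mem_deep hR (by omega) _

theorem W_three_mem_deep (hR : R.Generated) {v : V} (hv : v ∈ R.deep) :
    R.W (-3) v ∈ R.deep := by
  induction hv using Submodule.span_induction with
  | mem v hv =>
    obtain ⟨l, hl, rfl⟩ := hv
    cases hl with
    | L n hn l =>
      rw [word_L, ← sub_eq_of_eq_add (R.LW n (-3) (R.word l))]
      exact sub_mem (L_mem_deep hR hn _) (Submodule.smul_mem _ _ (W_mem_deep hR (by omega) _))
    | W n hn l =>
      rw [word_W, R.WW_word _ _ _ _ le_rfl, if_neg (by omega), zero_smul, add_zero]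
      exact add_mem (W_mem_deep hR hn _) (add_mem
        (Submodule.smul_mem _ _ (L_mem_deep hR (by omega) _))
        (Submodule.smul_mem _ _ (lambdaOf_mem_deep hR (by omega) _)))
  | zero => rw [map_zero]; exact zero_mem _
  | add a b _ _ ha hb => rw [map_add]; exact add_mem ha hb
  | smul r a _ ha => rw [map_smul]; exact Submodule.smul_mem _ _ ha

/-- Reordering a word in `L_n`, `n ≤ -2`, and `W_n`, `n ≤ -3`, creates deep terms only. -/
theorem span_basic_sup_deep (hR : R.Generated) :
    Submodule.span ℂ (Set.range fun p : ℕ × ℕ => R.word (basicWord p.1 p.2)) ⊔ R.deep = ⊤ := by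
  set S := Submodule.span ℂ (Set.range fun p : ℕ × ℕ => R.word (basicWord p.1 p.2)) ⊔ R.deep
  have hb : ∀ i j, R.word (basicWord i j) ∈ S := fun i j =>
    Submodule.mem_sup_left (Submodule.subset_span ⟨(i, j), rfl⟩)
  have hd : R.deep ≤ S := le_sup_right
  have hL : ∀ v ∈ S, R.L (-2) v ∈ S := by
    intro v hv
    obtain ⟨x, hx, y, hy, rfl⟩ := Submodule.mem_sup.mp hv
    rw [map_add]
    refine add_mem ?_ (hd (L_two_mem_deep hR hy))
    induction hx using Submodule.span_induction with
    | mem x hx => obtain ⟨p, rfl⟩ := hx; exact hb (p.1 + 1) p.2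
    | zero => rw [map_zero]; exact zero_mem _
    | add a b ha' hb' ha hb =>
      rw [map_add]
      exact add_mem (ha (Submodule.add_mem_sup ha' hy)) (hb (Submodule.add_mem_sup hb' hy))
    | smul r a ha' ha =>
      rw [map_smul]; exact Submodule.smul_mem _ _ (ha (Submodule.add_mem_sup ha' hy))
  have hWb : ∀ i j, R.W (-3) (R.word (basicWord i j)) ∈ S := by
    intro i j
    induction i with
    | zero => exact hb 0 (j + 1)
    | succ i ih =>
      rw [word_basicWord_succ, ← sub_eq_of_eq_add (R.LW (-2) (-3) (R.word (basicWord i j)))]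
      exact sub_mem (hL _ ih) (Submodule.smul_mem _ _ (hd (W_mem_deep hR (by omega) _)))
  refine R.eq_top_of_creators hR (hb 0 0) ?_ ?_
  · intro n hn v hv
    rcases hn.eq_or_lt with rfl | hn
    · exact hL v hv
    · exact hd (L_mem_deep hR (by omega) v)
  · intro n hn v hv
    rcases hn.eq_or_lt with rfl | hn
    · obtain ⟨x, hx, y, hy, rfl⟩ := Submodule.mem_sup.mp hv
      rw [map_add]
      refine add_mem ?_ (hd (W_three_mem_deep hR hy))
      clear hv
      induction hx using Submodule.span_induction with
      | mem x hx => obtain ⟨p, rfl⟩ := hx; exact hWb p.1 p.2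
      | zero => rw [map_zero]; exact zero_mem _
      | add a b _ _ ha hb => rw [map_add]; exact add_mem ha hb
      | smul r a _ ha => rw [map_smul]; exact Submodule.smul_mem _ _ ha
    · exact hd (W_mem_deep hR (by omega) v)

theorem IsStructure.word_mem (h : R.IsStructure 𝒱) {l : List Gen} {N : ℕ}
    (hN : degree l = -N) : R.word l ∈ 𝒱.grading N := by
  rw [mem_grading_iff, h.L0_eq, L0_word, hN]; simp

theorem IsStructure.omega_mem (h : R.IsStructure 𝒱) : R.L (-2) R.Ω ∈ 𝒱.grading 2 :=
  h.word_mem (l := [.L (-2)]) rfl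

theorem IsStructure.w_mem (h : R.IsStructure 𝒱) : R.W (-3) R.Ω ∈ 𝒱.grading 3 :=
  h.word_mem (l := [.W (-3)]) rfl

/-- The relation `Res_z z^(-2-i) (z + 1)² Y(ω, z) b ∈ O(V)`. -/
theorem IsStructure.L_rel_mem_O (h : R.IsStructure 𝒱) (i : ℕ) (b : V) :
    R.L (-3 - i) b + (2 : ℂ) • R.L (-2 - i) b + R.L (-1 - i) b ∈ 𝒱.O := by
  have := 𝒱.residue_mem_O h.omega_mem b i
  rw [residue_apply] at this
  simp only [sum_range_succ, sum_range_zero, h.Y_L] at this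
  norm_num at this
  rwa [show (-(i : ℤ) + -2 - 1) = -3 - i by ring, show (-(i : ℤ) + -2) = -2 - i by ring,
    show (-(i : ℤ) - 1) = -1 - i by ring] at this

/-- The relation `Res_z z^(-2-i) (z + 1)³ Y(w, z) b ∈ O(V)`. -/
theorem IsStructure.W_rel_mem_O (h : R.IsStructure 𝒱) (i : ℕ) (b : V) :
    R.W (-4 - i) b + (3 : ℂ) • R.W (-3 - i) b + (3 : ℂ) • R.W (-2 - i) b
      + R.W (-1 - i) b ∈ 𝒱.O := by
  have := 𝒱.residue_mem_O h.w_mem b i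
  rw [residue_apply] at this
  simp only [sum_range_succ, sum_range_zero, h.Y_W] at this
  norm_num [Nat.choose] at this
  rwa [show (-(i : ℤ) + -2 - 2) = -4 - i by ring, show (1 - (2 + (i : ℤ)) - 2) = -3 - i by ring,
    show (-(i : ℤ) - 2) = -2 - i by ring,
    show (3 - (2 + (i : ℤ)) - 2) = -1 - i by ring] at this

/-- Modulo `O(V)`, vectors of weight `N` are combinations of the `L_{-2}^i W_{-3}^j Ω` with
`2 i + 3 j ≤ N`. -/
theorem IsStructure.grading_le (h : R.IsStructure 𝒱) (hR : R.Generated) (N : ℕ) :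
    𝒱.grading N ≤ Submodule.span ℂ ((fun p : ℕ × ℕ => R.word (basicWord p.1 p.2)) ''
      {p | 2 * p.1 + 3 * p.2 ≤ N}) ⊔ 𝒱.O := by
  induction N using Nat.strong_induction_on with
  | _ N ih =>
  set D : ℕ → Submodule ℂ V := fun N => Submodule.span ℂ
    ((fun p : ℕ × ℕ => R.word (basicWord p.1 p.2)) '' {p | 2 * p.1 + 3 * p.2 ≤ N}) ⊔ 𝒱.O
  have hD : ∀ M ≤ N, D M ≤ D N := fun M hM => sup_le_sup_right
    (Submodule.span_mono (Set.image_mono fun p (hp : _ ≤ M) => hp.trans hM)) _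
  have hlow : ∀ l, -degree l < N → R.word l ∈ D N := by
    intro l hl
    rcases lt_or_ge 0 (degree l) with h0 | h0
    · rw [word, R.word_eq_zero l h0]; exact zero_mem _
    · exact hD (-degree l).toNat (by omega)
        (ih (-degree l).toNat (by omega) (h.word_mem (by omega)))
  have hgen : ∀ l, (∃ p : ℕ × ℕ, l = basicWord p.1 p.2) ∨ IsDeep l →
      𝒱.homComponent N (R.word l) ∈ D N := by
    intro l hl
    rcases lt_or_ge 0 (degree l) with h0 | h0
    · rw [word, R.word_eq_zero l h0, map_zero]; exact zero_mem _
    rw [𝒱.homComponent_of_mem (h.word_mem (N := (-degree l).toNat) (by omega))]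
    split_ifs with hN
    swap; · exact zero_mem _
    rcases hl with ⟨p, rfl⟩ | hl
    · refine Submodule.mem_sup_left (Submodule.subset_span ⟨p, ?_, rfl⟩)
      rw [degree_basicWord] at hN
      change 2 * p.1 + 3 * p.2 ≤ N
      omega
    · cases hl with
      | L n hn l =>
        rw [degree_cons] at hN h0
        simp only [Gen.index] at hN h0
        obtain ⟨i, rfl⟩ : ∃ i : ℕ, n = -3 - i := ⟨(-3 - n).toNat, by omega⟩
        have h1 : R.L (-3 - i) (R.word l) + (2 : ℂ) • R.L (-2 - i) (R.word l)
            + R.L (-1 - i) (R.word l) ∈ D N := Submodule.mem_sup_right (h.L_rel_mem_O i _)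
        have h2 : R.L (-2 - i) (R.word l) ∈ D N := hlow (.L (-2 - i) :: l) (by
          rw [degree_cons]; simp only [Gen.index]; omega)
        have h3 : R.L (-1 - i) (R.word l) ∈ D N := hlow (.L (-1 - i) :: l) (by
          rw [degree_cons]; simp only [Gen.index]; omega)
        exact (Submodule.add_mem_iff_left _ (Submodule.smul_mem _ _ h2)).mp
          ((Submodule.add_mem_iff_left _ h3).mp h1)
      | W n hn l =>
        rw [degree_cons] at hN h0
        simp only [Gen.index] at hN h0
        obtain ⟨i, rfl⟩ : ∃ i : ℕ, n = -4 - i := ⟨(-4 - n).toNat, by omega⟩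
        have h1 : R.W (-4 - i) (R.word l) + (3 : ℂ) • R.W (-3 - i) (R.word l)
            + (3 : ℂ) • R.W (-2 - i) (R.word l) + R.W (-1 - i) (R.word l) ∈ D N :=
          Submodule.mem_sup_right (h.W_rel_mem_O i _)
        have h2 : R.W (-3 - i) (R.word l) ∈ D N := hlow (.W (-3 - i) :: l) (by
          rw [degree_cons]; simp only [Gen.index]; omega)
        have h3 : R.W (-2 - i) (R.word l) ∈ D N := hlow (.W (-2 - i) :: l) (by
          rw [degree_cons]; simp only [Gen.index]; omega)
        have h4 : R.W (-1 - i) (R.word l) ∈ D N := hlow (.W (-1 - i) :: l) (by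
          rw [degree_cons]; simp only [Gen.index]; omega)
        exact (Submodule.add_mem_iff_left _ (Submodule.smul_mem _ _ h2)).mp
          ((Submodule.add_mem_iff_left _ (Submodule.smul_mem _ _ h3)).mp
            ((Submodule.add_mem_iff_left _ h4).mp h1))
  intro v hv
  have htop : (⊤ : Submodule ℂ V) ≤ (D N).comap (𝒱.homComponent N) := by
    rw [← span_basic_sup_deep hR]
    refine sup_le (Submodule.span_le.mpr ?_) (Submodule.span_le.mpr ?_)
    · rintro _ ⟨p, rfl⟩; exact hgen _ (Or.inl ⟨p, rfl⟩)
    · rintro _ ⟨l, hl, rfl⟩; exact hgen _ (Or.inr hl)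
  have := htop (Submodule.mem_top (x := v))
  rwa [Submodule.mem_comap, 𝒱.homComponent_of_mem hv, if_pos rfl] at this

/-- If polynomials in the classes of `L_{-2} Ω` and `w = λ W_{-3} Ω` are independent in the Zhu
algebra, then it is a polynomial ring in these classes: by `grading_le`, in each filtration
degree there are no more classes than such polynomials. -/
theorem IsStructure.exists_iso (h : R.IsStructure 𝒱) (hR : R.Generated) {r : ℂ}
    {B : Type*} [CommRing B] [Algebra ℂ B] {Ψ : V →ₗ[ℂ] B} (hΩ : Ψ R.Ω = 1)
    (hs : ∀ a b, Ψ (𝒱.star a b) = Ψ a * Ψ b) (hO : ∀ a b, Ψ (𝒱.circ a b) = 0)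
    (hinj : Function.Injective (MvPolynomial.aeval (R := ℂ)
        ![Ψ (R.L (-2) R.Ω), Ψ (r • R.W (-3) R.Ω)])) :
    ∃ σ : 𝒱.ZhuAlgebra ≃ₗ[ℂ] MvPolynomial (Fin 2) ℂ, 𝒱.IsZhuAlgebraIso σ ∧
      σ (𝒱.zhuClass (R.L (-2) R.Ω)) = MvPolynomial.X 0 ∧
      σ (𝒱.zhuClass (r • R.W (-3) R.Ω)) = MvPolynomial.X 1 := by
  set ω := R.L (-2) R.Ω
  set w := r • R.W (-3) R.Ω
  have hω : ω ∈ 𝒱.grading 2 := h.omega_mem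
  have hw : w ∈ 𝒱.grading 3 := Submodule.smul_mem _ _ h.w_mem
  set θ := MvPolynomial.aeval (R := ℂ) ![Ψ ω, Ψ w]
  -- representatives of the products `[ω]^i [w]^j`
  let e : ℕ × ℕ → V := fun p => (𝒱.star ω)^[p.1] ((𝒱.star w)^[p.2] R.Ω)
  have he : ∀ p N, 2 * p.1 + 3 * p.2 ≤ N → e p ∈ 𝒱.weightLE N := by
    have h1 : ∀ j, (𝒱.star w)^[j] R.Ω ∈ 𝒱.weightLE (3 * j) := fun j => by
      induction j with
      | zero => exact Submodule.subset_span ⟨0, le_rfl, h.vac_eq ▸ 𝒱.vac_mem_grading⟩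
      | succ j ih =>
        rw [Function.iterate_succ_apply', show 3 * (j + 1) = 3 + 3 * j by ring]
        exact 𝒱.star_mem_weightLE hw ih
    have h2 : ∀ i j, e (i, j) ∈ 𝒱.weightLE (2 * i + 3 * j) := fun i j => by
      induction i with
      | zero => rw [mul_zero, zero_add]; exact h1 j
      | succ i ih =>
        simp only [e]
        rw [Function.iterate_succ_apply', show 2 * (i + 1) + 3 * j = 2 + (2 * i + 3 * j) by ring]
        exact 𝒱.star_mem_weightLE hω ih
    exact fun p N hp => 𝒱.weightLE_mono hp (h2 p.1 p.2)
  have hΨe : ∀ p, Ψ (e p) = Ψ ω ^ p.1 * Ψ w ^ p.2 := by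
    rintro ⟨i, j⟩
    simp only [e]
    induction i with
    | zero =>
      induction j with
      | zero => simp [hΩ]
      | succ j ih =>
        rw [Function.iterate_zero_apply] at ih ⊢
        rw [Function.iterate_succ_apply', hs, ih]; ring
    | succ i ih => rw [Function.iterate_succ_apply', hs, ih]; ring
  have hker : 𝒱.O ≤ LinearMap.ker Ψ := by
    refine Submodule.span_le.mpr ?_
    rintro _ ⟨a, b, rfl⟩
    exact hO a b
  let E : MvPolynomial (Fin 2) ℂ →ₗ[ℂ] 𝒱.ZhuAlgebra :=
    (MvPolynomial.basisMonomials (Fin 2) ℂ).constr ℂ fun s => 𝒱.O.mkQ (e (s 0, s 1))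
  have hE : ∀ s, E (MvPolynomial.monomial s 1) = 𝒱.O.mkQ (e (s 0, s 1)) := fun s => by
    have := (MvPolynomial.basisMonomials (Fin 2) ℂ).constr_basis ℂ
      (fun s => 𝒱.O.mkQ (e (s 0, s 1))) s
    rwa [MvPolynomial.coe_basisMonomials] at this
  have hθ : ∀ p, 𝒱.O.liftQ Ψ hker (E p) = θ p := by
    have : 𝒱.O.liftQ Ψ hker ∘ₗ E = θ.toLinearMap := by
      refine (MvPolynomial.basisMonomials (Fin 2) ℂ).ext fun s => ?_
      rw [MvPolynomial.coe_basisMonomials, LinearMap.comp_apply, hE, Submodule.mkQ_apply,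
        Submodule.liftQ_apply, hΨe, AlgHom.toLinearMap_apply, MvPolynomial.aeval_monomial,
        Finsupp.prod_fintype _ _ (by simp)]
      simp
    exact fun p => LinearMap.congr_fun this p
  have hEinj : Function.Injective E := fun p q hpq => hinj (by
    rw [← hθ, ← hθ, hpq])
  have hEsurj : Function.Surjective E := by
    intro x
    obtain ⟨v, rfl⟩ := Submodule.mkQ_surjective _ x
    obtain ⟨N, hN⟩ := 𝒱.exists_mem_weightLE v
    let s : Finset (ℕ × ℕ) := {p ∈ range (N + 1) ×ˢ range (N + 1) | 2 * p.1 + 3 * p.2 ≤ N}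
    have hs : ∀ p, p ∈ s ↔ 2 * p.1 + 3 * p.2 ≤ N := fun p => by
      simp only [s, mem_filter, mem_product, mem_range]; omega
    let fe : s → 𝒱.ZhuAlgebra := fun p => 𝒱.O.mkQ (e p)
    let fu : s → 𝒱.ZhuAlgebra := fun p => 𝒱.O.mkQ (R.word (basicWord p.1.1 p.1.2))
    have hle : (𝒱.weightLE N).map 𝒱.O.mkQ ≤ Submodule.span ℂ (Set.range fu) := by
      rw [weightLE, Submodule.map_span, Submodule.span_le]
      rintro _ ⟨v, ⟨k, hk, hv⟩, rfl⟩
      obtain ⟨y, hy, z, hz, rfl⟩ := Submodule.mem_sup.mp (h.grading_le hR k hv)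
      have hz0 : 𝒱.O.mkQ z = 0 := (Submodule.Quotient.mk_eq_zero _).mpr hz
      rw [SetLike.mem_coe, map_add, hz0, add_zero]
      refine (Submodule.span_le.mpr ?_ : _ ≤ (Submodule.span ℂ (Set.range fu)).comap 𝒱.O.mkQ) hy
      rintro _ ⟨p, hp, rfl⟩
      exact Submodule.subset_span ⟨⟨p, (hs p).mpr (le_trans hp hk)⟩, rfl⟩
    let g : s → Fin 2 →₀ ℕ := fun p => Finsupp.single 0 p.1.1 + Finsupp.single 1 p.1.2
    have hg0 : ∀ p, g p 0 = p.1.1 := fun p => by simp [g]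
    have hg1 : ∀ p, g p 1 = p.1.2 := fun p => by simp [g]
    have hEg : ∀ p, E (MvPolynomial.monomial (g p) 1) = fe p := fun p => by
      rw [hE, hg0, hg1]
    have hind : LinearIndependent ℂ fe := by
      have h1 := ((MvPolynomial.basisMonomials (Fin 2) ℂ).linearIndependent.comp g
        fun p q hpq => Subtype.ext (Prod.ext (by rw [← hg0, ← hg0, hpq])
          (by rw [← hg1, ← hg1, hpq]))).map' E (LinearMap.ker_eq_bot.mpr hEinj)
      rwa [show ⇑E ∘ ⇑(MvPolynomial.basisMonomials (Fin 2) ℂ) ∘ g = fe from funext fun p => by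
        rw [← hEg]; simp] at h1
    have hfe : Submodule.span ℂ (Set.range fe) ≤ Submodule.span ℂ (Set.range fu) := by
      refine Submodule.span_le.mpr ?_
      rintro _ ⟨p, rfl⟩
      exact hle (Submodule.mem_map_of_mem (he p N ((hs _).mp p.2)))
    -- `fe` and `fu` have the same index set, and `fe` is independent
    have heq : Submodule.span ℂ (Set.range fe) = Submodule.span ℂ (Set.range fu) := by
      have := FiniteDimensional.span_of_finite ℂ (Set.finite_range fu)
      refine Submodule.eq_of_le_of_finrank_le hfe ?_
      rw [finrank_span_eq_card hind]
      exact finrank_range_le_card fu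
    have hv : 𝒱.O.mkQ v ∈ Submodule.span ℂ (Set.range fe) :=
      heq ▸ hle (Submodule.mem_map_of_mem hN)
    refine (Submodule.span_le.mpr ?_ : _ ≤ LinearMap.range E) hv
    rintro _ ⟨p, rfl⟩
    exact ⟨_, hEg p⟩
  let σ := (LinearEquiv.ofBijective E ⟨hEinj, hEsurj⟩).symm
  have hσ : ∀ v, θ (σ (𝒱.zhuClass v)) = Ψ v := fun v => by
    have h1 : E (σ (𝒱.zhuClass v)) = 𝒱.zhuClass v :=
      (LinearEquiv.ofBijective E ⟨hEinj, hEsurj⟩).apply_symm_apply _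
    rw [← hθ, h1]; rfl
  refine ⟨σ, ⟨fun a b => hinj ?_, hinj ?_⟩, hinj ?_, hinj ?_⟩
  · rw [map_mul, hσ, hσ, hσ, hs]
  · rw [hσ, h.vac_eq, hΩ, map_one]
  · rw [hσ, MvPolynomial.aeval_X]; rfl
  · rw [hσ, MvPolynomial.aeval_X]; rfl

end VacuumRep

end WThree

/-! ### The classes of the vectors `v_s` and `v_s'` -/

namespace WThree

open VertexAlgebra

namespace VacuumRep

section Classes

variable {V : Type*} [AddCommGroup V] [Module ℂ V] {𝒱 : VertexAlgebra V}

theorem IsStructure.T_eq {c : ℂ} {R : VacuumRep c V} (h : R.IsStructure 𝒱) (hR : R.Generated)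
    (v : V) : 𝒱.T v = R.L (-1) v := by
  induction v using hR.induction with
  | hw l =>
    induction l with
    | nil => rw [word_nil, ← h.vac_eq, 𝒱.T_vac, h.vac_eq, R.L_vac _ le_rfl]
    | cons g l ih =>
      cases g with
      | L n =>
        have e := 𝒱.T_Y_apply (R.L (-2) R.Ω) (n + 1) (R.word l)
        rw [add_sub_cancel_right, ← h.L_eq, h.Y_L] at e
        rw [word_L, R.LL, ← ih, e, show -1 + n = n - 1 by ring]
        split_ifs <;> push_cast <;> module
      | W n =>
        have e := 𝒱.T_Y_apply (R.W (-3) R.Ω) (n + 2) (R.word l)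
        rw [← h.W_eq, h.Y_W, show n + 2 - 1 - 2 = n - 1 by ring] at e
        rw [word_W, R.LW, ← ih, e, show -1 + n = n - 1 by ring]
        push_cast; module
  | zero => simp
  | add a b ha hb => simp only [map_add, ha, hb]
  | smul r a ha => simp only [map_smul, ha]

variable {R : VacuumRep (-2) V} {B : Type*} [CommRing B] [Algebra ℂ B]
  {φ : V →ₗ[ℂ] B}

theorem IsStructure.map_L_neg_one (h : R.IsStructure 𝒱) (hR : R.Generated)
    (hO : ∀ v ∈ 𝒱.O, φ v = 0) (b : V) : φ (R.L (-1) b) = -φ (R.L 0 b) := by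
  have := hO _ (𝒱.T_add_L0_mem_O b)
  rwa [h.T_eq hR, h.L0_eq, map_add, add_eq_zero_iff_eq_neg] at this

theorem IsStructure.map_L_neg_two (h : R.IsStructure 𝒱) (hR : R.Generated)
    (hO : ∀ v ∈ 𝒱.O, φ v = 0) (hs : ∀ a b, φ (𝒱.star a b) = φ a * φ b) (b : V) :
    φ (R.L (-2) b) = φ (R.L (-2) R.Ω) * φ b + φ (R.L 0 b) := by
  have h1 := hs (R.L (-2) R.Ω) b
  rw [𝒱.star_of_mem h.omega_mem, residue_apply] at h1
  simp only [sum_range_succ, sum_range_zero, h.Y_L] at h1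
  norm_num at h1
  rw [h.map_L_neg_one hR hO] at h1
  rw [← h1, two_smul]; abel

/-- The class of `L_{-1-i} b` modulo `O(V)`, by recursion from the relations
`L_{-3-i} b + 2 L_{-2-i} b + L_{-1-i} b ∈ O(V)`. -/
theorem IsStructure.map_L_neg (h : R.IsStructure 𝒱) (hR : R.Generated)
    (hO : ∀ v ∈ 𝒱.O, φ v = 0) (hs : ∀ a b, φ (𝒱.star a b) = φ a * φ b) (i : ℕ) (b : V) :
    φ (R.L (-1 - i) b) = (-1) ^ (i + 1) * (i * (φ (R.L (-2) R.Ω) * φ b) + φ (R.L 0 b)) := by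
  induction i using Nat.twoStepInduction with
  | zero => simpa using h.map_L_neg_one hR hO b
  | one =>
    rw [show (-1 - ((1 : ℕ) : ℤ)) = -2 by norm_num, h.map_L_neg_two hR hO hs]
    push_cast; ring
  | more i h1 h2 =>
    have := hO _ (h.L_rel_mem_O i b)
    rw [map_add, map_add, map_smul, two_smul, show (-2 - (i : ℤ)) = -1 - ((i + 1 : ℕ) : ℤ) by
      push_cast; ring, h1, h2, show (-3 - (i : ℤ)) = -1 - ((i + 2 : ℕ) : ℤ) by
      push_cast; ring] at this
    push_cast at this ⊢
    rw [add_assoc, add_eq_zero_iff_eq_neg] at this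
    rw [this]
    ring

theorem IsStructure.map_L_neg_of_mem (h : R.IsStructure 𝒱) (hR : R.Generated)
    (hO : ∀ v ∈ 𝒱.O, φ v = 0) (hs : ∀ a b, φ (𝒱.star a b) = φ a * φ b) (i : ℕ) {b : V} {N : ℕ}
    (hb : b ∈ 𝒱.grading N) : φ (R.L (-1 - i) b) =
      (-1) ^ (i + 1) * (i * φ (R.L (-2) R.Ω) + N) * φ b := by
  rw [h.map_L_neg hR hO hs, ← h.L0_eq, 𝒱.L0_apply N b hb, map_smul, Nat.cast_smul_eq_nsmul,
    nsmul_eq_mul]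
  ring

theorem IsStructure.lambdaOf_vac (h : R.IsStructure 𝒱) (m : ℤ) : lambdaOf R.L |m| m R.Ω =
    𝒱.Y (R.L (-2) (R.L (-2) R.Ω)) (m + 3) R.Ω
      - (3 / 10 * ((m : ℂ) + 2) * ((m : ℂ) + 3)) • R.L m R.Ω := by
  have h0 := neg_abs_le m
  have h1 := abs_nonneg m
  have := 𝒱.lambdaOf_eq (R.L (-2) R.Ω) (K := |m|) (v := R.Ω) (le_refl |m|)
    (fun k hk => by rw [← h.L_eq, R.L_vac _ (by omega)])
    (fun k hk => by rw [← h.L_eq, R.L_vac _ (by omega)])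
  rw [← h.L_eq, h.Y_L (-1), show (-1 - 1 : ℤ) = -2 by norm_num] at this
  rw [← this]
  congr 1
  funext n
  exact h.L_eq n

/-- Here `φ` is the quotient map to the Zhu algebra followed by a homomorphism to a commutative
ring. The class of `W_{-3}² Ω` is read off from `w * w`, in which the lower terms `W_n W_{-3} Ω`,
`-2 ≤ n ≤ 0`, are commutators. -/
theorem IsStructure.map_vs (h : R.IsStructure 𝒱) (hR : R.Generated)
    (hO : ∀ v ∈ 𝒱.O, φ v = 0) (hs : ∀ a b, φ (𝒱.star a b) = φ a * φ b) (hΩ : φ R.Ω = 1)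
    {t w : B} (ht : φ (R.L (-2) R.Ω) = t) (hw : φ (rescale • R.W (-3) R.Ω) = w) :
    φ ((3 / 2 : ℂ) • R.W (-3) (R.W (-3) R.Ω) - (19 / 36 : ℂ) • R.L (-3) (R.L (-3) R.Ω)
      - (8 / 9 : ℂ) • R.L (-2) (R.L (-2) (R.L (-2) R.Ω)) - (14 / 9 : ℂ) • R.L (-2) (R.L (-4) R.Ω)
      + (44 / 9 : ℂ) • R.L (-6) R.Ω) = w ^ 2 - (1 / 9 : ℂ) • (t ^ 2 * (8 * t + 1)) := by
  have k := fun (i : ℕ) (l : List Gen) (N : ℕ) (hN : degree l = -N) =>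
    h.map_L_neg_of_mem hR hO hs i (h.word_mem hN)
  have l3 : φ (R.L (-3) R.Ω) = -2 * t := by
    refine (k 2 [] 0 rfl).trans ?_
    rw [word_nil, hΩ, ht]; push_cast; ring
  have l4 : φ (R.L (-4) R.Ω) = 3 * t := by
    refine (k 3 [] 0 rfl).trans ?_
    rw [word_nil, hΩ, ht]; push_cast; ring
  have l5 : φ (R.L (-5) R.Ω) = -4 * t := by
    refine (k 4 [] 0 rfl).trans ?_
    rw [word_nil, hΩ, ht]; push_cast; ring
  have l6 : φ (R.L (-6) R.Ω) = 5 * t := by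
    refine (k 5 [] 0 rfl).trans ?_
    rw [word_nil, hΩ, ht]; push_cast; ring
  have l22 : φ (R.L (-2) (R.L (-2) R.Ω)) = (t + 2) * t := by
    refine (k 1 [.L (-2)] 2 rfl).trans ?_
    rw [word_L, word_nil, ht]; push_cast; ring
  have l222 : φ (R.L (-2) (R.L (-2) (R.L (-2) R.Ω))) = (t + 4) * ((t + 2) * t) := by
    refine (k 1 [.L (-2), .L (-2)] 4 rfl).trans ?_
    rw [word_L, word_L, word_nil, l22, ht]; push_cast; ring
  have l33 : φ (R.L (-3) (R.L (-3) R.Ω)) = (2 * t + 3) * (2 * t) := by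
    refine (k 2 [.L (-3)] 3 rfl).trans ?_
    rw [word_L, word_nil, l3, ht]; push_cast; ring
  have l24 : φ (R.L (-2) (R.L (-4) R.Ω)) = (t + 4) * (3 * t) := by
    refine (k 1 [.L (-4)] 4 rfl).trans ?_
    rw [word_L, word_nil, l4, ht]; push_cast; ring
  have hx : R.L (-2) (R.L (-2) R.Ω) ∈ 𝒱.grading 4 := h.word_mem (l := [.L (-2), .L (-2)]) rfl
  have Tx : φ (𝒱.T (R.L (-2) (R.L (-2) R.Ω))) = -4 * ((t + 2) * t) := by
    rw [h.T_eq hR, h.map_L_neg_one hR hO, ← h.L0_eq, 𝒱.L0_apply 4 _ hx, map_smul,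
      Nat.cast_smul_eq_nsmul, nsmul_eq_mul, l22]
    push_cast; ring
  have w5 : φ (R.W (-2) (R.W (-3) R.Ω)) = (2 / 5 : ℂ) • (-4 * t)
      + (4 / 3 : ℂ) • (-4 * ((t + 2) * t) - (9 / 5 : ℂ) • (-4 * t)) := by
    have := R.WW_word (-2) (-3) |-2 + -3| [] (by simp [degree])
    rw [word_nil, h.lambdaOf_vac, R.W_vac (-2) le_rfl] at this
    rw [this]
    norm_num [coeffL, ← h.vac_eq, 𝒱.Y_neg_two_vac]
    rw [h.vac_eq, Tx, l5]
    norm_num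
  have w4 : φ (R.W (-1) (R.W (-3) R.Ω)) = (3 / 5 : ℂ) • (3 * t)
      + (8 / 3 : ℂ) • ((t + 2) * t - (3 / 5 : ℂ) • (3 * t)) := by
    have := R.WW_word (-1) (-3) |-1 + -3| [] (by simp [degree])
    rw [word_nil, h.lambdaOf_vac, R.W_vac (-1) (by norm_num)] at this
    rw [this]
    norm_num [coeffL, ← h.vac_eq, 𝒱.Y_apply_vac]
    rw [h.vac_eq, l22, l4]
  have w3 : φ (R.W 0 (R.W (-3) R.Ω)) = -2 * t := by
    have := R.WW_word 0 (-3) |0 + -3| [] (by simp [degree])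
    rw [word_nil, h.lambdaOf_vac, R.W_vac 0 (by norm_num)] at this
    rw [this]
    norm_num [coeffL, ← h.vac_eq, 𝒱.Y_apply_vac_of_nonneg]
    rw [h.vac_eq, l3]; ring
  have hww : (3 / 2 : ℂ) • φ (𝒱.star (R.W (-3) R.Ω) (R.W (-3) R.Ω)) = w ^ 2 := by
    rw [hs, ← hw, map_smul, smul_pow, rescale_sq, sq]
  rw [𝒱.star_of_mem h.w_mem, residue_apply] at hww
  simp only [sum_range_succ, sum_range_zero, h.Y_W] at hww
  norm_num [Nat.choose] at hww
  rw [w5, w4, w3] at hww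
  simp only [map_add, map_sub, map_smul, l222, l33, l24, l6]
  rw [← hww]
  algebra with ℂ

/-- The relations in `O(V)` reduce every `W_n Ω`, `n ≤ -4`, to a multiple of `W_{-3} Ω`. -/
theorem IsStructure.map_vs' (h : R.IsStructure 𝒱) (hR : R.Generated)
    (hO : ∀ v ∈ 𝒱.O, φ v = 0) (hs : ∀ a b, φ (𝒱.star a b) = φ a * φ b) :
    φ ((9 / 2 : ℂ) • R.W (-6) R.Ω + (9 : ℂ) • R.L (-3) (R.W (-3) R.Ω)
      - (6 : ℂ) • R.L (-2) (R.W (-4) R.Ω)) = 0 := by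
  have rel := fun i => hO _ (h.W_rel_mem_O i R.Ω)
  have r0 := rel 0
  have r1 := rel 1
  have r2 := rel 2
  norm_num [R.W_vac] at r0 r1 r2
  have k1 := h.map_L_neg_of_mem hR hO hs 2 h.w_mem
  have k2 := h.map_L_neg_of_mem hR hO hs 1 (h.word_mem (l := [.W (-4)]) (N := 4) rfl)
  rw [word_W, word_nil] at k2
  norm_num at k1 k2
  have x4 : φ (R.W (-4) R.Ω) = (-3 : ℂ) • φ (R.W (-3) R.Ω) := by
    rw [eq_neg_of_add_eq_zero_left r0]; module
  have x5 : φ (R.W (-5) R.Ω) = (6 : ℂ) • φ (R.W (-3) R.Ω) := by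
    rw [add_assoc] at r1
    rw [eq_neg_of_add_eq_zero_left r1, x4]; module
  have x6 : φ (R.W (-6) R.Ω) = (-10 : ℂ) • φ (R.W (-3) R.Ω) := by
    rw [add_assoc, add_assoc] at r2
    rw [eq_neg_of_add_eq_zero_left r2, x4, x5]; module
  simp only [map_add, map_sub, map_smul, k1, k2, x6, x4]
  algebra with ℂ

end Classes

end VacuumRep

theorem smul_vac_vs : vs = (3 / 2 : ℂ) • opW (-2) (-3) (opW (-2) (-3) (vac (-2)))
    - (19 / 36 : ℂ) • opL (-2) (-3) (opL (-2) (-3) (vac (-2)))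
    - (8 / 9 : ℂ) • opL (-2) (-2) (opL (-2) (-2) (opL (-2) (-2) (vac (-2))))
    - (14 / 9 : ℂ) • opL (-2) (-2) (opL (-2) (-4) (vac (-2)))
    + (44 / 9 : ℂ) • opL (-2) (-6) (vac (-2)) := by
  simp only [vs, opL_apply, opW_apply, add_smul, sub_smul, smul_assoc, mul_smul, pow_succ, pow_zero,
    one_mul]

theorem smul_vac_vs' : vs' = (9 / 2 : ℂ) • opW (-2) (-6) (vac (-2))
    + (9 : ℂ) • opL (-2) (-3) (opW (-2) (-3) (vac (-2)))
    - (6 : ℂ) • opL (-2) (-2) (opW (-2) (-4) (vac (-2))) := by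
  simp only [vs', opL_apply, opW_apply, add_smul, sub_smul, smul_assoc, mul_smul]

theorem IsVacuumVertexAlgebra.isStructure {c : ℂ} {𝒱 : VertexAlgebra (VacuumModule c)}
    (h : IsVacuumVertexAlgebra c 𝒱) : (vacRep c).IsStructure 𝒱 :=
  ⟨h.vac_eq, h.L0_eq, h.field_T, h.field_W⟩

end WThree

theorem mainTheorem4 :
    (∃ 𝒱 : VertexAlgebra (WThree.VacuumModule (-2)), WThree.IsVacuumVertexAlgebra (-2) 𝒱) ∧
    ∀ 𝒱 : VertexAlgebra (WThree.VacuumModule (-2)), WThree.IsVacuumVertexAlgebra (-2) 𝒱 →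
      (∃ σ : 𝒱.ZhuAlgebra ≃ₗ[ℂ] MvPolynomial (Fin 2) ℂ,
        WThree.IsZhuPolynomialIso (-2) 𝒱 σ) ∧
      ∀ σ : 𝒱.ZhuAlgebra ≃ₗ[ℂ] MvPolynomial (Fin 2) ℂ,
        WThree.IsZhuPolynomialIso (-2) 𝒱 σ →
          σ (𝒱.zhuClass WThree.vs) =
            MvPolynomial.X 1 ^ 2 - MvPolynomial.C (1 / 9 : ℂ) * MvPolynomial.X 0 ^ 2 *
              (8 * MvPolynomial.X 0 + 1) ∧
          σ (𝒱.zhuClass WThree.vs') = 0 := by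
  refine ⟨WThree.exists_isVacuumVertexAlgebra (-2), fun 𝒱 h => ?_⟩
  have hS := h.isStructure
  have hR := WThree.vacRep_generated (-2)
  have hw : (WThree.rescale • WThree.genW (-3)) • WThree.vac (-2) =
      WThree.rescale • (WThree.vacRep (-2)).W (-3) (WThree.vacRep (-2)).Ω :=
    smul_assoc (M := ℂ) (N := WThree.FreeAlg) (α := WThree.VacuumModule (-2)) _ _ _
  refine ⟨?_, fun σ hσ => ?_⟩
  · obtain ⟨Ψ, h1, h2, h3, h4⟩ := WThree.VacuumRep.exists_map_mvPolynomial hR hS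
      (fun R' => R'.exists_hom)
    obtain ⟨σ, e1, e2, e3⟩ := hS.exists_iso hR h1 h2 h3 h4
    exact ⟨σ, e1, e2, by rw [hw]; exact e3⟩
  · let φ : WThree.VacuumModule (-2) →ₗ[ℂ] MvPolynomial (Fin 2) ℂ := σ.toLinearMap ∘ₗ 𝒱.O.mkQ
    have hO : ∀ v ∈ 𝒱.O, φ v = 0 := fun v hv => by
      have : 𝒱.O.mkQ v = 0 := (Submodule.Quotient.mk_eq_zero _).mpr hv
      change σ (𝒱.O.mkQ v) = 0
      rw [this, map_zero]
    have hs : ∀ a b, φ (𝒱.star a b) = φ a * φ b := hσ.isAlgebraIso.map_star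
    have hΩ : φ (WThree.vacRep (-2)).Ω = 1 := by
      rw [← hS.vac_eq]; exact hσ.isAlgebraIso.map_vac
    have e1 := hS.map_vs hR hO hs hΩ hσ.map_L
      (show φ _ = MvPolynomial.X 1 by rw [← hw]; exact hσ.map_W)
    have e2 := hS.map_vs' hR hO hs
    constructor
    · rw [WThree.smul_vac_vs]
      refine e1.trans ?_
      rw [MvPolynomial.smul_eq_C_mul, mul_assoc]
    · rw [WThree.smul_vac_vs']
      exact e2
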